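/- \textbf{Setting.} Let $n\ge 2$ and let $(\mathcal S_0,\sigma_{ij})$ be a compact, connected, smooth Riemannian $n$-manifold without boundary, with Laplace--Beltrami operator $\Delta$ and scalar curvature $R$ (positive on round spheres). Let $\mathcal G$ be a compact, connected, semi-simple Lie group with Lie algebra $\mathfrak g$, let $\gamma_{ab}$ be the Cartan--Killing metric of $\mathfrak g$ (the negative of the Killing form, which is positive definite), let $E_0$ be a smooth vector bundle over $\mathcal S_0$ with fibre $\mathfrak g$ and structure group $\mathrm{Ad}(\mathcal G)$ (an adjoint bundle), and let $A=(A^a_i)$ be a smooth connection in $E_0$ with curvature $F_{ij}=\partial_iA_j-\partial_jA_i+[A_i,A_j]$. Put $F_{ij}F^{ij}=\gamma_{ab}\,\sigma^{ik}\sigma^{jl}F^a_{ij}F^b_{kl}$, and let $\alpha_1,\alpha_2>0$ and $m\ge 0$ be constants. A number $\mu\in\mathbb R$ is called an eigenvalue of an operator $Lv=-(n-1)\Delta v+Wv$ with real coefficient $W\in C^\infty(\mathcal S_0)$ if there is a function $v\in H^{1,2}(\mathcal S_0,\mathbb C)$, $v\ne 0$, which solves $Lv=\mu v$ weakly, i.e.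 $\int_{\mathcal S_0}\overline{L\varphi}\,v=\mu\int_{\mathcal S_0}\overline{\varphi}\,v$ for all $\varphi\in C^\infty(\mathcal S_0,\mathbb C)$. \textbf{Theorem.} Assume that $R\le 0$ everywhere and that at least one of the functions $R$ and $F_{ij}F^{ij}$ does not vanish identically. Then: (i) The operator $$-(n-1)\Delta v-\tfrac n2Rv+\alpha_1\tfrac n8F_{ij}F^{ij}v$$ has a smallest eigenvalue, and this eigenvalue is strictly positive. (ii) Let $\Phi=(\Phi^a)$ be a smooth section of $E_0$ (a Higgs field) with covariant derivative $\Phi_i=\partial_i\Phi+[A_i,\Phi]$, and let $V\ge 0$ be a smooth function on $E_0$. Then the eigenvalue problem $$-(n-1)\Delta v-\tfrac n2Rv+\alpha_1\tfrac n8F_{ij}F^{ij}v+\alpha_2\tfrac n4\gamma_{ab}\sigma^{ij}\Phi^a_i\Phi^b_jv+\alpha_2\tfrac n2mV(\Phi)v=\mu v$$ has a mass gap: it has a smallest eigenvalue $\mu_0$, and $\mu_0>0$. The same holds if $\Phi$ is instead a smooth real-valued function on $\mathcal S_0$, $V\ge 0$ is a smooth function on $\mathbb R$, and $\gamma_{ab}\sigma^{ij}\Phi^a_i\Phi^b_j$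 is replaced by $\sigma^{ij}\Phi_i\Phi_j$. -/

import Mathlib

open scoped Manifold ContDiff Matrix ComplexConjugate
open MeasureTheory Filter Topology Bundle

/-! ### Riemannian geometry in charts

Throughout, `S` is a smooth `n`-manifold without boundary and `g` a smooth Riemannian metric on it.
A point `p : S` selects the preferred chart `extChartAt (𝓡 n) p` around `p`; a variable `y` is a
point of `ℝⁿ` in the range of that chart. -/

/-- A smooth Riemannian metric on the manifold `S`. -/
abbrev RMetric (n : ℕ) (S : Type*) [TopologicalSpace S] [ChartedSpace (EuclideanSpace ℝ (Fin n)) S]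
    [IsManifold (𝓡 n) ∞ S] : Type _ :=
  ContMDiffRiemannianMetric (𝓡 n) ∞ (EuclideanSpace ℝ (Fin n))
    (fun x : S => TangentSpace (𝓡 n) x)

/-- The partial derivative `∂f/∂yⁱ` of a function on `ℝⁿ`. -/
noncomputable def pd {n : ℕ} {F : Type*} [NormedAddCommGroup F] [NormedSpace ℝ F] (i : Fin n)
    (f : EuclideanSpace ℝ (Fin n) → F) (y : EuclideanSpace ℝ (Fin n)) : F :=
  fderiv ℝ f y (EuclideanSpace.single i 1)

section Geometry

variable {n : ℕ} {S : Type*} [TopologicalSpace S] [ChartedSpace (EuclideanSpace ℝ (Fin n)) S]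

/-- The coordinate vector field `∂ᵢ` of the chart at `p`, at the point with coordinates `y`. -/
noncomputable def coordVec (p : S) (y : EuclideanSpace ℝ (Fin n)) (i : Fin n) :
    TangentSpace (𝓡 n) ((extChartAt (𝓡 n) p).symm y) :=
  mfderiv 𝓘(ℝ, EuclideanSpace ℝ (Fin n)) (𝓡 n) (extChartAt (𝓡 n) p).symm y
    (EuclideanSpace.single i 1)

variable [IsManifold (𝓡 n) ∞ S]

/-- The coefficients `g_{ij}` of the metric in the chart at `p`. -/
noncomputable def metricCoeff (g : RMetric n S) (p : S) (y : EuclideanSpace ℝ (Fin n)) :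
    Matrix (Fin n) (Fin n) ℝ :=
  Matrix.of fun i j => g.inner _ (coordVec p y i) (coordVec p y j)

/-- The coefficients `g^{ij}` of the inverse metric in the chart at `p`. -/
noncomputable def metricInv (g : RMetric n S) (p : S) (y : EuclideanSpace ℝ (Fin n)) :
    Matrix (Fin n) (Fin n) ℝ :=
  (metricCoeff g p y)⁻¹

/-- The Riemannian density `√(det g_{ij})` in the chart at `p`. -/
noncomputable def metricDensity (g : RMetric n S) (p : S) (y : EuclideanSpace ℝ (Fin n)) : ℝ :=
  Real.sqrt (metricCoeff g p y).det

/-- The Christoffel symbols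
`Γᵏᵢⱼ = ½ gᵏˡ (∂ᵢ g_{jl} + ∂ⱼ g_{il} - ∂ₗ g_{ij})` in the chart at `p`. -/
noncomputable def christoffel (g : RMetric n S) (p : S) (k i j : Fin n)
    (y : EuclideanSpace ℝ (Fin n)) : ℝ :=
  (1 / 2) * ∑ l, metricInv g p y k l *
    (pd i (fun z => metricCoeff g p z j l) y + pd j (fun z => metricCoeff g p z i l) y
      - pd l (fun z => metricCoeff g p z i j) y)

/-- The Ricci tensor
`R_{jk} = ∂ᵢ Γⁱⱼₖ - ∂ⱼ Γⁱᵢₖ + Γⁱᵢₗ Γˡⱼₖ - Γⁱⱼₗ Γˡᵢₖ` in the chart at `p`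
(positive on round spheres). -/
noncomputable def ricciCoeff (g : RMetric n S) (p : S) (j k : Fin n)
    (y : EuclideanSpace ℝ (Fin n)) : ℝ :=
  ∑ i, (pd i (christoffel g p i j k) y - pd j (christoffel g p i i k) y
    + ∑ l, (christoffel g p i i l y * christoffel g p l j k y
      - christoffel g p i j l y * christoffel g p l i k y))

/-- The scalar curvature `R = g^{jk} R_{jk}`, evaluated at `p` in the chart at `p`. -/
noncomputable def scalarCurvature (g : RMetric n S) (p : S) : ℝ :=
  ∑ j, ∑ k, metricInv g p (extChartAt (𝓡 n) p p) j k * ricciCoeff g p j k (extChartAt (𝓡 n) p p)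

/-- The squared norm `|du|² = g^{ij} Re(conj(∂ᵢu) ∂ⱼu)` of the differential of a complex-valued
function. -/
noncomputable def gradNormSq (g : RMetric n S) (u : S → ℂ) (p : S) : ℝ :=
  ∑ i, ∑ j, metricInv g p (extChartAt (𝓡 n) p p) i j *
    (conj (pd i (fun y => u ((extChartAt (𝓡 n) p).symm y)) (extChartAt (𝓡 n) p p)) *
      pd j (fun y => u ((extChartAt (𝓡 n) p).symm y)) (extChartAt (𝓡 n) p p)).re

/-- The Laplace–Beltrami operator
`Δu = (1/√det g) ∂ᵢ(√det g · g^{ij} ∂ⱼu)` on complex-valued functions. -/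
noncomputable def laplaceBeltrami (g : RMetric n S) (u : S → ℂ) (p : S) : ℂ :=
  ((metricDensity g p (extChartAt (𝓡 n) p p) : ℝ) : ℂ)⁻¹ *
    ∑ i, pd i (fun y => ∑ j, ((metricDensity g p y * metricInv g p y i j : ℝ) : ℂ) *
      pd j (fun z => u ((extChartAt (𝓡 n) p).symm z)) y) (extChartAt (𝓡 n) p p)

variable [MeasurableSpace S]

/-- The Riemannian volume measure on the domain of the chart at `p` (zero outside this domain):
the image of `√(det g_{ij}) dy` under the inverse of the chart. -/
noncomputable def chartVolume (g : RMetric n S) (p : S) : Measure S :=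
  Measure.map (extChartAt (𝓡 n) p).symm
    ((volume.restrict (extChartAt (𝓡 n) p).target).withDensity
      (fun y => ENNReal.ofReal (metricDensity g p y)))

/-- The Riemannian volume measure. The measures `chartVolume g p` are its restrictions to the
domains of the charts, and (as countably many of these domains cover `S`) it is the least measure
which dominates them all. -/
noncomputable def riemannianVolume (g : RMetric n S) : Measure S :=
  ⨆ p : S, chartVolume g p

/-- The Sobolev space `H^{1,2}(S, ℂ)`: the functions of class `L²` which are `L²`-limits of a
sequence of smooth functions whose differentials form a Cauchy sequence in `L²`, i.e. the completion
of `C^∞(S, ℂ)` (for compact `S`) with respect to the norm `(∫ |u|² + |du|²)^{1/2}`. -/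
def MemH12 (g : RMetric n S) (v : S → ℂ) : Prop :=
  MemLp v 2 (riemannianVolume g) ∧
  ∃ u : ℕ → S → ℂ, (∀ k, ContMDiff (𝓡 n) 𝓘(ℝ, ℂ) ∞ (u k)) ∧
    Tendsto (fun k => ∫ x, ‖u k x - v x‖ ^ 2 ∂(riemannianVolume g)) atTop (𝓝 0) ∧
    Tendsto (fun kl : ℕ × ℕ =>
      ∫ x, gradNormSq g (fun y => u kl.1 y - u kl.2 y) x ∂(riemannianVolume g)) atTop (𝓝 0)

/-- The operator `v ↦ -(n-1) Δv + W v`. -/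
noncomputable def ellipticOp (g : RMetric n S) (W : S → ℝ) (v : S → ℂ) (x : S) : ℂ :=
  -((n : ℂ) - 1) * laplaceBeltrami g v x + (W x : ℂ) * v x

/-- `μ` is an eigenvalue of the (formally self-adjoint, real) operator `-(n-1) Δ + W` on the closed
manifold `S`: the equation `-(n-1) Δv + W v = μ v` has a weak solution `v ≠ 0` in `H^{1,2}(S, ℂ)`,
in the sense of testing with all smooth functions. -/
def IsEigenvalue (g : RMetric n S) (W : S → ℝ) (μ : ℝ) : Prop :=
  ∃ v : S → ℂ, MemH12 g v ∧ ¬ (v =ᵐ[riemannianVolume g] 0) ∧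
    ∀ φ : S → ℂ, ContMDiff (𝓡 n) 𝓘(ℝ, ℂ) ∞ φ →
      ∫ x, conj (ellipticOp g W φ x) * v x ∂(riemannianVolume g) =
        (μ : ℂ) * ∫ x, conj (φ x) * v x ∂(riemannianVolume g)

end Geometry

/-! ### Lie groups, adjoint bundles, connections

`G` is a Lie group of dimension `k`; its Lie algebra `𝔤 = T₁G` is Mathlib's `GroupLieAlgebra`,
whose underlying vector space is `ℝᵏ` (by definition of Mathlib's tangent spaces). -/

instance instLEInftyMinSmoothnessReal : ENat.LEInfty (minSmoothness ℝ 3) :=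
  ⟨by rw [minSmoothness_of_isRCLikeNormedField]; exact ENat.LEInfty.out⟩

section Gauge

variable {k : ℕ} (G : Type*) [TopologicalSpace G] [ChartedSpace (EuclideanSpace ℝ (Fin k)) G]
  [Group G]

/-- The Lie bracket of `𝔤 = T₁G`, read in `ℝᵏ`. -/
noncomputable def lieBr (a b : EuclideanSpace ℝ (Fin k)) : EuclideanSpace ℝ (Fin k) :=
  (⁅(show GroupLieAlgebra (𝓡 k) G from a), (show GroupLieAlgebra (𝓡 k) G from b)⁆ :
    GroupLieAlgebra (𝓡 k) G)

/-- The Cartan–Killing metric `γ(a, b) = -tr(ad a ∘ ad b)` of `𝔤`, with the sign for which it is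
positive definite when `G` is compact and semi-simple. -/
noncomputable def cartanKilling [LieGroup (𝓡 k) ∞ G] (a b : EuclideanSpace ℝ (Fin k)) : ℝ :=
  -killingForm ℝ (GroupLieAlgebra (𝓡 k) G) (show GroupLieAlgebra (𝓡 k) G from a)
    (show GroupLieAlgebra (𝓡 k) G from b)

variable {G} in
/-- The adjoint representation: `Ad h` is the differential at `1` of `x ↦ h x h⁻¹`. -/
noncomputable def Ad (h : G) : EuclideanSpace ℝ (Fin k) →L[ℝ] EuclideanSpace ℝ (Fin k) :=
  (mfderiv (𝓡 k) (𝓡 k) (fun x : G => h * x * h⁻¹) 1 :)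

variable {n : ℕ} {S : Type*} [TopologicalSpace S] [ChartedSpace (EuclideanSpace ℝ (Fin n)) S]
  {ι : Type*}

/-- The vector bundle with fibre `𝔤` given by the cocycle `Z` has structure group `Ad(G)`. -/
def HasAdStructureGroup (Z : VectorBundleCore ℝ S (EuclideanSpace ℝ (Fin k)) ι) : Prop :=
  ∀ i j, ∀ x ∈ Z.baseSet i ∩ Z.baseSet j, ∃ h : G, Z.coordChange i j x = Ad h

/-- A smooth connection in the adjoint bundle `Z`: in the trivialization over `Z.baseSet i` it is
given by a smooth `𝔤`-valued `1`-form `A i = (A^a_μ)`, and the covariant derivatives `dΦ + [A, Φ]`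
computed in two trivializations agree. (Only the values of `A i` over `Z.baseSet i` matter.) -/
structure AdConnection [IsManifold (𝓡 n) ∞ S]
    (Z : VectorBundleCore ℝ S (EuclideanSpace ℝ (Fin k)) ι) where
  /-- the local connection forms -/
  form : ι → (x : S) → TangentSpace (𝓡 n) x →L[ℝ] EuclideanSpace ℝ (Fin k)
  smooth : ∀ i, ContMDiffOn (𝓡 n)
    ((𝓡 n).prod 𝓘(ℝ, EuclideanSpace ℝ (Fin n) →L[ℝ] EuclideanSpace ℝ (Fin k))) ∞
    (fun x => TotalSpace.mk' (EuclideanSpace ℝ (Fin n) →L[ℝ] EuclideanSpace ℝ (Fin k))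
      (E := fun x : S => TangentSpace (𝓡 n) x →L[ℝ] Bundle.Trivial S (EuclideanSpace ℝ (Fin k)) x)
      x (form i x)) (Z.baseSet i)
  compat : ∀ i j, ∀ x ∈ Z.baseSet i ∩ Z.baseSet j, ∀ (X : TangentSpace (𝓡 n) x)
    (ξ : EuclideanSpace ℝ (Fin k)),
    (show EuclideanSpace ℝ (Fin k) →L[ℝ] EuclideanSpace ℝ (Fin k) from
        mfderiv (𝓡 n) 𝓘(ℝ, EuclideanSpace ℝ (Fin k) →L[ℝ] EuclideanSpace ℝ (Fin k))
          (Z.coordChange i j) x X) ξ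
      + lieBr G (form j x X) (Z.coordChange i j x ξ)
      = Z.coordChange i j x (lieBr G (form i x X) ξ)

variable [IsManifold (𝓡 n) ∞ S] {Z : VectorBundleCore ℝ S (EuclideanSpace ℝ (Fin k)) ι}
variable {G}

/-- The components `A_i = (A^a_i)` of the connection, in the chart at `p` and the preferred
trivialization at `p`. -/
noncomputable def AdConnection.coeff (A : AdConnection G (n := n) Z) (p : S) (i : Fin n)
    (y : EuclideanSpace ℝ (Fin n)) : EuclideanSpace ℝ (Fin k) :=
  A.form (Z.indexAt p) ((extChartAt (𝓡 n) p).symm y) (coordVec p y i)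

/-- The curvature `F_{ij} = ∂ᵢA_j - ∂ⱼA_i + [A_i, A_j] ∈ 𝔤` at `p`. -/
noncomputable def AdConnection.curv (A : AdConnection G (n := n) Z) (p : S) (i j : Fin n) :
    EuclideanSpace ℝ (Fin k) :=
  pd i (A.coeff p j) (extChartAt (𝓡 n) p p) - pd j (A.coeff p i) (extChartAt (𝓡 n) p p)
    + lieBr G (A.coeff p i (extChartAt (𝓡 n) p p)) (A.coeff p j (extChartAt (𝓡 n) p p))

/-- The function `F_{ij}F^{ij} = γ_{ab} g^{ik} g^{jl} F^a_{ij} F^b_{kl}`. -/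
noncomputable def AdConnection.curvSq [LieGroup (𝓡 k) ∞ G] (A : AdConnection G (n := n) Z)
    (g : RMetric n S) (p : S) : ℝ :=
  ∑ i, ∑ j, ∑ r, ∑ l, metricInv g p (extChartAt (𝓡 n) p p) i r *
    metricInv g p (extChartAt (𝓡 n) p p) j l * cartanKilling G (A.curv p i j) (A.curv p r l)

/-- The covariant derivative `Φ_i = ∂ᵢΦ + [A_i, Φ]` of a section of the adjoint bundle at `p`. -/
noncomputable def AdConnection.covDeriv (A : AdConnection G (n := n) Z) (Φ : (x : S) → Z.Fiber x)
    (p : S) (i : Fin n) : EuclideanSpace ℝ (Fin k) :=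
  pd i (fun y => Z.coordChange (Z.indexAt ((extChartAt (𝓡 n) p).symm y)) (Z.indexAt p)
      ((extChartAt (𝓡 n) p).symm y) (Φ ((extChartAt (𝓡 n) p).symm y))) (extChartAt (𝓡 n) p p)
    + lieBr G (A.coeff p i (extChartAt (𝓡 n) p p)) (Φ p)

/-- The function `γ_{ab} g^{ij} Φ^a_i Φ^b_j`. -/
noncomputable def AdConnection.higgsSq [LieGroup (𝓡 k) ∞ G] (A : AdConnection G (n := n) Z)
    (g : RMetric n S) (Φ : (x : S) → Z.Fiber x) (p : S) : ℝ :=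
  ∑ i, ∑ j, metricInv g p (extChartAt (𝓡 n) p p) i j *
    cartanKilling G (A.covDeriv Φ p i) (A.covDeriv Φ p j)

/-- The zero-order coefficient `-(n/2) R + α₁ (n/8) F_{ij}F^{ij}`. -/
noncomputable def ymPotential [LieGroup (𝓡 k) ∞ G] (g : RMetric n S) (A : AdConnection G (n := n) Z)
    (α₁ : ℝ) (x : S) : ℝ :=
  -((n : ℝ) / 2) * scalarCurvature g x + α₁ * ((n : ℝ) / 8) * A.curvSq g x

/-- The zero-order coefficient
`-(n/2) R + α₁ (n/8) F_{ij}F^{ij} + α₂ (n/4) γ_{ab} g^{ij} Φ^a_i Φ^b_j + α₂ (n/2) m V(Φ)`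
for a Higgs field `Φ` with values in the adjoint bundle and a function `V` on that bundle. -/
noncomputable def higgsPotential [LieGroup (𝓡 k) ∞ G] (g : RMetric n S)
    (A : AdConnection G (n := n) Z) (Φ : (x : S) → Z.Fiber x)
    (V : TotalSpace (EuclideanSpace ℝ (Fin k)) Z.Fiber → ℝ) (α₁ α₂ m : ℝ) (x : S) : ℝ :=
  ymPotential g A α₁ x + α₂ * ((n : ℝ) / 4) * A.higgsSq g Φ x
    + α₂ * ((n : ℝ) / 2) * m * V ⟨x, Φ x⟩

/-- The same coefficient for a scalar field `Φ` in place of the Higgs field; the gradient term is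
then `g^{ij} Φ_i Φ_j = |dΦ|²`. -/
noncomputable def scalarPotential [LieGroup (𝓡 k) ∞ G] (g : RMetric n S)
    (A : AdConnection G (n := n) Z) (Φ : S → ℝ) (V : ℝ → ℝ) (α₁ α₂ m : ℝ) (x : S) : ℝ :=
  ymPotential g A α₁ x + α₂ * ((n : ℝ) / 4) * gradNormSq g (fun y => (Φ y : ℂ)) x
    + α₂ * ((n : ℝ) / 2) * m * V (Φ x)

end Gauge

/-!
All the operators in question have the form `L = -(n-1)Δ + W`, where the potential `W` is continuous,
nonnegative and not identically zero. For such an operator the theorem is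
`exists_isLeast_eigenvalue_pos`; what remains is to check these three properties of the potentials.

**The potentials.** The scalar curvature, `F_{ij}F^{ij}` and `γ_{ab} g^{ij} Φ^a_i Φ^b_j` are defined at
each point in the preferred chart and the preferred trivialization at that point, which vary
discontinuously. Their continuity therefore amounts to their invariance under changes of charts and of
trivializations. The Christoffel symbols (read as a connection form with values in the endomorphisms of
`ℝⁿ`) and the adjoint action of the gauge field satisfy the same transformation law, under which the
curvature `dη + η ∧ η` is covariant (`curvForm_gauge`). The form `γ` is `-tr(ad a ∘ ad b)`; it is
invariant because `Ad h` is an automorphism of the Lie algebra (`Ad_lieBr`), and nonnegative because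
averaging over the compact group gives an inner product for which all operators `ad a` are skew
(`cartanKilling_nonneg`). With `R ≤ 0` every term of the potentials is nonnegative, so nothing cancels.

**Existence of the smallest eigenvalue.** Green's formula (`integral_conj_laplaceBeltrami_mul`) shows that
`L` is represented on smooth functions by the energy form `Q(u, v) = (n-1)∫⟨du, dv⟩ + ∫ W conj(u) v`,
and `Q` is minimized on the unit sphere of `L²`. The compactness this needs is the Rellich theorem; it
enters as Friedrichs' inequality (`exists_friedrichs`): for each `ε > 0` one has
`‖u‖² ≤ ε ∫|du|² + ∑ wᵢ |ℓᵢ(u)|²` with finitely many `L²`-bounded functionals `ℓᵢ`, namely integrals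
over the cubes of fine grids in finitely many charts. A minimizing sequence for which the countably many
functionals converge is Cauchy in `L²` and in energy, so that its limit lies in `H^{1,2}` and is a weak
eigenfunction for the minimal value `μ₀` (`exists_minimizer`). Any other eigenfunction is a limit of smooth
functions in `H^{1,2}`, and testing its equation with them gives `μ₀ ≤ μ` (`le_of_weak_eigenvector`). No
regularity theory is used.

**Positivity.** If `μ₀` were zero, the energies of the minimizing sequence would tend to zero. By the
local Poincaré inequality (`exists_poincare_nhds`) its limit is locally constant, and it vanishes where `W`
is positive; as the manifold is connected, it vanishes everywhere, although its norm is one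
(`ae_eq_zero_of_energy_tendsto_zero`).
-/

set_option synthInstance.maxHeartbeats 200000

/-! ### Charts and transition maps -/

section Charts

variable {n : ℕ} {S : Type*} [TopologicalSpace S] [ChartedSpace (EuclideanSpace ℝ (Fin n)) S]

/-- The differential of the inverse chart at `p`, read as an endomorphism of `ℝⁿ` by means of the
identification of every tangent space with `ℝⁿ`. -/
noncomputable def dsymm (p : S) (y : EuclideanSpace ℝ (Fin n)) :
    EuclideanSpace ℝ (Fin n) →L[ℝ] EuclideanSpace ℝ (Fin n) :=
  (mfderiv 𝓘(ℝ, EuclideanSpace ℝ (Fin n)) (𝓡 n) (extChartAt (𝓡 n) p).symm y :)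

/-- The transition map from the chart at `p` to the chart at `q`. -/
noncomputable def transMap (p q : S) : EuclideanSpace ℝ (Fin n) → EuclideanSpace ℝ (Fin n) :=
  fun y => extChartAt (𝓡 n) q ((extChartAt (𝓡 n) p).symm y)

/-- The part of the image of the chart at `p` that corresponds to the domain of the chart at
`q`. -/
def overlap (p q : S) : Set (EuclideanSpace ℝ (Fin n)) :=
  (extChartAt (𝓡 n) p).target ∩ (extChartAt (𝓡 n) p).symm ⁻¹' (extChartAt (𝓡 n) q).source

lemma isOpen_target (p : S) : IsOpen (extChartAt (𝓡 n) p).target := isOpen_extChartAt_target p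

lemma isOpen_overlap (p q : S) : IsOpen (overlap (n := n) p q) :=
  (continuousOn_extChartAt_symm p).isOpen_inter_preimage (isOpen_target p)
    (isOpen_extChartAt_source q)

lemma chart_mem_overlap {p q x : S} (hp : x ∈ (extChartAt (𝓡 n) p).source)
    (hq : x ∈ (extChartAt (𝓡 n) q).source) : extChartAt (𝓡 n) p x ∈ overlap (n := n) p q :=
  ⟨(extChartAt (𝓡 n) p).map_source hp, by
    rw [Set.mem_preimage, (extChartAt (𝓡 n) p).left_inv hp]; exact hq⟩

lemma symm_transMap {p q : S} {y : EuclideanSpace ℝ (Fin n)} (hy : y ∈ overlap p q) :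
    (extChartAt (𝓡 n) q).symm (transMap p q y) = (extChartAt (𝓡 n) p).symm y :=
  (extChartAt (𝓡 n) q).left_inv hy.2

lemma transMap_mem_overlap {p q : S} {y : EuclideanSpace ℝ (Fin n)} (hy : y ∈ overlap p q) :
    transMap p q y ∈ overlap (n := n) q p :=
  ⟨(extChartAt (𝓡 n) q).map_source hy.2, by
    rw [Set.mem_preimage, symm_transMap hy]; exact (extChartAt (𝓡 n) p).map_target hy.1⟩

lemma transMap_mem_target {p q : S} {y : EuclideanSpace ℝ (Fin n)} (hy : y ∈ overlap p q) :
    transMap p q y ∈ (extChartAt (𝓡 n) q).target := (transMap_mem_overlap hy).1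

lemma transMap_transMap {p q : S} {y : EuclideanSpace ℝ (Fin n)} (hy : y ∈ overlap p q) :
    transMap q p (transMap p q y) = y := by
  rw [transMap, symm_transMap hy, (extChartAt (𝓡 n) p).right_inv hy.1]

lemma transMap_chart {p q x : S} (hp : x ∈ (extChartAt (𝓡 n) p).source) :
    transMap p q (extChartAt (𝓡 n) p x) = extChartAt (𝓡 n) q x := by
  rw [transMap, (extChartAt (𝓡 n) p).left_inv hp]

/-- A function on the manifold which is given near each point by a function of the coordinates that
is continuous on the whole chart domain is continuous. -/
lemma continuous_of_chart {X : Type*} [TopologicalSpace X] {f : S → X}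
    (h : ∀ p : S, ∃ ℓ : EuclideanSpace ℝ (Fin n) → X, ∃ U ∈ 𝓝 p,
      ContinuousAt ℓ (extChartAt (𝓡 n) p p) ∧ ∀ x ∈ U, f x = ℓ (extChartAt (𝓡 n) p x)) :
    Continuous f := by
  rw [continuous_iff_continuousAt]
  intro p
  obtain ⟨ℓ, U, hU, hl, hf⟩ := h p
  have h1 : ContinuousAt (fun x => ℓ (extChartAt (𝓡 n) p x)) p :=
    ContinuousAt.comp (g := ℓ) hl (continuousAt_extChartAt p)
  exact h1.congr (Filter.mem_of_superset hU fun x hx => (hf x hx).symm)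

variable [IsManifold (𝓡 n) ∞ S]

lemma contDiffOn_transMap (p q : S) :
    ContDiffOn ℝ ∞ (transMap (n := n) p q) (overlap p q) := by
  have h := contDiffOn_ext_coord_change (I := 𝓡 n) (n := ∞) q p
  refine (h.congr fun y _ => rfl).mono ?_
  intro y hy
  rw [PartialEquiv.trans_source]
  exact ⟨hy.1, hy.2⟩

lemma contDiffAt_transMap {p q : S} {y : EuclideanSpace ℝ (Fin n)} (hy : y ∈ overlap p q) :
    ContDiffAt ℝ ∞ (transMap p q) y :=
  (contDiffOn_transMap p q).contDiffAt ((isOpen_overlap p q).mem_nhds hy)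

lemma differentiableAt_transMap {p q : S} {y : EuclideanSpace ℝ (Fin n)} (hy : y ∈ overlap p q) :
    DifferentiableAt ℝ (transMap p q) y :=
  (contDiffAt_transMap hy).differentiableAt (by simp)

lemma fderiv_transMap_comp {p q : S} {y : EuclideanSpace ℝ (Fin n)} (hy : y ∈ overlap p q) :
    fderiv ℝ (transMap q p) (transMap p q y) ∘L fderiv ℝ (transMap p q) y =
      ContinuousLinearMap.id ℝ _ := by
  rw [← fderiv_comp y (differentiableAt_transMap (transMap_mem_overlap hy))
    (differentiableAt_transMap hy)]
  have : transMap q p ∘ transMap p q =ᶠ[𝓝 y] id := by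
    filter_upwards [(isOpen_overlap p q).mem_nhds hy] with z hz using transMap_transMap hz
  rw [this.fderiv_eq, fderiv_id]

lemma fderiv_transMap_comp' {p q : S} {y : EuclideanSpace ℝ (Fin n)} (hy : y ∈ overlap p q) :
    fderiv ℝ (transMap p q) y ∘L fderiv ℝ (transMap q p) (transMap p q y) =
      ContinuousLinearMap.id ℝ _ := by
  have := fderiv_transMap_comp (transMap_mem_overlap hy)
  rwa [transMap_transMap hy] at this

lemma fderiv_transMap_surjective {p q : S} {y : EuclideanSpace ℝ (Fin n)} (hy : y ∈ overlap p q) :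
    Function.Surjective (fderiv ℝ (transMap p q) y) := fun X =>
  ⟨fderiv ℝ (transMap q p) (transMap p q y) X,
    congrArg (fun L => L X) (fderiv_transMap_comp' hy)⟩

lemma mdifferentiableAt_symm {p : S} {y : EuclideanSpace ℝ (Fin n)}
    (hy : y ∈ (extChartAt (𝓡 n) p).target) :
    MDifferentiableAt 𝓘(ℝ, EuclideanSpace ℝ (Fin n)) (𝓡 n) (extChartAt (𝓡 n) p).symm y :=
  ((contMDiffOn_extChartAt_symm (n := ∞) p).contMDiffAt
    ((isOpen_target p).mem_nhds hy)).mdifferentiableAt (by simp)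

lemma dsymm_eq_comp {p q : S} {y : EuclideanSpace ℝ (Fin n)} (hy : y ∈ overlap p q) :
    dsymm p y = dsymm q (transMap p q y) ∘L fderiv ℝ (transMap p q) y := by
  have h1 : (extChartAt (𝓡 n) p).symm =ᶠ[𝓝 y] (extChartAt (𝓡 n) q).symm ∘ transMap p q := by
    filter_upwards [(isOpen_overlap p q).mem_nhds hy] with z hz using (symm_transMap hz).symm
  have h2 := mfderiv_comp (I := 𝓘(ℝ, EuclideanSpace ℝ (Fin n)))
    (I' := 𝓘(ℝ, EuclideanSpace ℝ (Fin n))) (I'' := 𝓡 n) y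
    (mdifferentiableAt_symm (transMap_mem_target hy))
    (differentiableAt_transMap hy).mdifferentiableAt
  rw [mfderiv_eq_fderiv] at h2
  have h3 := h1.mfderiv_eq (I := 𝓘(ℝ, EuclideanSpace ℝ (Fin n))) (I' := 𝓡 n)
  exact h3.trans h2

lemma dsymm_injective {p : S} {y : EuclideanSpace ℝ (Fin n)}
    (hy : y ∈ (extChartAt (𝓡 n) p).target) : Function.Injective (dsymm p y) := by
  have h := mfderiv_extChartAt_comp_mfderivWithin_extChartAt_symm (I := 𝓡 n) hy
  rw [ModelWithCorners.Boundaryless.range_eq_univ, mfderivWithin_univ] at h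
  refine Function.LeftInverse.injective
    (g := fun X => mfderiv (𝓡 n) 𝓘(ℝ, EuclideanSpace ℝ (Fin n)) (extChartAt (𝓡 n) p)
      ((extChartAt (𝓡 n) p).symm y) X) fun X => ?_
  exact congrArg (fun L => L X) h

lemma dsymm_self (p : S) : dsymm p (extChartAt (𝓡 n) p p) = ContinuousLinearMap.id ℝ _ := by
  have h := mfderivWithin_range_extChartAt_symm (I := 𝓡 n) (x := p)
  rw [ModelWithCorners.Boundaryless.range_eq_univ, mfderivWithin_univ] at h
  exact h

/-- The coordinate vector fields with constant components are smooth sections of the tangent bundle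
along the inverse chart. -/
lemma contMDiffOn_dsymm (p : S) (X : EuclideanSpace ℝ (Fin n)) :
    ContMDiffOn 𝓘(ℝ, EuclideanSpace ℝ (Fin n)) (𝓡 n).tangent ∞
      (fun y => (TotalSpace.mk' (EuclideanSpace ℝ (Fin n)) ((extChartAt (𝓡 n) p).symm y)
        (dsymm p y X) : TangentBundle (𝓡 n) S)) (extChartAt (𝓡 n) p).target := by
  have h1 := (contMDiffOn_extChartAt_symm (I := 𝓡 n) (n := ∞) p).contMDiffOn_tangentMapWithin
    (m := ∞) le_rfl (isOpen_target p).uniqueMDiffOn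
  have h2 : ContMDiffOn 𝓘(ℝ, EuclideanSpace ℝ (Fin n)) 𝓘(ℝ, EuclideanSpace ℝ (Fin n)).tangent ∞
      (fun y => (TotalSpace.mk' (EuclideanSpace ℝ (Fin n)) y X :
        TangentBundle 𝓘(ℝ, EuclideanSpace ℝ (Fin n)) (EuclideanSpace ℝ (Fin n))))
      (extChartAt (𝓡 n) p).target :=
    contMDiffOn_vectorSpace_iff_contDiffOn.2 contDiffOn_const
  refine (h1.comp h2 fun y hy => hy).congr fun y hy => ?_
  simp only [Function.comp, tangentMapWithin]
  rw [mfderivWithin_of_isOpen (isOpen_target p) hy]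
  rfl

end Charts

/-! ### The metric in charts -/

/-- The standard basis vectors of `ℝⁿ`. -/
noncomputable abbrev stdE {n : ℕ} (i : Fin n) : EuclideanSpace ℝ (Fin n) :=
  EuclideanSpace.single i 1

lemma sum_smul_stdE {n : ℕ} (X : EuclideanSpace ℝ (Fin n)) : ∑ i, X i • stdE i = X := by
  ext j
  simp [Finset.sum_apply, Pi.single_apply]

section MatrixSmooth

variable {X : Type*} [NormedAddCommGroup X] [NormedSpace ℝ X] {ι : Type*} [Fintype ι]
  [DecidableEq ι]

lemma contDiffOn_det {M : X → Matrix ι ι ℝ} {s : Set X} {m : WithTop ℕ∞}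
    (h : ∀ i j, ContDiffOn ℝ m (fun x => M x i j) s) : ContDiffOn ℝ m (fun x => (M x).det) s := by
  simp only [Matrix.det_apply]
  exact ContDiffOn.sum fun σ _ => (contDiffOn_prod fun i _ => h _ _).const_smul _

lemma contDiffOn_matrix_inv {M : X → Matrix ι ι ℝ} {s : Set X} {m : WithTop ℕ∞}
    (h : ∀ i j, ContDiffOn ℝ m (fun x => M x i j) s) (hd : ∀ x ∈ s, (M x).det ≠ 0) (i j : ι) :
    ContDiffOn ℝ m (fun x => (M x)⁻¹ i j) s := by
  simp only [Matrix.inv_def, Ring.inverse_eq_inv', Matrix.smul_apply, Matrix.adjugate_apply,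
    smul_eq_mul]
  refine ((contDiffOn_det h).inv hd).mul (contDiffOn_det fun a b => ?_)
  by_cases hab : a = j
  · subst hab
    simp only [Matrix.updateRow_self]
    exact contDiffOn_const
  · simp only [Matrix.updateRow_ne hab]
    exact h a b

end MatrixSmooth

section Metric

variable {n : ℕ} {S : Type*} [TopologicalSpace S] [ChartedSpace (EuclideanSpace ℝ (Fin n)) S]

/-- The Jacobian matrix of the transition map. -/
noncomputable def jacMat (p q : S) (y : EuclideanSpace ℝ (Fin n)) : Matrix (Fin n) (Fin n) ℝ :=
  Matrix.of fun a i => fderiv ℝ (transMap p q) y (stdE i) a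

lemma jacMat_apply (p q : S) (y : EuclideanSpace ℝ (Fin n)) (a i : Fin n) :
    jacMat p q y a i = fderiv ℝ (transMap p q) y (stdE i) a := rfl

lemma jacMat_eq_toMatrix (p q : S) (y : EuclideanSpace ℝ (Fin n)) :
    jacMat p q y = LinearMap.toMatrix (EuclideanSpace.basisFun (Fin n) ℝ).toBasis
      (EuclideanSpace.basisFun (Fin n) ℝ).toBasis (fderiv ℝ (transMap p q) y).toLinearMap := by
  ext a i
  simp [jacMat_apply, LinearMap.toMatrix_apply]

lemma jacMat_det (p q : S) (y : EuclideanSpace ℝ (Fin n)) :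
    (jacMat p q y).det = (fderiv ℝ (transMap p q) y).det := by
  rw [jacMat_eq_toMatrix, LinearMap.det_toMatrix]

lemma fderiv_transMap_stdE (p q : S) (y : EuclideanSpace ℝ (Fin n)) (i : Fin n) :
    fderiv ℝ (transMap p q) y (stdE i) = ∑ a, jacMat p q y a i • stdE a :=
  (sum_smul_stdE _).symm

variable [IsManifold (𝓡 n) ∞ S]

/-- The metric at `x`, as a bilinear form on `ℝⁿ`, which is the underlying space of `T_x S`. -/
noncomputable def innerAt (g : RMetric n S) (x : S) :
    EuclideanSpace ℝ (Fin n) →L[ℝ] EuclideanSpace ℝ (Fin n) →L[ℝ] ℝ :=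
  (g.inner x :)

/-- The pullback of the metric under the inverse chart at `p`, as a bilinear form on `ℝⁿ`. -/
noncomputable def chartForm (g : RMetric n S) (p : S) (y : EuclideanSpace ℝ (Fin n)) :
    EuclideanSpace ℝ (Fin n) →L[ℝ] EuclideanSpace ℝ (Fin n) →L[ℝ] ℝ :=
  (innerAt g ((extChartAt (𝓡 n) p).symm y)).bilinearComp (dsymm p y) (dsymm p y)

lemma chartForm_apply (g : RMetric n S) (p : S) (y X Y : EuclideanSpace ℝ (Fin n)) :
    chartForm g p y X Y = innerAt g ((extChartAt (𝓡 n) p).symm y) (dsymm p y X) (dsymm p y Y) :=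
  rfl

lemma metricCoeff_apply (g : RMetric n S) (p : S) (y : EuclideanSpace ℝ (Fin n)) (i j : Fin n) :
    metricCoeff g p y i j = chartForm g p y (stdE i) (stdE j) := rfl

lemma chartForm_symm (g : RMetric n S) (p : S) (y X Y : EuclideanSpace ℝ (Fin n)) :
    chartForm g p y X Y = chartForm g p y Y X := g.symm _ _ _

lemma chartForm_pos (g : RMetric n S) {p : S} {y : EuclideanSpace ℝ (Fin n)}
    (hy : y ∈ (extChartAt (𝓡 n) p).target) {X : EuclideanSpace ℝ (Fin n)} (hX : X ≠ 0) :
    0 < chartForm g p y X X := by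
  refine g.pos _ _ fun h => hX (dsymm_injective hy ?_)
  rw [map_zero]
  exact h

lemma chartForm_trans (g : RMetric n S) {p q : S} {y : EuclideanSpace ℝ (Fin n)}
    (hy : y ∈ overlap p q) (X Y : EuclideanSpace ℝ (Fin n)) :
    chartForm g p y X Y = chartForm g q (transMap p q y) (fderiv ℝ (transMap p q) y X)
      (fderiv ℝ (transMap p q) y Y) := by
  rw [chartForm_apply, chartForm_apply, symm_transMap hy, dsymm_eq_comp hy]
  rfl

lemma contDiffOn_chartForm_apply (g : RMetric n S) (p : S) (X Y : EuclideanSpace ℝ (Fin n)) :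
    ContDiffOn ℝ ∞ (fun y => chartForm g p y X Y) (extChartAt (𝓡 n) p).target := by
  have h1 := g.contMDiff.comp_contMDiffOn (contMDiffOn_extChartAt_symm (I := 𝓡 n) (n := ∞) p)
  have h2 := ContMDiffOn.clm_bundle_apply₂ (F₁ := EuclideanSpace ℝ (Fin n))
    (E₁ := fun x : S => TangentSpace (𝓡 n) x) (F₂ := EuclideanSpace ℝ (Fin n))
    (E₂ := fun x : S => TangentSpace (𝓡 n) x) (F₃ := ℝ) (E₃ := Bundle.Trivial S ℝ)
    (b := (extChartAt (𝓡 n) p).symm) (ψ := fun y => g.inner ((extChartAt (𝓡 n) p).symm y))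
    (v := fun y => dsymm p y X) (w := fun y => dsymm p y Y)
    h1 (contMDiffOn_dsymm p X) (contMDiffOn_dsymm p Y)
  intro y hy
  have h3 := h2 y hy
  simp only [contMDiffWithinAt_totalSpace] at h3
  exact h3.2.contDiffWithinAt

lemma contDiffOn_chartForm (g : RMetric n S) (p : S) :
    ContDiffOn ℝ ∞ (chartForm g p) (extChartAt (𝓡 n) p).target :=
  contDiffOn_clm_apply.2 fun X => contDiffOn_clm_apply.2 fun Y => contDiffOn_chartForm_apply g p X Y

lemma contDiffOn_metricCoeff (g : RMetric n S) (p : S) (i j : Fin n) :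
    ContDiffOn ℝ ∞ (fun y => metricCoeff g p y i j) (extChartAt (𝓡 n) p).target :=
  contDiffOn_chartForm_apply g p _ _

lemma chartForm_eq_dotProduct (g : RMetric n S) (p : S) (y X Y : EuclideanSpace ℝ (Fin n)) :
    chartForm g p y X Y = ∑ i, ∑ j, X i * Y j * metricCoeff g p y i j := by
  conv_lhs => rw [← sum_smul_stdE X, ← sum_smul_stdE Y]
  simp only [map_sum, map_smul, sum_apply, smul_apply,
    metricCoeff_apply, smul_eq_mul, Finset.mul_sum]
  rw [Finset.sum_comm]
  exact Finset.sum_congr rfl fun i _ => Finset.sum_congr rfl fun j _ => by ring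

lemma metricCoeff_posDef (g : RMetric n S) {p : S} {y : EuclideanSpace ℝ (Fin n)}
    (hy : y ∈ (extChartAt (𝓡 n) p).target) : (metricCoeff g p y).PosDef := by
  refine Matrix.PosDef.of_dotProduct_mulVec_pos ?_ ?_
  · ext i j
    simp only [Matrix.conjTranspose_apply, metricCoeff_apply, star_trivial]
    exact chartForm_symm g p y _ _
  · intro x hx
    have h := chartForm_pos g hy (X := WithLp.toLp 2 x) (by simpa using hx)
    rw [chartForm_eq_dotProduct] at h
    simp only [dotProduct, Matrix.mulVec, star_trivial, Finset.mul_sum]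
    refine h.trans_eq ?_
    exact Finset.sum_congr rfl fun i _ => Finset.sum_congr rfl fun j _ => by ring

lemma metricCoeff_det_pos (g : RMetric n S) {p : S} {y : EuclideanSpace ℝ (Fin n)}
    (hy : y ∈ (extChartAt (𝓡 n) p).target) : 0 < (metricCoeff g p y).det :=
  (metricCoeff_posDef g hy).det_pos

lemma metricInv_posDef (g : RMetric n S) {p : S} {y : EuclideanSpace ℝ (Fin n)}
    (hy : y ∈ (extChartAt (𝓡 n) p).target) : (metricInv g p y).PosDef :=
  (metricCoeff_posDef g hy).inv

lemma metricInv_symm (g : RMetric n S) {p : S} {y : EuclideanSpace ℝ (Fin n)}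
    (hy : y ∈ (extChartAt (𝓡 n) p).target) (i j : Fin n) :
    metricInv g p y i j = metricInv g p y j i := by
  conv_lhs => rw [← (metricInv_posDef g hy).isHermitian]
  simp

lemma contDiffOn_metricInv (g : RMetric n S) (p : S) (i j : Fin n) :
    ContDiffOn ℝ ∞ (fun y => metricInv g p y i j) (extChartAt (𝓡 n) p).target :=
  contDiffOn_matrix_inv (contDiffOn_metricCoeff g p) (fun _ hy => (metricCoeff_det_pos g hy).ne') i j

lemma metricDensity_pos (g : RMetric n S) {p : S} {y : EuclideanSpace ℝ (Fin n)}
    (hy : y ∈ (extChartAt (𝓡 n) p).target) : 0 < metricDensity g p y :=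
  Real.sqrt_pos.2 (metricCoeff_det_pos g hy)

lemma contDiffOn_metricDensity (g : RMetric n S) (p : S) :
    ContDiffOn ℝ ∞ (metricDensity g p) (extChartAt (𝓡 n) p).target :=
  (contDiffOn_det (contDiffOn_metricCoeff g p)).sqrt fun _ hy => (metricCoeff_det_pos g hy).ne'

lemma metricCoeff_trans (g : RMetric n S) {p q : S} {y : EuclideanSpace ℝ (Fin n)}
    (hy : y ∈ overlap p q) :
    metricCoeff g p y = (jacMat p q y)ᵀ * metricCoeff g q (transMap p q y) * jacMat p q y := by
  ext i j
  rw [metricCoeff_apply, chartForm_trans g hy, chartForm_eq_dotProduct]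
  simp only [Matrix.mul_apply, Matrix.transpose_apply, jacMat_apply, Finset.sum_mul]
  rw [Finset.sum_comm]
  exact Finset.sum_congr rfl fun i _ => Finset.sum_congr rfl fun j _ => by ring

lemma jacMat_isUnit {p q : S} {y : EuclideanSpace ℝ (Fin n)}
    (hy : y ∈ overlap p q) : IsUnit (jacMat p q y).det := by
  rw [jacMat_det]
  have h := congrArg ContinuousLinearMap.det (fderiv_transMap_comp hy)
  rw [ContinuousLinearMap.det, ContinuousLinearMap.toLinearMap_comp, LinearMap.det_comp,
    ContinuousLinearMap.det, ContinuousLinearMap.coe_id, LinearMap.det_id] at h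
  exact IsUnit.of_mul_eq_one_right _ h

lemma metricInv_trans (g : RMetric n S) {p q : S} {y : EuclideanSpace ℝ (Fin n)}
    (hy : y ∈ overlap p q) :
    metricInv g q (transMap p q y) = jacMat p q y * metricInv g p y * (jacMat p q y)ᵀ := by
  have hJ := jacMat_isUnit hy
  have hJt : IsUnit (jacMat p q y)ᵀ.det := by rwa [Matrix.det_transpose]
  rw [metricInv, metricInv, metricCoeff_trans g hy, Matrix.mul_inv_rev, Matrix.mul_inv_rev,
    ← mul_assoc, ← mul_assoc, Matrix.mul_nonsing_inv _ hJ, one_mul, mul_assoc,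
    Matrix.nonsing_inv_mul _ hJt, mul_one]

lemma metricDensity_trans (g : RMetric n S) {p q : S} {y : EuclideanSpace ℝ (Fin n)}
    (hy : y ∈ overlap p q) :
    metricDensity g p y =
      |(fderiv ℝ (transMap p q) y).det| * metricDensity g q (transMap p q y) := by
  rw [metricDensity, metricCoeff_trans g hy, Matrix.det_mul, Matrix.det_mul, Matrix.det_transpose,
    jacMat_det, mul_right_comm, ← pow_two, Real.sqrt_mul (sq_nonneg _), Real.sqrt_sq_eq_abs, metricDensity]

/-- The trace of a bilinear map with respect to the inverse metric does not depend on the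
coordinates. -/
lemma metricInv_contract {M : Type*} [AddCommGroup M] [Module ℝ M] (g : RMetric n S) {p q : S}
    {y : EuclideanSpace ℝ (Fin n)} (hy : y ∈ overlap p q)
    (β : EuclideanSpace ℝ (Fin n) →ₗ[ℝ] EuclideanSpace ℝ (Fin n) →ₗ[ℝ] M) :
    ∑ i, ∑ j, metricInv g p y i j • β (fderiv ℝ (transMap p q) y (stdE i))
        (fderiv ℝ (transMap p q) y (stdE j)) =
      ∑ a, ∑ b, metricInv g q (transMap p q y) a b • β (stdE a) (stdE b) := by
  simp only [fderiv_transMap_stdE, metricInv_trans g hy, map_sum, LinearMap.sum_apply, map_smul,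
    LinearMap.smul_apply, Matrix.mul_apply, Matrix.transpose_apply, Finset.sum_mul, Finset.sum_smul,
    Finset.smul_sum, smul_smul]
  calc _ = ∑ i, ∑ b, ∑ a, ∑ j, (metricInv g p y i j * (jacMat p q y b j * jacMat p q y a i)) •
          (β (stdE a)) (stdE b) := by
        refine Finset.sum_congr rfl fun i _ => ?_
        rw [Finset.sum_comm]
        refine Finset.sum_congr rfl fun b _ => ?_
        rw [Finset.sum_comm]
    _ = ∑ a, ∑ b, ∑ i, ∑ j, (metricInv g p y i j * (jacMat p q y b j * jacMat p q y a i)) •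
          (β (stdE a)) (stdE b) := by
        rw [Finset.sum_comm]
        conv_rhs => rw [Finset.sum_comm]
        refine Finset.sum_congr rfl fun b _ => ?_
        rw [Finset.sum_comm]
    _ = _ := by
        refine Finset.sum_congr rfl fun a _ => Finset.sum_congr rfl fun b _ => ?_
        rw [Finset.sum_comm]
        exact Finset.sum_congr rfl fun i _ => Finset.sum_congr rfl fun j _ => by
          congr 1; ring

end Metric

/-! ### Curvature of a connection form -/

section CurvForm

variable {E : Type*} [NormedAddCommGroup E] [NormedSpace ℝ E]
  {𝔸 : Type*} [NormedRing 𝔸] [NormedAlgebra ℝ 𝔸]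

/-- The curvature `dη + η ∧ η` of a connection form `η` with values in an algebra. -/
noncomputable def curvForm (η : E → E →L[ℝ] 𝔸) (x : E) : E →ₗ[ℝ] E →ₗ[ℝ] 𝔸 :=
  LinearMap.mk₂ ℝ
    (fun X Y => fderiv ℝ η x X Y - fderiv ℝ η x Y X + (η x X * η x Y - η x Y * η x X))
    (fun X X' Y => by simp only [map_add, add_apply, add_mul, mul_add]; abel)
    (fun r X Y => by
      simp only [map_smul, smul_apply, smul_mul_assoc, mul_smul_comm, smul_add, smul_sub])
    (fun X Y Y' => by simp only [map_add, add_apply, add_mul, mul_add]; abel)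
    (fun r X Y => by
      simp only [map_smul, smul_apply, smul_mul_assoc, mul_smul_comm, smul_add, smul_sub])

lemma curvForm_apply (η : E → E →L[ℝ] 𝔸) (x X Y : E) : curvForm η x X Y =
    fderiv ℝ η x X Y - fderiv ℝ η x Y X + (η x X * η x Y - η x Y * η x X) := rfl

/-- Curvature is covariant under a simultaneous change of coordinates `τ` and of gauge `c`. The
gauge transformation law is written without inverses. -/
lemma curvForm_gauge {η η' : E → E →L[ℝ] 𝔸} {c : E → 𝔸} {τ : E → E} {x : E}
    (hτ : ContDiffAt ℝ 2 τ x) (hc : ContDiffAt ℝ 2 c x)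
    (hη : DifferentiableAt ℝ η (τ x)) (hη' : DifferentiableAt ℝ η' x)
    (h : ∀ᶠ z in 𝓝 x, ∀ X, c z * η' z X = η (τ z) (fderiv ℝ τ z X) * c z + fderiv ℝ c z X)
    (X Y : E) :
    c x * curvForm η' x X Y = curvForm η (τ x) (fderiv ℝ τ x X) (fderiv ℝ τ x Y) * c x := by
  have hτ1 : HasFDerivAt τ (fderiv ℝ τ x) x := (hτ.differentiableAt (by simp)).hasFDerivAt
  have hc1 : HasFDerivAt c (fderiv ℝ c x) x := (hc.differentiableAt (by simp)).hasFDerivAt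
  have hτ2 : HasFDerivAt (fderiv ℝ τ) (fderiv ℝ (fderiv ℝ τ) x) x :=
    ((hτ.fderiv_right (m := 1) (by norm_num)).differentiableAt (by simp)).hasFDerivAt
  have hc2 : HasFDerivAt (fderiv ℝ c) (fderiv ℝ (fderiv ℝ c) x) x :=
    ((hc.fderiv_right (m := 1) (by norm_num)).differentiableAt (by simp)).hasFDerivAt
  have sτ := hτ.isSymmSndFDerivAt (by simp)
  have sc := hc.isSymmSndFDerivAt (by simp)
  -- the derivative of the transformation law; its antisymmetric part is the claim, since second
  -- derivatives are symmetric
  have key : ∀ X Y, fderiv ℝ c x Y * η' x X + c x * fderiv ℝ η' x Y X =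
      (fderiv ℝ η (τ x) (fderiv ℝ τ x Y) (fderiv ℝ τ x X)
        + η (τ x) (fderiv ℝ (fderiv ℝ τ) x Y X)) * c x
      + η (τ x) (fderiv ℝ τ x X) * fderiv ℝ c x Y + fderiv ℝ (fderiv ℝ c) x Y X := by
    intro X Y
    have h1 := hc1.mul' (hη'.hasFDerivAt.clm_apply (hasFDerivAt_const X x))
    have h2 := (((hη.hasFDerivAt.comp x hτ1).clm_apply
      (hτ2.clm_apply (hasFDerivAt_const X x))).mul' hc1).add
      (hc2.clm_apply (hasFDerivAt_const X x))
    have h3 : (fun z => c z * η' z X) =ᶠ[𝓝 x]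
        fun z => (η ∘ τ) z (fderiv ℝ τ z X) * c z + fderiv ℝ c z X := h.mono fun z hz => hz X
    have h4 := congrArg (fun L => L Y) (h1.unique (h2.congr_of_eventuallyEq h3))
    simp only [add_apply, smul_apply, ContinuousLinearMap.comp_apply, Function.comp,
      ContinuousLinearMap.flip_apply, zero_apply, map_zero, zero_add, smul_eq_mul, MulOpposite.smul_eq_mul_unop, MulOpposite.unop_op] at h4
    rw [add_comm, h4]
    noncomm_ring
  have e0 := h.self_of_nhds
  have k1 := key Y X
  have k2 := key X Y
  have eX := e0 X
  have eY := e0 Y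
  rw [sτ X Y, sc X Y] at k1
  simp only [curvForm_apply]
  set a := c x
  set p := η' x X
  set q := η' x Y
  set P := η (τ x) (fderiv ℝ τ x X)
  set Q := η (τ x) (fderiv ℝ τ x Y)
  set u := fderiv ℝ c x X
  set v := fderiv ℝ c x Y
  calc a * (fderiv ℝ η' x X Y - fderiv ℝ η' x Y X + (p * q - q * p))
      = (u * q + a * fderiv ℝ η' x X Y) - (v * p + a * fderiv ℝ η' x Y X)
        + ((a * p) * q - (a * q) * p) - u * q + v * p := by noncomm_ring
    _ = (fderiv ℝ η (τ x) (fderiv ℝ τ x X) (fderiv ℝ τ x Y)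
          - fderiv ℝ η (τ x) (fderiv ℝ τ x Y) (fderiv ℝ τ x X)) * a
        + Q * u - P * v + ((P * a + u) * q - (Q * a + v) * p) - u * q + v * p := by
        rw [k1, k2, eX, eY]; noncomm_ring
    _ = (fderiv ℝ η (τ x) (fderiv ℝ τ x X) (fderiv ℝ τ x Y)
          - fderiv ℝ η (τ x) (fderiv ℝ τ x Y) (fderiv ℝ τ x X)) * a
        + Q * u - P * v + (P * (a * q) - Q * (a * p)) := by noncomm_ring
    _ = _ := by rw [eX, eY]; noncomm_ring

lemma fderiv_clm_apply₂ {F E E' M : Type*} [NormedAddCommGroup F] [NormedSpace ℝ F]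
    [NormedAddCommGroup E] [NormedSpace ℝ E] [NormedAddCommGroup E'] [NormedSpace ℝ E']
    [NormedAddCommGroup M] [NormedSpace ℝ M]
    {L : F → E →L[ℝ] E' →L[ℝ] M} {y : F}
    (hL : DifferentiableAt ℝ L y) (V : F) (X : E) (Y : E') :
    fderiv ℝ (fun z => L z X Y) y V = fderiv ℝ L y V X Y := by
  have h := ((hL.hasFDerivAt.clm_apply (hasFDerivAt_const X y)).clm_apply
    (hasFDerivAt_const Y y)).fderiv
  rw [h]
  simp

/-- The transformation law of Christoffel symbols. The bilinear maps `Γ` at `τ x` and `Γ'` at `x` are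
determined by the Koszul formulas of the metric `G` and of its pullback `G'` under `τ`. With `J` the
differential of `τ`, one has `J Γ'(X, Y) = Γ(JX, JY) + D²τ(X, Y)`, since both sides pair equally with
every vector `JZ`. -/
lemma koszul_trans {E : Type*} [NormedAddCommGroup E] [NormedSpace ℝ E]
    {G G' : E → E →L[ℝ] E →L[ℝ] ℝ} {τ : E → E} {x : E} {Γ Γ' : E → E → E}
    (hτ : ContDiffAt ℝ 2 τ x) (hG : DifferentiableAt ℝ G (τ x)) (hG' : DifferentiableAt ℝ G' x)
    (h : ∀ᶠ z in 𝓝 x, ∀ X Y, G' z X Y = G (τ z) (fderiv ℝ τ z X) (fderiv ℝ τ z Y))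
    (hs : ∀ X Y, G (τ x) X Y = G (τ x) Y X) (hpos : ∀ X, X ≠ 0 → 0 < G (τ x) X X)
    (hsurj : Function.Surjective (fderiv ℝ τ x))
    (hΓ : ∀ X Y Z, G (τ x) (Γ X Y) Z = (1 / 2) * (fderiv ℝ G (τ x) X Y Z
      + fderiv ℝ G (τ x) Y X Z - fderiv ℝ G (τ x) Z X Y))
    (hΓ' : ∀ X Y Z, G' x (Γ' X Y) Z = (1 / 2) * (fderiv ℝ G' x X Y Z
      + fderiv ℝ G' x Y X Z - fderiv ℝ G' x Z X Y)) (X Y : E) :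
    fderiv ℝ τ x (Γ' X Y) =
      Γ (fderiv ℝ τ x X) (fderiv ℝ τ x Y) + fderiv ℝ (fderiv ℝ τ) x X Y := by
  have hτ1 : HasFDerivAt τ (fderiv ℝ τ x) x := (hτ.differentiableAt (by simp)).hasFDerivAt
  have hτ2 : HasFDerivAt (fderiv ℝ τ) (fderiv ℝ (fderiv ℝ τ) x) x :=
    ((hτ.fderiv_right (m := 1) (by norm_num)).differentiableAt (by simp)).hasFDerivAt
  have sB : ∀ X Y, fderiv ℝ (fderiv ℝ τ) x X Y = fderiv ℝ (fderiv ℝ τ) x Y X :=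
    hτ.isSymmSndFDerivAt (by simp)
  have e0 := h.self_of_nhds
  -- the derivative of `G' = τ^* G`
  have hder : ∀ X Y Z, fderiv ℝ G' x X Y Z =
      fderiv ℝ G (τ x) (fderiv ℝ τ x X) (fderiv ℝ τ x Y) (fderiv ℝ τ x Z)
        + G (τ x) (fderiv ℝ (fderiv ℝ τ) x X Y) (fderiv ℝ τ x Z)
        + G (τ x) (fderiv ℝ τ x Y) (fderiv ℝ (fderiv ℝ τ) x X Z) := by
    intro X Y Z
    rw [← fderiv_clm_apply₂ hG']
    have h00 : HasFDerivAt G (fderiv ℝ G (τ x)) (τ x) := hG.hasFDerivAt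
    have h0 := HasFDerivAt.comp (G := E →L[ℝ] E →L[ℝ] ℝ) (g := G) x h00 hτ1
    have h1 := (h0.clm_apply
      (hτ2.clm_apply (hasFDerivAt_const Y x))).clm_apply (hτ2.clm_apply (hasFDerivAt_const Z x))
    have h2 : (fun z => G' z Y Z) =ᶠ[𝓝 x] fun z =>
        (G ∘ τ) z (fderiv ℝ τ z Y) (fderiv ℝ τ z Z) := h.mono fun z hz => hz Y Z
    rw [(h1.congr_of_eventuallyEq h2).fderiv]
    simp only [add_apply, ContinuousLinearMap.comp_apply, Function.comp,
      ContinuousLinearMap.flip_apply, zero_apply, map_zero, zero_add]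
    ring
  set J := fderiv ℝ τ x
  set B := fderiv ℝ (fderiv ℝ τ) x
  have hpair : ∀ Z, G (τ x) (J (Γ' X Y) - (Γ (J X) (J Y) + B X Y)) (J Z) = 0 := by
    intro Z
    rw [map_sub, map_add, sub_apply, add_apply, ← e0, hΓ, hΓ', hder, hder, hder, sB Y X, sB Z X,
      sB Z Y, hs (J Y) (B X Z)]
    ring
  by_contra hne
  have hne' := sub_ne_zero.2 hne
  obtain ⟨Z, hZ⟩ := hsurj (J (Γ' X Y) - (Γ (J X) (J Y) + B X Y))
  have h5 := hpair Z
  rw [hZ] at h5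
  exact (hpos _ hne').ne' h5

/-- It suffices to verify the Koszul formula on a basis. -/
lemma koszul_of_basis {E ι : Type*} [NormedAddCommGroup E] [NormedSpace ℝ E]
    (b : Module.Basis ι ℝ E) {G : E →L[ℝ] E →L[ℝ] ℝ} {D : E →L[ℝ] E →L[ℝ] E →L[ℝ] ℝ}
    {Γ : E →L[ℝ] E →L[ℝ] E}
    (h : ∀ i j k, G (Γ (b i) (b j)) (b k) = (1 / 2) * (D (b i) (b j) (b k)
      + D (b j) (b i) (b k) - D (b k) (b i) (b j))) (X Y Z : E) :
    G (Γ X Y) Z = (1 / 2) * (D X Y Z + D Y X Z - D Z X Y) := by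
  have h1 : ∀ i j, (G (Γ (b i) (b j))).toLinearMap = (1 / 2 : ℝ) • ((D (b i) (b j)).toLinearMap
      + (D (b j) (b i)).toLinearMap - ((D.flip (b i)).flip (b j)).toLinearMap) :=
    fun i j => b.ext fun k => h i j k
  have h2 : ∀ i, (((G.flip Z).comp (Γ (b i)))).toLinearMap =
      (1 / 2 : ℝ) • (((D (b i)).flip Z).toLinearMap + ((D.flip (b i)).flip Z).toLinearMap
        - (D Z (b i)).toLinearMap) :=
    fun i => b.ext fun j => congrArg (fun L => L Z) (h1 i j)
  have h3 : (((G.flip Z).comp (Γ.flip Y))).toLinearMap =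
      (1 / 2 : ℝ) • (((D.flip Y).flip Z).toLinearMap + ((D Y).flip Z).toLinearMap
        - ((D Z).flip Y).toLinearMap) :=
    b.ext fun i => congrArg (fun L => L Y) (h2 i)
  exact congrArg (fun L => L X) h3

lemma contDiffOn_smul_const {E F : Type*} [NormedAddCommGroup E] [NormedSpace ℝ E]
    [NormedAddCommGroup F] [NormedSpace ℝ F] {f : E → ℝ} {s : Set E} {m : WithTop ℕ∞}
    (hf : ContDiffOn ℝ m f s) (c : F) : ContDiffOn ℝ m (fun x => f x • c) s :=
  hf.smul contDiffOn_const

end CurvForm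

section LinExt

variable {n : ℕ}

lemma trace_eq_sum_stdE (T : EuclideanSpace ℝ (Fin n) →ₗ[ℝ] EuclideanSpace ℝ (Fin n)) :
    LinearMap.trace ℝ _ T = ∑ i, T (stdE i) i := by
  rw [LinearMap.trace_eq_matrix_trace ℝ (EuclideanSpace.basisFun (Fin n) ℝ).toBasis]
  simp [Matrix.trace, LinearMap.toMatrix_apply]

end LinExt

/-! ### Transformation of the Christoffel symbols and of the scalar curvature -/

section Christoffel

variable {n : ℕ} {S : Type*} [TopologicalSpace S] [ChartedSpace (EuclideanSpace ℝ (Fin n)) S]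
  [IsManifold (𝓡 n) ∞ S]

/-- The Christoffel symbols, assembled into a bilinear map. -/
noncomputable def chrisForm (g : RMetric n S) (p : S) (y : EuclideanSpace ℝ (Fin n)) :
    EuclideanSpace ℝ (Fin n) →L[ℝ] EuclideanSpace ℝ (Fin n) →L[ℝ] EuclideanSpace ℝ (Fin n) :=
  ∑ k, ∑ i, ∑ j, christoffel g p k i j y •
    (EuclideanSpace.proj i : EuclideanSpace ℝ (Fin n) →L[ℝ] ℝ).smulRight
      ((EuclideanSpace.proj j : EuclideanSpace ℝ (Fin n) →L[ℝ] ℝ).smulRight (stdE k))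

lemma chrisForm_stdE (g : RMetric n S) (p : S) (y : EuclideanSpace ℝ (Fin n)) (i j : Fin n) :
    chrisForm g p y (stdE i) (stdE j) = ∑ k, christoffel g p k i j y • stdE k := by
  simp [chrisForm, sum_apply, ite_smul]

lemma chrisForm_stdE_apply (g : RMetric n S) (p : S) (y : EuclideanSpace ℝ (Fin n))
    (k i j : Fin n) : chrisForm g p y (stdE i) (stdE j) k = christoffel g p k i j y := by
  rw [chrisForm_stdE]
  simp [Finset.sum_apply, Pi.single_apply]

lemma contDiffOn_pd {f : EuclideanSpace ℝ (Fin n) → ℝ} {s : Set (EuclideanSpace ℝ (Fin n))}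
    (hs : IsOpen s) (hf : ContDiffOn ℝ ∞ f s) (i : Fin n) : ContDiffOn ℝ ∞ (pd i f) s :=
  (hf.fderiv_of_isOpen hs (m := ∞) (by simp)).clm_apply contDiffOn_const

lemma contDiffOn_christoffel (g : RMetric n S) (p : S) (k i j : Fin n) :
    ContDiffOn ℝ ∞ (christoffel g p k i j) (extChartAt (𝓡 n) p).target := by
  have hd := fun i j l => contDiffOn_pd (isOpen_target p) (contDiffOn_metricCoeff g p j l) i
  exact contDiffOn_const.mul (ContDiffOn.sum fun l _ => (contDiffOn_metricInv g p k l).mul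
    (((hd i j l).add (hd j i l)).sub (hd l i j)))

lemma contDiffOn_chrisForm (g : RMetric n S) (p : S) :
    ContDiffOn ℝ ∞ (chrisForm g p) (extChartAt (𝓡 n) p).target :=
  ContDiffOn.sum fun k _ => ContDiffOn.sum fun i _ => ContDiffOn.sum fun j _ =>
    contDiffOn_smul_const (contDiffOn_christoffel g p k i j) _

lemma differentiableAt_chartForm (g : RMetric n S) {p : S} {y : EuclideanSpace ℝ (Fin n)}
    (hy : y ∈ (extChartAt (𝓡 n) p).target) : DifferentiableAt ℝ (chartForm g p) y :=
  ((contDiffOn_chartForm g p).contDiffAt ((isOpen_target p).mem_nhds hy)).differentiableAt (by simp)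

lemma differentiableAt_chrisForm (g : RMetric n S) {p : S} {y : EuclideanSpace ℝ (Fin n)}
    (hy : y ∈ (extChartAt (𝓡 n) p).target) : DifferentiableAt ℝ (chrisForm g p) y :=
  ((contDiffOn_chrisForm g p).contDiffAt ((isOpen_target p).mem_nhds hy)).differentiableAt (by simp)

/-- The Koszul formula. -/
lemma chartForm_chrisForm (g : RMetric n S) {p : S} {y : EuclideanSpace ℝ (Fin n)}
    (hy : y ∈ (extChartAt (𝓡 n) p).target) (X Y Z : EuclideanSpace ℝ (Fin n)) :
    chartForm g p y (chrisForm g p y X Y) Z = (1 / 2) * (fderiv ℝ (chartForm g p) y X Y Z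
      + fderiv ℝ (chartForm g p) y Y X Z - fderiv ℝ (chartForm g p) y Z X Y) := by
  set D := fderiv ℝ (chartForm g p) y with hD
  have hdiff := differentiableAt_chartForm g hy
  have hpd : ∀ i j l, pd i (fun z => metricCoeff g p z j l) y = D (stdE i) (stdE j) (stdE l) :=
    fun i j l => fderiv_clm_apply₂ hdiff _ _ _
  refine koszul_of_basis (EuclideanSpace.basisFun (Fin n) ℝ).toBasis (fun i j m => ?_) X Y Z
  simp only [OrthonormalBasis.coe_toBasis, EuclideanSpace.basisFun_apply]
  change chartForm g p y (chrisForm g p y (stdE i) (stdE j)) (stdE m) =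
    (1 / 2) * (D (stdE i) (stdE j) (stdE m) + D (stdE j) (stdE i) (stdE m)
      - D (stdE m) (stdE i) (stdE j))
  have hinv : metricCoeff g p y * metricInv g p y = 1 :=
    Matrix.mul_nonsing_inv _ (metricCoeff_det_pos g hy).ne'.isUnit
  rw [chrisForm_stdE]
  simp only [map_sum, map_smul, sum_apply, smul_apply, ← metricCoeff_apply, smul_eq_mul, christoffel,
    hpd]
  have hsym : ∀ k, metricCoeff g p y k m = metricCoeff g p y m k := fun k => chartForm_symm g p y _ _
  calc _ = (1 / 2) * ∑ l, (metricCoeff g p y * metricInv g p y) m l *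
        (D (stdE i) (stdE j) (stdE l) + D (stdE j) (stdE i) (stdE l)
          - D (stdE l) (stdE i) (stdE j)) := by
        simp only [Matrix.mul_apply, Finset.sum_mul, Finset.mul_sum, hsym]
        rw [Finset.sum_comm]
        exact Finset.sum_congr rfl fun a _ => Finset.sum_congr rfl fun b _ => by ring
    _ = _ := by simp [hinv, Matrix.one_apply]

lemma chrisForm_trans (g : RMetric n S) {p q : S} {y : EuclideanSpace ℝ (Fin n)}
    (hy : y ∈ overlap p q) (X Y : EuclideanSpace ℝ (Fin n)) :
    fderiv ℝ (transMap p q) y (chrisForm g p y X Y) =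
      chrisForm g q (transMap p q y) (fderiv ℝ (transMap p q) y X) (fderiv ℝ (transMap p q) y Y)
        + fderiv ℝ (fderiv ℝ (transMap p q)) y X Y := by
  have hty := transMap_mem_target hy
  refine koszul_trans (G := chartForm g q) (G' := chartForm g p)
    (Γ := fun X Y => chrisForm g q (transMap p q y) X Y) (Γ' := fun X Y => chrisForm g p y X Y)
    ((contDiffAt_transMap hy).of_le ENat.LEInfty.out)
    (differentiableAt_chartForm g hty) (differentiableAt_chartForm g hy.1) ?_
    (chartForm_symm g q _) (fun X hX => chartForm_pos g hty hX) (fderiv_transMap_surjective hy)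
    (chartForm_chrisForm g hty) (chartForm_chrisForm g hy.1) X Y
  filter_upwards [(isOpen_overlap p q).mem_nhds hy] with z hz using chartForm_trans g hz

lemma curvForm_chrisForm_trans (g : RMetric n S) {p q : S} {y : EuclideanSpace ℝ (Fin n)}
    (hy : y ∈ overlap p q) (X Y : EuclideanSpace ℝ (Fin n)) :
    fderiv ℝ (transMap p q) y * curvForm (chrisForm g p) y X Y =
      curvForm (chrisForm g q) (transMap p q y) (fderiv ℝ (transMap p q) y X)
        (fderiv ℝ (transMap p q) y Y) * fderiv ℝ (transMap p q) y := by
  have hτ := contDiffAt_transMap hy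
  refine curvForm_gauge (hτ.of_le ENat.LEInfty.out)
    ((hτ.fderiv_right (m := ∞) (by simp)).of_le ENat.LEInfty.out) ?_ ?_ ?_ X Y
  · exact differentiableAt_chrisForm g (transMap_mem_target hy)
  · exact differentiableAt_chrisForm g hy.1
  · filter_upwards [(isOpen_overlap p q).mem_nhds hy] with z hz X
    ext1 Y
    exact chrisForm_trans g hz X Y

/-- The Ricci tensor of the connection form `η` on `ℝⁿ`: the trace of `X ↦ Ω(X, Y)Z`. -/
noncomputable def ricciForm (η : EuclideanSpace ℝ (Fin n) → EuclideanSpace ℝ (Fin n) →L[ℝ]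
      EuclideanSpace ℝ (Fin n) →L[ℝ] EuclideanSpace ℝ (Fin n)) (y : EuclideanSpace ℝ (Fin n)) :
    EuclideanSpace ℝ (Fin n) →ₗ[ℝ] EuclideanSpace ℝ (Fin n) →ₗ[ℝ] ℝ :=
  LinearMap.mk₂ ℝ (fun Y Z => ∑ i, curvForm η y (stdE i) Y Z i)
    (fun Y Y' Z => by simp [Finset.sum_add_distrib])
    (fun r Y Z => by simp [Finset.mul_sum])
    (fun Y Z Z' => by simp [Finset.sum_add_distrib])
    (fun r Y Z => by simp [Finset.mul_sum])

lemma ricciCoeff_eq (g : RMetric n S) {p : S} {y : EuclideanSpace ℝ (Fin n)}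
    (hy : y ∈ (extChartAt (𝓡 n) p).target) (j k : Fin n) :
    ricciCoeff g p j k y = ricciForm (chrisForm g p) y (stdE j) (stdE k) := by
  have hd := differentiableAt_chrisForm g hy
  have hpd : ∀ i k' j k, pd i (christoffel g p k' j k) y =
      fderiv ℝ (chrisForm g p) y (stdE i) (stdE j) (stdE k) k' := by
    intro i k' j k
    have h1 : christoffel g p k' j k = fun z => chrisForm g p z (stdE j) (stdE k) k' :=
      funext fun z => (chrisForm_stdE_apply g p z k' j k).symm
    have h2 := (EuclideanSpace.proj k' : EuclideanSpace ℝ (Fin n) →L[ℝ] ℝ).hasFDerivAt.comp y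
      ((hd.hasFDerivAt.clm_apply (hasFDerivAt_const (stdE j) y)).clm_apply
        (hasFDerivAt_const (stdE k) y))
    rw [pd, h1]
    refine (congrArg (fun L => L (stdE i)) h2.fderiv).trans ?_
    simp
  have hmul : ∀ i j k k', (chrisForm g p y (stdE i) * chrisForm g p y (stdE j)) (stdE k) k' =
      ∑ l, christoffel g p k' i l y * christoffel g p l j k y := by
    intro i j k k'
    rw [mul_apply_eq_comp, chrisForm_stdE g p y j k]
    simp only [map_sum, map_smul, WithLp.ofLp_sum, WithLp.ofLp_smul, Finset.sum_apply,
      Pi.smul_apply, smul_eq_mul, chrisForm_stdE_apply]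
    exact Finset.sum_congr rfl fun l _ => mul_comm _ _
  simp only [ricciCoeff, ricciForm, LinearMap.mk₂_apply, curvForm_apply, add_apply, sub_apply,
    PiLp.add_apply, PiLp.sub_apply, hmul, hpd, Finset.sum_sub_distrib]

lemma ricciForm_trans (g : RMetric n S) {p q : S} {y : EuclideanSpace ℝ (Fin n)}
    (hy : y ∈ overlap p q) (Y Z : EuclideanSpace ℝ (Fin n)) :
    ricciForm (chrisForm g p) y Y Z = ricciForm (chrisForm g q) (transMap p q y)
      (fderiv ℝ (transMap p q) y Y) (fderiv ℝ (transMap p q) y Z) := by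
  set J := fderiv ℝ (transMap p q) y with hJ
  set K := fderiv ℝ (transMap q p) (transMap p q y) with hK
  let T : (EuclideanSpace ℝ (Fin n) → EuclideanSpace ℝ (Fin n) →L[ℝ]
      EuclideanSpace ℝ (Fin n) →L[ℝ] EuclideanSpace ℝ (Fin n)) → EuclideanSpace ℝ (Fin n) →
      EuclideanSpace ℝ (Fin n) → EuclideanSpace ℝ (Fin n) →
      (EuclideanSpace ℝ (Fin n) →ₗ[ℝ] EuclideanSpace ℝ (Fin n)) := fun η y Y Z =>
    (ContinuousLinearMap.apply ℝ _ Z).toLinearMap ∘ₗ (curvForm η y).flip Y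
  have hT : ∀ η y Y Z, ricciForm η y Y Z = LinearMap.trace ℝ _ (T η y Y Z) := fun η y Y Z => by
    rw [trace_eq_sum_stdE]; rfl
  have hcomp : T (chrisForm g p) y Y Z =
      (K.toLinearMap ∘ₗ T (chrisForm g q) (transMap p q y) (J Y) (J Z)) ∘ₗ J.toLinearMap := by
    ext1 X
    have h1 := congrArg (fun L => K (L Z)) (curvForm_chrisForm_trans g hy X Y)
    have h2 : ∀ v, K (J v) = v := fun v => congrArg (fun L => L v) (fderiv_transMap_comp hy)
    simp only [mul_apply_eq_comp] at h1
    rw [← hJ, h2] at h1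
    exact h1
  rw [hT, hT, hcomp, LinearMap.trace_comp_comm', ← LinearMap.comp_assoc]
  congr 1
  have h3 : J.toLinearMap ∘ₗ K.toLinearMap = LinearMap.id := by
    ext1 v
    exact congrArg (fun L => L v) (fderiv_transMap_comp' hy)
  rw [h3, LinearMap.id_comp]

lemma continuousOn_ricciForm (g : RMetric n S) (p : S) (Y Z : EuclideanSpace ℝ (Fin n)) :
    ContinuousOn (fun y => ricciForm (chrisForm g p) y Y Z) (extChartAt (𝓡 n) p).target := by
  have h0 := contDiffOn_chrisForm g p
  have h1 := (h0.fderiv_of_isOpen (isOpen_target p) (m := ∞) (by simp)).continuousOn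
  have h2 := h0.continuousOn
  simp only [ricciForm, LinearMap.mk₂_apply, curvForm_apply, ContinuousLinearMap.mul_def]
  fun_prop

lemma scalarCurvature_eq (g : RMetric n S) {p q : S} (hp : p ∈ (extChartAt (𝓡 n) q).source) :
    scalarCurvature g p = ∑ j, ∑ k, metricInv g q (extChartAt (𝓡 n) q p) j k *
      ricciForm (chrisForm g q) (extChartAt (𝓡 n) q p) (stdE j) (stdE k) := by
  have ho := chart_mem_overlap (mem_extChartAt_source p) hp
  have h := metricInv_contract g ho (ricciForm (chrisForm g q) (extChartAt (𝓡 n) q p))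
  rw [transMap_chart (mem_extChartAt_source p)] at h
  simp only [smul_eq_mul] at h
  rw [← h]
  refine Finset.sum_congr rfl fun j _ => Finset.sum_congr rfl fun k _ => ?_
  rw [ricciCoeff_eq g ho.1, ricciForm_trans g ho, transMap_chart (mem_extChartAt_source p)]

lemma continuous_scalarCurvature (g : RMetric n S) : Continuous (scalarCurvature g) := by
  refine continuous_of_chart (n := n) fun q => ⟨fun y => ∑ j, ∑ k, metricInv g q y j k *
      ricciForm (chrisForm g q) y (stdE j) (stdE k), (extChartAt (𝓡 n) q).source,
      extChartAt_source_mem_nhds q, ?_, fun x hx => scalarCurvature_eq g hx⟩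
  refine ContinuousOn.continuousAt ?_ ((isOpen_target q).mem_nhds (mem_extChartAt_target q))
  exact continuousOn_finsetSum _ fun j _ => continuousOn_finsetSum _ fun k _ =>
    (contDiffOn_metricInv g q j k).continuousOn.mul (continuousOn_ricciForm g q _ _)

end Christoffel

/-! ### The adjoint representation and its differential -/

/-- In a local group with multiplication `m` and conjugation `C(x, y) = x y x⁻¹`, near the unit `e`,
the differential of `x ↦ Ad x = ∂₂C(x, e)` at `e` is the bracket of the left-invariant vector fields
`y ↦ ∂₂m(y, e) a`. This is obtained by differentiating `m(C(x, y), x) = m(x, y)` in `y` and then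
in `x`. -/
lemma fderiv_conj_eq_bracket {E : Type*} [NormedAddCommGroup E] [NormedSpace ℝ E]
    {m C : E × E → E} {e : E} (hm : ContDiffAt ℝ 2 m (e, e)) (hC : ContDiffAt ℝ 2 C (e, e))
    (h1 : ∀ᶠ y in 𝓝 e, m (y, e) = y) (h2 : ∀ᶠ z in 𝓝 (e, e), m (C z, z.1) = m z)
    (hC1 : ∀ᶠ x in 𝓝 e, C (x, e) = e) (hC2 : ∀ᶠ y in 𝓝 e, C (e, y) = y) :
    DifferentiableAt ℝ (fun x => fderiv ℝ (fun y => C (x, y)) e) e ∧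
    ∀ u a, fderiv ℝ (fun x => fderiv ℝ (fun y => C (x, y)) e) e u a =
      fderiv ℝ (fun y => fderiv ℝ (fun z => m (y, z)) e a) e u -
        fderiv ℝ (fun y => fderiv ℝ (fun z => m (y, z)) e u) e a := by
  have hpair : ∀ y : E, HasFDerivAt (fun z => (y, z)) (ContinuousLinearMap.inr ℝ E E) e := fun y =>
    (hasFDerivAt_const y e).prodMk (hasFDerivAt_id e)
  have hpair' : HasFDerivAt (fun y : E => (y, e)) (ContinuousLinearMap.inl ℝ E E) e :=
    (hasFDerivAt_id e).prodMk (hasFDerivAt_const e e)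
  have hcont : ContinuousAt (fun x : E => (x, e)) e := by fun_prop
  have hcont' : ContinuousAt (fun x : E => (e, x)) e := by fun_prop
  have part : ∀ f : E × E → E, ContDiffAt ℝ 2 f (e, e) →
      ∀ᶠ x in 𝓝 e, fderiv ℝ (fun y => f (x, y)) e =
        (fderiv ℝ f (x, e)).comp (ContinuousLinearMap.inr ℝ E E) := by
    intro f hf
    have h3 : ∀ᶠ z in 𝓝 (e, e), ContDiffAt ℝ 2 f z := hf.eventually (by simp)
    filter_upwards [hcont.eventually h3] with x hx
    exact ((hx.differentiableAt (by simp)).hasFDerivAt.comp e (hpair x)).fderiv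
  have hd2 : ∀ f : E × E → E, ContDiffAt ℝ 2 f (e, e) →
      HasFDerivAt (fderiv ℝ f) (fderiv ℝ (fderiv ℝ f) (e, e)) (e, e) := fun f hf =>
    ((hf.fderiv_right (m := 1) (by norm_num)).differentiableAt (by simp)).hasFDerivAt
  -- the second derivative of the multiplication
  set M := fderiv ℝ (fderiv ℝ m) (e, e) with hM
  have hMs : ∀ v w, M v w = M w v := hm.isSymmSndFDerivAt (by simp)
  have hmx : HasFDerivAt (fun x => fderiv ℝ m (x, e)) (M.comp (ContinuousLinearMap.inl ℝ E E)) e :=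
    HasFDerivAt.comp (f := fun y : E => (y, e)) e (hd2 m hm) hpair'
  have hmx' : HasFDerivAt (fun x => fderiv ℝ m (e, x)) (M.comp (ContinuousLinearMap.inr ℝ E E)) e :=
    (hd2 m hm).comp e (hpair e)
  have hV : ∀ a u, fderiv ℝ (fun y => fderiv ℝ (fun z => m (y, z)) e a) e u = M (u, 0) (0, a) := by
    intro a u
    have h3 : (fun y => fderiv ℝ (fun z => m (y, z)) e a) =ᶠ[𝓝 e]
        fun y => fderiv ℝ m (y, e) (0, a) := (part m hm).mono fun y hy => by
      change fderiv ℝ (fun z => m (y, z)) e a = _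
      rw [hy]; simp
    rw [h3.fderiv_eq, (hmx.clm_apply (hasFDerivAt_const (0, a) e)).fderiv]
    simp
  have hAd : DifferentiableAt ℝ (fun x => fderiv ℝ (fun y => C (x, y)) e) e := by
    have h3 : DifferentiableAt ℝ (fun x => (fderiv ℝ C (x, e)).comp
        (ContinuousLinearMap.inr ℝ E E)) e :=
      ((HasFDerivAt.comp (f := fun y : E => (y, e)) e (hd2 C hC) hpair').clm_comp (hasFDerivAt_const _ e)).differentiableAt
    exact h3.congr_of_eventuallyEq (part C hC)
  refine ⟨hAd, fun u a => ?_⟩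
  rw [hV, hV]
  set AdC := fun x => fderiv ℝ (fun y => C (x, y)) e with hAdC
  have hAde : AdC e a = a := by
    have h3 : (fun y => C (e, y)) =ᶠ[𝓝 e] id := hC2
    change fderiv ℝ (fun y => C (e, y)) e a = a
    rw [h3.fderiv_eq, fderiv_id]; rfl
  have hm1 : ∀ v, fderiv ℝ m (e, e) (v, 0) = v := by
    intro v
    have h3 : (fun y => m (y, e)) =ᶠ[𝓝 e] id := h1
    have h4 := (HasFDerivAt.comp (f := fun y : E => (y, e)) e
      (hm.differentiableAt (by simp)).hasFDerivAt hpair').fderiv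
    have h5 : fderiv ℝ (fun y => m (y, e)) e v = v := by
      rw [h3.fderiv_eq, fderiv_id]; rfl
    exact (congrArg (fun L => L v) h4).symm.trans h5
  -- the derivative of `m(C(x, y), x) = m(x, y)` in `y` at `e`
  have hI : ∀ᶠ x in 𝓝 e, fderiv ℝ m (e, x) (AdC x a, 0) = fderiv ℝ m (x, e) (0, a) := by
    have h3 : ∀ᶠ z in 𝓝 (e, e), ContDiffAt ℝ 2 m z := hm.eventually (by simp)
    have h3' : ∀ᶠ z in 𝓝 (e, e), ContDiffAt ℝ 2 C z := hC.eventually (by simp)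
    have h4 : ∀ᶠ x in 𝓝 e, ∀ᶠ y in 𝓝 e, m (C (x, y), x) = m (x, y) := h2.curry_nhds
    filter_upwards [hcont.eventually h3, hcont'.eventually h3, h4, hC1, hcont.eventually h3']
      with x hx hx' h5 hx1 hxC
    have hCx : HasFDerivAt (fun y => C (x, y)) (AdC x) e := by
      have := (hxC.differentiableAt (by simp)).hasFDerivAt.comp e (hpair x)
      exact this.differentiableAt.hasFDerivAt
    have hmx1 : HasFDerivAt m (fderiv ℝ m (e, x)) (C (x, e), x) := by
      rw [hx1]; exact (hx'.differentiableAt (by simp)).hasFDerivAt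
    have h6 := HasFDerivAt.comp e hmx1 (hCx.prodMk (hasFDerivAt_const x e))
    have h7 := HasFDerivAt.comp e (hx.differentiableAt (by simp)).hasFDerivAt (hpair x)
    have h8 := h7.unique (h6.congr_of_eventuallyEq (h5.mono fun y hy => hy.symm))
    have h9 := congrArg (fun L => L a) h8
    simpa using h9.symm
  -- differentiate the identity `hI` in `x` at `e`
  have hL := hmx'.clm_apply ((hAd.hasFDerivAt.clm_apply (hasFDerivAt_const a e)).prodMk
    (hasFDerivAt_const (0 : E) e))
  have hR := hmx.clm_apply (hasFDerivAt_const ((0 : E), a) e)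
  have h10 := congrArg (fun L => L u) (hR.unique (hL.congr_of_eventuallyEq
    (hI.mono fun x hx => hx.symm)))
  simp only [add_apply, ContinuousLinearMap.comp_apply, ContinuousLinearMap.flip_apply,
    ContinuousLinearMap.inl_apply, ContinuousLinearMap.inr_apply, zero_apply, map_zero, zero_add,
    ContinuousLinearMap.prod_apply, hm1] at h10
  change M (u, 0) (0, a) = fderiv ℝ AdC e u a + M (0, u) (AdC e a, 0) at h10
  rw [hAde] at h10
  rw [h10, hMs (0, u) (a, 0)]
  abel

section LieGroup

variable {k : ℕ} {G : Type*} [TopologicalSpace G] [ChartedSpace (EuclideanSpace ℝ (Fin k)) G]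
  [Group G]

variable (G) in
/-- Multiplication in the chart at the unit. -/
noncomputable def chartMul (z : EuclideanSpace ℝ (Fin k) × EuclideanSpace ℝ (Fin k)) :
    EuclideanSpace ℝ (Fin k) :=
  extChartAt (𝓡 k) (1 : G) ((extChartAt (𝓡 k) (1 : G)).symm z.1 * (extChartAt (𝓡 k) (1 : G)).symm z.2)

/-- Conjugation by `h`, in the chart at the unit. -/
noncomputable def chartConj (h : G) (y : EuclideanSpace ℝ (Fin k)) : EuclideanSpace ℝ (Fin k) :=
  extChartAt (𝓡 k) (1 : G) (h * (extChartAt (𝓡 k) (1 : G)).symm y * h⁻¹)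

variable (k G) in
/-- The coordinates of the unit. -/
noncomputable def unitPt : EuclideanSpace ℝ (Fin k) := extChartAt (𝓡 k) (1 : G) 1

lemma symm_unitPt : (extChartAt (𝓡 k) (1 : G)).symm (unitPt k G) = 1 :=
  extChartAt_to_inv (1 : G)

lemma chartConj_unitPt (h : G) : chartConj h (unitPt k G) = unitPt k G := by
  simp [chartConj, unitPt]

lemma unitPt_mem : (unitPt k G) ∈ (extChartAt (𝓡 k) (1 : G)).target := mem_extChartAt_target _

lemma contDiffAt_of_group {F : Type*} [NormedAddCommGroup F] [NormedSpace ℝ F] [IsManifold (𝓡 k) ∞ G] {f : F → G}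
    {x : F}
    (hf : ContMDiffAt 𝓘(ℝ, F) (𝓡 k) ∞ f x) (h1 : f x = 1) :
    ContDiffAt ℝ ∞ (fun y => extChartAt (𝓡 k) (1 : G) (f y)) x := by
  have h2 : ContMDiffAt (𝓡 k) 𝓘(ℝ, EuclideanSpace ℝ (Fin k)) ∞ (extChartAt (𝓡 k) (1 : G)) (f x) := by
    rw [h1]; exact contMDiffAt_extChartAt
  exact (h2.comp x hf).contDiffAt

variable [LieGroup (𝓡 k) ∞ G]

lemma contMDiffAt_symm_unitPt : ContMDiffAt 𝓘(ℝ, EuclideanSpace ℝ (Fin k)) (𝓡 k) ∞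
    (extChartAt (𝓡 k) (1 : G)).symm (unitPt k G) :=
  (contMDiffOn_extChartAt_symm (n := ∞) (1 : G)).contMDiffAt
    ((isOpen_target (1 : G)).mem_nhds unitPt_mem)

lemma contDiffAt_chartMul : ContDiffAt ℝ ∞ (chartMul (k := k) G) (unitPt k G, unitPt k G) := by
  have h1 : ContMDiffAt 𝓘(ℝ, EuclideanSpace ℝ (Fin k) × EuclideanSpace ℝ (Fin k)) (𝓡 k) ∞
      (fun z : EuclideanSpace ℝ (Fin k) × EuclideanSpace ℝ (Fin k) =>
        (extChartAt (𝓡 k) (1 : G)).symm z.1) (unitPt k G, unitPt k G) :=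
    ContMDiffAt.comp (g := (extChartAt (𝓡 k) (1 : G)).symm) (unitPt k G, unitPt k G)
      contMDiffAt_symm_unitPt contDiffAt_fst.contMDiffAt
  have h2 : ContMDiffAt 𝓘(ℝ, EuclideanSpace ℝ (Fin k) × EuclideanSpace ℝ (Fin k)) (𝓡 k) ∞
      (fun z : EuclideanSpace ℝ (Fin k) × EuclideanSpace ℝ (Fin k) =>
        (extChartAt (𝓡 k) (1 : G)).symm z.2) (unitPt k G, unitPt k G) :=
    ContMDiffAt.comp (g := (extChartAt (𝓡 k) (1 : G)).symm) (unitPt k G, unitPt k G)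
      contMDiffAt_symm_unitPt contDiffAt_snd.contMDiffAt
  exact contDiffAt_of_group (h1.mul h2) (by
    change (extChartAt (𝓡 k) (1 : G)).symm (unitPt k G) * (extChartAt (𝓡 k) (1 : G)).symm (unitPt k G) = 1
    rw [symm_unitPt, mul_one])

lemma contDiffAt_chartConj_joint : ContDiffAt ℝ ∞
    (fun z : EuclideanSpace ℝ (Fin k) × EuclideanSpace ℝ (Fin k) =>
      chartConj ((extChartAt (𝓡 k) (1 : G)).symm z.1) z.2) (unitPt k G, unitPt k G) := by
  have h1 : ContMDiffAt 𝓘(ℝ, EuclideanSpace ℝ (Fin k) × EuclideanSpace ℝ (Fin k)) (𝓡 k) ∞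
      (fun z : EuclideanSpace ℝ (Fin k) × EuclideanSpace ℝ (Fin k) =>
        (extChartAt (𝓡 k) (1 : G)).symm z.1) (unitPt k G, unitPt k G) :=
    ContMDiffAt.comp (g := (extChartAt (𝓡 k) (1 : G)).symm) (unitPt k G, unitPt k G)
      contMDiffAt_symm_unitPt contDiffAt_fst.contMDiffAt
  have h2 : ContMDiffAt 𝓘(ℝ, EuclideanSpace ℝ (Fin k) × EuclideanSpace ℝ (Fin k)) (𝓡 k) ∞
      (fun z : EuclideanSpace ℝ (Fin k) × EuclideanSpace ℝ (Fin k) =>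
        (extChartAt (𝓡 k) (1 : G)).symm z.2) (unitPt k G, unitPt k G) :=
    ContMDiffAt.comp (g := (extChartAt (𝓡 k) (1 : G)).symm) (unitPt k G, unitPt k G)
      contMDiffAt_symm_unitPt contDiffAt_snd.contMDiffAt
  exact contDiffAt_of_group ((h1.mul h2).mul h1.inv) (by
    change (extChartAt (𝓡 k) (1 : G)).symm (unitPt k G) * (extChartAt (𝓡 k) (1 : G)).symm (unitPt k G)
      * ((extChartAt (𝓡 k) (1 : G)).symm (unitPt k G))⁻¹ = 1
    rw [symm_unitPt, mul_one, mul_inv_cancel])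

lemma contMDiff_conj (h : G) : ContMDiff (𝓡 k) (𝓡 k) ∞ (fun x : G => h * x * h⁻¹) :=
  (contMDiff_const.mul contMDiff_id).mul contMDiff_const

lemma contDiffAt_chartConj (h : G) : ContDiffAt ℝ ∞ (chartConj h) (unitPt k G) := by
  have h1 : ContMDiffAt 𝓘(ℝ, EuclideanSpace ℝ (Fin k)) (𝓡 k) ∞
      (fun y => h * (extChartAt (𝓡 k) (1 : G)).symm y * h⁻¹) (unitPt k G) :=
    ((contMDiff_conj (k := k) h).contMDiffAt).comp _ contMDiffAt_symm_unitPt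
  exact contDiffAt_of_group h1 (by rw [symm_unitPt, mul_one, mul_inv_cancel])

lemma Ad_eq_fderiv (h : G) : Ad h = fderiv ℝ (chartConj h) (unitPt k G) := by
  have hd : MDifferentiableAt (𝓡 k) (𝓡 k) (fun x : G => h * x * h⁻¹) 1 :=
    (contMDiff_conj (k := k) h).contMDiffAt.mdifferentiableAt (by simp)
  have h2 : h * 1 * h⁻¹ = 1 := by simp
  have h1 : HasFDerivWithinAt (extChartAt (𝓡 k) (h * 1 * h⁻¹) ∘ (fun x : G => h * x * h⁻¹) ∘
      (extChartAt (𝓡 k) (1 : G)).symm) (Ad h) (Set.range (𝓡 k)) (extChartAt (𝓡 k) (1 : G) 1) :=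
    hd.hasMFDerivAt.2
  rw [h2, ModelWithCorners.Boundaryless.range_eq_univ, hasFDerivWithinAt_univ] at h1
  exact h1.fderiv.symm

lemma hasFDerivAt_chartConj (h : G) : HasFDerivAt (chartConj h) (Ad h) (unitPt k G) := by
  rw [Ad_eq_fderiv]
  exact ((contDiffAt_chartConj h).differentiableAt (by simp)).hasFDerivAt

/-- Near the unit, points of the chart image are mapped into the chart domain by conjugation. -/
lemma eventually_conj_mem (h : G) : ∀ᶠ y in 𝓝 (unitPt k G),
    h * (extChartAt (𝓡 k) (1 : G)).symm y * h⁻¹ ∈ (extChartAt (𝓡 k) (1 : G)).source := by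
  have h1 : ContinuousAt (fun y => h * (extChartAt (𝓡 k) (1 : G)).symm y * h⁻¹) (unitPt k G) :=
    (((contMDiff_conj (k := k) h).contMDiffAt).comp _ contMDiffAt_symm_unitPt).continuousAt
  refine h1.eventually ((isOpen_extChartAt_source (1 : G)).mem_nhds ?_)
  beta_reduce
  rw [symm_unitPt, mul_one, mul_inv_cancel]
  exact mem_extChartAt_source (1 : G)

lemma Ad_mul (g h : G) : Ad (k := k) (g * h) = (Ad g).comp (Ad h) := by
  have h1 : HasFDerivAt (chartConj g) (Ad g) (chartConj h (unitPt k G)) := by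
    rw [chartConj_unitPt]; exact hasFDerivAt_chartConj g
  have h2 := h1.comp _ (hasFDerivAt_chartConj h)
  refine (hasFDerivAt_chartConj (g * h)).unique (h2.congr_of_eventuallyEq ?_)
  filter_upwards [eventually_conj_mem h] with y hy
  simp only [Function.comp, chartConj]
  rw [(extChartAt (𝓡 k) (1 : G)).left_inv hy]
  congr 1
  group

lemma Ad_one : Ad (1 : G) = ContinuousLinearMap.id ℝ (EuclideanSpace ℝ (Fin k)) := by
  refine (hasFDerivAt_chartConj (1 : G)).unique ((hasFDerivAt_id _).congr_of_eventuallyEq ?_)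
  filter_upwards [(isOpen_target (1 : G)).mem_nhds (unitPt_mem (k := k))] with y hy
  rw [chartConj, one_mul, inv_one, mul_one, (extChartAt (𝓡 k) (1 : G)).right_inv hy]; rfl

lemma Ad_inv_apply (h : G) (a : EuclideanSpace ℝ (Fin k)) : Ad h⁻¹ (Ad h a) = a := by
  have := congrArg (fun L => L a) (Ad_mul (k := k) h⁻¹ h)
  simpa [Ad_one] using this.symm

end LieGroup

section LieGroup

variable {k : ℕ} {G : Type*} [TopologicalSpace G] [ChartedSpace (EuclideanSpace ℝ (Fin k)) G]
  [Group G] [LieGroup (𝓡 k) ∞ G]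

/-- The left-invariant vector field with value `a` at the unit is `y ↦ ∂₂m(y, e) a` in the chart at
the unit. -/
lemma mpullback_mulInvariantVectorField_chart (a : EuclideanSpace ℝ (Fin k)) :
    ∀ᶠ y in 𝓝 (unitPt k G),
      (VectorField.mpullbackWithin 𝓘(ℝ, EuclideanSpace ℝ (Fin k)) (𝓡 k)
        (extChartAt (𝓡 k) (1 : G)).symm
        (mulInvariantVectorField (show GroupLieAlgebra (𝓡 k) G from a)) Set.univ y :
        EuclideanSpace ℝ (Fin k)) =
      fderiv ℝ (fun z => chartMul G (y, z)) (unitPt k G) a := by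
  filter_upwards [(isOpen_target (1 : G)).mem_nhds (unitPt_mem (k := k))] with y hy
  set φ := extChartAt (𝓡 k) (1 : G) with hφ
  have hinv1 := mfderiv_extChartAt_comp_mfderivWithin_extChartAt_symm (I := 𝓡 k) hy
  have hinv2 := mfderivWithin_extChartAt_symm_comp_mfderiv_extChartAt (I := 𝓡 k) hy
  rw [ModelWithCorners.Boundaryless.range_eq_univ] at hinv1 hinv2
  have hsrc : φ.symm y ∈ (chartAt (EuclideanSpace ℝ (Fin k)) (1 : G)).source := by
    have := φ.map_target hy
    rwa [extChartAt_source] at this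
  have hφd : MDifferentiableAt (𝓡 k) 𝓘(ℝ, EuclideanSpace ℝ (Fin k)) φ (φ.symm y * 1) := by
    rw [mul_one]; exact mdifferentiableAt_extChartAt hsrc
  have hmul : MDifferentiableAt (𝓡 k) (𝓡 k) (fun x : G => φ.symm y * x) 1 :=
    (contMDiff_mul_left (n := ∞)).contMDiffAt.mdifferentiableAt (by simp)
  have hsymm : MDifferentiableAt 𝓘(ℝ, EuclideanSpace ℝ (Fin k)) (𝓡 k) φ.symm (unitPt k G) :=
    contMDiffAt_symm_unitPt.mdifferentiableAt (by simp)
  have hmul' : MDifferentiableAt (𝓡 k) (𝓡 k) (fun x : G => φ.symm y * x) (φ.symm (unitPt k G)) := by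
    rw [symm_unitPt]; exact hmul
  have hφd' : MDifferentiableAt (𝓡 k) 𝓘(ℝ, EuclideanSpace ℝ (Fin k)) φ
      (((fun x : G => φ.symm y * x) ∘ φ.symm) (unitPt k G)) := by
    simp only [Function.comp]; rw [symm_unitPt]; exact hφd
  have hc1 := mfderiv_comp (unitPt k G) hmul' hsymm
  have hc2 := mfderiv_comp (unitPt k G) hφd' (hmul'.comp _ hsymm)
  rw [VectorField.mpullbackWithin_apply, ContinuousLinearMap.inverse_eq hinv2 hinv1]
  have e1 : dsymm (1 : G) (unitPt k G) a = a := by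
    exact congrArg (fun L => L a) (dsymm_self (n := k) (1 : G))
  have e2 : (mfderiv 𝓘(ℝ, EuclideanSpace ℝ (Fin k)) 𝓘(ℝ, EuclideanSpace ℝ (Fin k))
      (φ ∘ (fun x : G => φ.symm y * x) ∘ φ.symm) (unitPt k G)) =
      fderiv ℝ (fun z => chartMul G (y, z)) (unitPt k G) := mfderiv_eq_fderiv
  have h3 : (mfderiv 𝓘(ℝ, EuclideanSpace ℝ (Fin k)) 𝓘(ℝ, EuclideanSpace ℝ (Fin k))
      (φ ∘ (fun x : G => φ.symm y * x) ∘ φ.symm) (unitPt k G)) a =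
      (mfderiv (𝓡 k) 𝓘(ℝ, EuclideanSpace ℝ (Fin k)) φ (φ.symm y * φ.symm (unitPt k G)))
        ((mfderiv (𝓡 k) (𝓡 k) (fun x : G => φ.symm y * x) (φ.symm (unitPt k G)))
          (dsymm (1 : G) (unitPt k G) a)) := by
    rw [hc2, hc1]; rfl
  rw [e2, e1] at h3
  refine Eq.trans ?_ h3.symm
  rw [mulInvariantVectorField]
  have h4 : ∀ u : G, u = 1 →
    ((mfderiv (𝓡 k) 𝓘(ℝ, EuclideanSpace ℝ (Fin k)) φ (φ.symm y))
      ((mfderiv (𝓡 k) (𝓡 k) (fun x : G => φ.symm y * x) 1) a : EuclideanSpace ℝ (Fin k)) :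
        EuclideanSpace ℝ (Fin k)) =
    (mfderiv (𝓡 k) 𝓘(ℝ, EuclideanSpace ℝ (Fin k)) φ (φ.symm y * u))
        ((mfderiv (𝓡 k) (𝓡 k) (fun x : G => φ.symm y * x) u) a : EuclideanSpace ℝ (Fin k)) := by
    rintro u rfl
    rw [mul_one]
  exact h4 _ symm_unitPt

/-- The Lie bracket in the chart at the unit. -/
lemma lieBr_eq_chart (a b : EuclideanSpace ℝ (Fin k)) : lieBr G a b =
    fderiv ℝ (fun y => fderiv ℝ (fun z => chartMul G (y, z)) (unitPt k G) b) (unitPt k G) a -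
      fderiv ℝ (fun y => fderiv ℝ (fun z => chartMul G (y, z)) (unitPt k G) a) (unitPt k G) b := by
  have hV := mpullback_mulInvariantVectorField_chart (G := G) (k := k)
  have he : ∀ a : EuclideanSpace ℝ (Fin k),
      fderiv ℝ (fun z => chartMul G (unitPt k G, z)) (unitPt k G) a = a := by
    intro a
    have h1 : (fun z => chartMul G (unitPt k G, z)) =ᶠ[𝓝 (unitPt k G)] id := by
      filter_upwards [(isOpen_target (1 : G)).mem_nhds (unitPt_mem (k := k))] with y hy
      simp only [chartMul]
      rw [symm_unitPt, one_mul, (extChartAt (𝓡 k) (1 : G)).right_inv hy]; rfl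
    rw [h1.fderiv_eq, fderiv_id]; rfl
  obtain ⟨V, hVdef⟩ : ∃ V : EuclideanSpace ℝ (Fin k) → EuclideanSpace ℝ (Fin k) →
      EuclideanSpace ℝ (Fin k), V = fun a y => VectorField.mpullbackWithin
        𝓘(ℝ, EuclideanSpace ℝ (Fin k)) (𝓡 k) (extChartAt (𝓡 k) (1 : G)).symm
        (mulInvariantVectorField (show GroupLieAlgebra (𝓡 k) G from a)) Set.univ y := ⟨_, rfl⟩
  have hVf : ∀ a, V a =ᶠ[𝓝 (unitPt k G)]
      fun y => fderiv ℝ (fun z => chartMul G (y, z)) (unitPt k G) a := by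
    rw [hVdef]; exact hV
  have h1 : lieBr G a b = VectorField.lieBracketWithin ℝ (V a) (V b) Set.univ (unitPt k G) := by
    have h2 : lieBr G a b = (mfderiv (𝓡 k) 𝓘(ℝ, EuclideanSpace ℝ (Fin k)) (extChartAt (𝓡 k) (1 : G))
        1).inverse (VectorField.lieBracketWithin (E := EuclideanSpace ℝ (Fin k)) ℝ
          (VectorField.mpullbackWithin 𝓘(ℝ, EuclideanSpace ℝ (Fin k)) (𝓡 k)
            (extChartAt (𝓡 k) (1 : G)).symm
            (mulInvariantVectorField (show GroupLieAlgebra (𝓡 k) G from a)) (Set.range (𝓡 k)))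
          (VectorField.mpullbackWithin 𝓘(ℝ, EuclideanSpace ℝ (Fin k)) (𝓡 k)
            (extChartAt (𝓡 k) (1 : G)).symm
            (mulInvariantVectorField (show GroupLieAlgebra (𝓡 k) G from b)) (Set.range (𝓡 k)))
          ((extChartAt (𝓡 k) (1 : G)).symm ⁻¹' Set.univ ∩ Set.range (𝓡 k))
          (extChartAt (𝓡 k) (1 : G) 1)) := rfl
    rw [h2, mfderiv_extChartAt_self, ModelWithCorners.Boundaryless.range_eq_univ,
      Set.preimage_univ, Set.univ_inter, hVdef]
    exact congrArg (fun L : EuclideanSpace ℝ (Fin k) →L[ℝ] EuclideanSpace ℝ (Fin k) => L _)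
      ContinuousLinearMap.inverse_id
  have hVa : ∀ a, V a (unitPt k G) = a := fun a => (hVf a).self_of_nhds.trans (he a)
  rw [h1, VectorField.lieBracketWithin_univ, VectorField.lieBracket_eq]
  beta_reduce
  rw [hVa, hVa]
  rw [(hVf a).fderiv_eq, (hVf b).fderiv_eq]

/-- The adjoint representation in the chart at the unit. -/
noncomputable def chartAd (x : EuclideanSpace ℝ (Fin k)) :
    EuclideanSpace ℝ (Fin k) →L[ℝ] EuclideanSpace ℝ (Fin k) :=
  Ad ((extChartAt (𝓡 k) (1 : G)).symm x)

/-- The differential of the adjoint representation at the unit is the Lie bracket. -/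
lemma differentiableAt_chartAd : DifferentiableAt ℝ (chartAd (G := G)) (unitPt k G) ∧
    ∀ u a, fderiv ℝ (chartAd (G := G)) (unitPt k G) u a = lieBr G u a := by
  have h0 : chartAd (k := k) (G := G) = fun x => fderiv ℝ (fun y =>
      chartConj ((extChartAt (𝓡 k) (1 : G)).symm x) y) (unitPt k G) :=
    funext fun x => Ad_eq_fderiv _
  have ht := (isOpen_target (1 : G)).mem_nhds (unitPt_mem (k := k))
  have hl : ∀ y ∈ (extChartAt (𝓡 k) (1 : G)).target,
    extChartAt (𝓡 k) (1 : G) ((extChartAt (𝓡 k) (1 : G)).symm y) = y :=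
    fun y hy => (extChartAt (𝓡 k) (1 : G)).right_inv hy
  have hsrc : ∀ᶠ z in 𝓝 (unitPt k G, unitPt k G), (extChartAt (𝓡 k) (1 : G)).symm z.1 *
      (extChartAt (𝓡 k) (1 : G)).symm z.2 * ((extChartAt (𝓡 k) (1 : G)).symm z.1)⁻¹ ∈
      (extChartAt (𝓡 k) (1 : G)).source := by
    have h1 : ContMDiffAt 𝓘(ℝ, EuclideanSpace ℝ (Fin k) × EuclideanSpace ℝ (Fin k)) (𝓡 k) ∞
        (fun z : EuclideanSpace ℝ (Fin k) × EuclideanSpace ℝ (Fin k) =>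
          (extChartAt (𝓡 k) (1 : G)).symm z.1) (unitPt k G, unitPt k G) :=
      ContMDiffAt.comp (g := (extChartAt (𝓡 k) (1 : G)).symm) (unitPt k G, unitPt k G)
        contMDiffAt_symm_unitPt contDiffAt_fst.contMDiffAt
    have h2 : ContMDiffAt 𝓘(ℝ, EuclideanSpace ℝ (Fin k) × EuclideanSpace ℝ (Fin k)) (𝓡 k) ∞
        (fun z : EuclideanSpace ℝ (Fin k) × EuclideanSpace ℝ (Fin k) =>
          (extChartAt (𝓡 k) (1 : G)).symm z.2) (unitPt k G, unitPt k G) :=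
      ContMDiffAt.comp (g := (extChartAt (𝓡 k) (1 : G)).symm) (unitPt k G, unitPt k G)
        contMDiffAt_symm_unitPt contDiffAt_snd.contMDiffAt
    refine ((h1.mul h2).mul h1.inv).continuousAt.eventually
      ((isOpen_extChartAt_source (1 : G)).mem_nhds ?_)
    change (extChartAt (𝓡 k) (1 : G)).symm (unitPt k G) * (extChartAt (𝓡 k) (1 : G)).symm (unitPt k G)
      * ((extChartAt (𝓡 k) (1 : G)).symm (unitPt k G))⁻¹ ∈ _
    rw [symm_unitPt, mul_one, mul_inv_cancel]
    exact mem_extChartAt_source (1 : G)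
  have key := fderiv_conj_eq_bracket (m := chartMul (k := k) G)
    (C := fun z => chartConj ((extChartAt (𝓡 k) (1 : G)).symm z.1) z.2) (e := unitPt k G)
    (contDiffAt_chartMul.of_le ENat.LEInfty.out) (contDiffAt_chartConj_joint.of_le ENat.LEInfty.out)
    (by
      filter_upwards [ht] with y hy
      simp only [chartMul]
      rw [symm_unitPt, mul_one, hl y hy])
    (by
      filter_upwards [hsrc] with z hz
      simp only [chartMul, chartConj]
      rw [(extChartAt (𝓡 k) (1 : G)).left_inv hz, inv_mul_cancel_right])
    (Eventually.of_forall fun x => chartConj_unitPt _)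
    (by
      filter_upwards [ht] with y hy
      simp only [chartConj]
      rw [symm_unitPt, one_mul, inv_one, mul_one, hl y hy])
  rw [h0]
  exact ⟨key.1, fun u a => (key.2 u a).trans (lieBr_eq_chart u a).symm⟩

lemma chartAd_unitPt : chartAd (G := G) (unitPt k G) = ContinuousLinearMap.id ℝ _ := by
  rw [chartAd, symm_unitPt, Ad_one]

/-- `Ad h` is an automorphism of the Lie algebra. -/
lemma Ad_lieBr (h : G) (u a : EuclideanSpace ℝ (Fin k)) :
    Ad h (lieBr G u a) = lieBr G (Ad h u) (Ad h a) := by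
  obtain ⟨hd, hb⟩ := differentiableAt_chartAd (k := k) (G := G)
  have hd' : HasFDerivAt (chartAd (G := G)) (fderiv ℝ (chartAd (G := G)) (unitPt k G))
      (chartConj h (unitPt k G)) := by
    rw [chartConj_unitPt]; exact hd.hasFDerivAt
  have h1 := (HasFDerivAt.comp _ hd' (hasFDerivAt_chartConj h)).clm_apply
    (hasFDerivAt_const (Ad h a) (unitPt k G))
  have h2 := (Ad (k := k) h).hasFDerivAt.comp (unitPt k G)
    (hd.hasFDerivAt.clm_apply (hasFDerivAt_const a (unitPt k G)))
  have h3 : (fun x => (chartAd (G := G) ∘ chartConj h) x (Ad h a)) =ᶠ[𝓝 (unitPt k G)]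
      (Ad h) ∘ fun x => chartAd (G := G) x a := by
    filter_upwards [eventually_conj_mem h] with y hy
    simp only [Function.comp, chartAd, chartConj]
    rw [(extChartAt (𝓡 k) (1 : G)).left_inv hy, Ad_mul, Ad_mul]
    simp [Ad_inv_apply]
  have h4 := congrArg (fun L => L u) (h1.unique (h2.congr_of_eventuallyEq h3))
  simp only [add_apply, ContinuousLinearMap.comp_apply, ContinuousLinearMap.flip_apply, zero_apply,
    map_zero, zero_add, hb] at h4
  exact h4.symm

lemma continuous_Ad : Continuous (Ad (k := k) (G := G)) := by
  have := topologicalGroup_of_lieGroup (𝓡 k) ∞ (G := G)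
  have h1 : ContinuousAt (Ad (k := k) (G := G)) 1 := by
    have h2 : ContinuousAt (chartAd (G := G)) (extChartAt (𝓡 k) (1 : G) 1) :=
      (differentiableAt_chartAd (k := k) (G := G)).1.continuousAt
    have h3 := ContinuousAt.comp h2 (continuousAt_extChartAt (I := 𝓡 k) (1 : G))
    refine h3.congr ?_
    filter_upwards [extChartAt_source_mem_nhds (I := 𝓡 k) (1 : G)] with x hx
    simp only [Function.comp, chartAd]
    rw [(extChartAt (𝓡 k) (1 : G)).left_inv hx]
  rw [continuous_iff_continuousAt]
  intro g
  have h2 : ContinuousAt (fun h : G => (Ad (k := k) g).comp (Ad (g⁻¹ * h))) g := by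
    have h3 : ContinuousAt (fun h : G => Ad (k := k) (g⁻¹ * h)) g := by
      refine ContinuousAt.comp (g := Ad (k := k)) ?_ (by fun_prop)
      rw [inv_mul_cancel]; exact h1
    exact continuousAt_const.clm_comp h3
  refine h2.congr (Eventually.of_forall fun h => ?_)
  beta_reduce
  rw [← Ad_mul, mul_inv_cancel_left]

end LieGroup

/-! ### The Cartan–Killing metric -/

/-- If an endomorphism `T` is skew for an inner product, then `tr T² ≤ 0`. -/
lemma trace_sq_nonpos_of_skew {V : Type*} [AddCommGroup V] [Module ℝ V] [FiniteDimensional ℝ V]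
    (B : LinearMap.BilinForm ℝ V) (hs : ∀ a b, B a b = B b a) (hpos : ∀ a, a ≠ 0 → 0 < B a a)
    (T : V →ₗ[ℝ] V) (hT : ∀ a b, B (T a) b + B a (T b) = 0) :
    LinearMap.trace ℝ V (T ∘ₗ T) ≤ 0 := by
  have : Invertible (2 : ℝ) := invertibleOfNonzero two_ne_zero
  obtain ⟨v, hv⟩ := LinearMap.BilinForm.exists_orthogonal_basis (B := B) ⟨hs⟩
  rw [LinearMap.trace_eq_matrix_trace ℝ v, Matrix.trace]
  refine Finset.sum_nonpos fun i _ => ?_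
  -- in an orthogonal basis `(T²)ᵢᵢ B(vᵢ, vᵢ) = B(T²vᵢ, vᵢ) = -B(Tvᵢ, Tvᵢ) ≤ 0`
  have hcoord : ∀ x, v.repr x i * B (v i) (v i) = B x (v i) := by
    intro x
    conv_rhs => rw [← v.sum_repr x]
    simp only [map_sum, LinearMap.sum_apply, map_smul, LinearMap.smul_apply, smul_eq_mul]
    rw [Finset.sum_eq_single i]
    · intro j _ hj
      have h0 : B (v j) (v i) = 0 := hv hj
      rw [h0, mul_zero]
    · simp
  have hvi := hpos (v i) (v.ne_zero i)
  have h1 := hcoord (T (T (v i)))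
  have h2 := hT (T (v i)) (v i)
  have h3 : 0 ≤ B (T (v i)) (T (v i)) := by
    by_cases h : T (v i) = 0
    · simp [h]
    · exact (hpos _ h).le
  rw [Matrix.diag_apply, LinearMap.toMatrix_apply, LinearMap.comp_apply]
  by_contra hcon
  push Not at hcon
  have := mul_pos hcon hvi
  linarith

section Killing

variable {k : ℕ} {G : Type*} [TopologicalSpace G] [ChartedSpace (EuclideanSpace ℝ (Fin k)) G]
  [Group G] [LieGroup (𝓡 k) ∞ G]

variable (k G) in
/-- The adjoint representation of the Lie algebra, as a continuous linear map. -/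
noncomputable def adMap :
    EuclideanSpace ℝ (Fin k) →L[ℝ] EuclideanSpace ℝ (Fin k) →L[ℝ] EuclideanSpace ℝ (Fin k) :=
  fderiv ℝ (chartAd (G := G)) (unitPt k G)

lemma adMap_apply (u a : EuclideanSpace ℝ (Fin k)) : adMap k G u a = lieBr G u a :=
  differentiableAt_chartAd.2 u a

lemma adMap_lieBr (u v : EuclideanSpace ℝ (Fin k)) :
    adMap k G (lieBr G u v) = adMap k G u * adMap k G v - adMap k G v * adMap k G u := by
  ext1 a
  have h := lie_lie (show GroupLieAlgebra (𝓡 k) G from u) (show GroupLieAlgebra (𝓡 k) G from v)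
    (show GroupLieAlgebra (𝓡 k) G from a)
  simp only [sub_apply, mul_apply_eq_comp, adMap_apply]
  exact h

lemma cartanKilling_eq (a b : EuclideanSpace ℝ (Fin k)) : cartanKilling G a b =
    -LinearMap.trace ℝ _ ((adMap k G a).toLinearMap ∘ₗ (adMap k G b).toLinearMap) := by
  have h := killingForm_apply_apply ℝ (GroupLieAlgebra (𝓡 k) G)
    (show GroupLieAlgebra (𝓡 k) G from a) (show GroupLieAlgebra (𝓡 k) G from b)
  rw [cartanKilling, h]
  have hx : ∀ a : EuclideanSpace ℝ (Fin k), (adMap k G a).toLinearMap =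
      (LieAlgebra.ad ℝ (GroupLieAlgebra (𝓡 k) G) (show GroupLieAlgebra (𝓡 k) G from a) :) := by
    intro a
    ext1 x
    exact adMap_apply a x
  rw [hx, hx]
  rfl

variable (k G) in
/-- The Cartan–Killing metric as a bilinear map. -/
noncomputable def killBilin : EuclideanSpace ℝ (Fin k) →ₗ[ℝ] EuclideanSpace ℝ (Fin k) →ₗ[ℝ] ℝ :=
  LinearMap.mk₂ ℝ (cartanKilling G)
    (fun a b c => by
      simp only [cartanKilling_eq, map_add, ContinuousLinearMap.toLinearMap_add,
        LinearMap.add_comp]; ring)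
    (fun r a b => by
      simp only [cartanKilling_eq, map_smul, ContinuousLinearMap.toLinearMap_smul,
        LinearMap.smul_comp, smul_eq_mul]; ring)
    (fun a b c => by
      simp only [cartanKilling_eq, map_add, ContinuousLinearMap.toLinearMap_add,
        LinearMap.comp_add]; ring)
    (fun r a b => by
      simp only [cartanKilling_eq, map_smul, ContinuousLinearMap.toLinearMap_smul,
        LinearMap.comp_smul, smul_eq_mul]; ring)

lemma killBilin_apply (a b : EuclideanSpace ℝ (Fin k)) : killBilin k G a b = cartanKilling G a b := rfl

lemma continuous_cartanKilling :
    Continuous fun z : EuclideanSpace ℝ (Fin k) × EuclideanSpace ℝ (Fin k) =>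
      cartanKilling G z.1 z.2 := by
  let L : EuclideanSpace ℝ (Fin k) →ₗ[ℝ] EuclideanSpace ℝ (Fin k) →L[ℝ] ℝ :=
    LinearMap.toContinuousLinearMap.toLinearMap ∘ₗ killBilin k G
  have hL : Continuous L := L.continuous_of_finiteDimensional
  exact (hL.comp continuous_fst).clm_apply continuous_snd

/-- The Cartan–Killing metric is invariant under the adjoint representation of the group. -/
lemma cartanKilling_Ad (h : G) (a b : EuclideanSpace ℝ (Fin k)) :
    cartanKilling G (Ad h a) (Ad h b) = cartanKilling G a b := by
  have hinv : ∀ x, Ad h (Ad h⁻¹ x) = x := fun x => by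
    have := Ad_inv_apply (k := k) h⁻¹ x
    rwa [inv_inv] at this
  have hc : ∀ a : EuclideanSpace ℝ (Fin k), (adMap k G (Ad h a)).toLinearMap =
      (Ad h).toLinearMap ∘ₗ (adMap k G a).toLinearMap ∘ₗ (Ad h⁻¹).toLinearMap := by
    intro a
    ext1 x
    change adMap k G (Ad h a) x = Ad h (adMap k G a (Ad h⁻¹ x))
    rw [adMap_apply, adMap_apply, Ad_lieBr, hinv]
  rw [cartanKilling_eq, cartanKilling_eq, hc, hc]
  congr 1
  have h1 : (Ad (k := k) h⁻¹).toLinearMap ∘ₗ (Ad h).toLinearMap = LinearMap.id := by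
    ext1 x; exact Ad_inv_apply h x
  calc _ = LinearMap.trace ℝ _ ((Ad h).toLinearMap ∘ₗ ((adMap k G a).toLinearMap ∘ₗ
        ((Ad h⁻¹).toLinearMap ∘ₗ (Ad h).toLinearMap) ∘ₗ (adMap k G b).toLinearMap ∘ₗ
          (Ad h⁻¹).toLinearMap)) := rfl
    _ = _ := by
      rw [h1, LinearMap.id_comp, LinearMap.trace_comp_comm', LinearMap.comp_assoc,
        LinearMap.comp_assoc, h1, LinearMap.comp_id]

/-- Averaging over a compact Lie group yields an inner product on its Lie algebra that is invariant
under the adjoint representation. -/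
lemma exists_invariant_inner [CompactSpace G] : ∃ B : LinearMap.BilinForm ℝ (EuclideanSpace ℝ (Fin k)),
    (∀ a b, B a b = B b a) ∧ (∀ a, a ≠ 0 → 0 < B a a) ∧
      ∀ (h : G) a b, B (Ad h a) (Ad h b) = B a b := by
  have := topologicalGroup_of_lieGroup (𝓡 k) ∞ (G := G)
  borelize G
  let μ : Measure G := Measure.haarMeasure ⊤
  have hcont : ∀ a b : EuclideanSpace ℝ (Fin k),
      Continuous fun h : G => inner ℝ (Ad h⁻¹ a) (Ad h⁻¹ b) := fun a b => by
    have h1 : Continuous fun h : G => Ad (k := k) h⁻¹ := continuous_Ad.comp continuous_inv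
    exact (h1.clm_apply continuous_const).inner (h1.clm_apply continuous_const)
  have hint : ∀ a b : EuclideanSpace ℝ (Fin k),
      Integrable (fun h : G => (inner ℝ (Ad h⁻¹ a) (Ad h⁻¹ b) : ℝ)) μ := fun a b =>
    (hcont a b).integrable_of_hasCompactSupport (HasCompactSupport.of_compactSpace _)
  -- with `Ad h⁻¹`, left invariance of the Haar measure suffices
  refine ⟨LinearMap.mk₂ ℝ (fun a b => ∫ h : G, (inner ℝ (Ad h⁻¹ a) (Ad h⁻¹ b) : ℝ) ∂μ) ?_ ?_ ?_ ?_,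
    ?_, ?_, ?_⟩
  · intro a b c
    simp only [map_add, inner_add_left]
    exact integral_add (hint _ _) (hint _ _)
  · intro r a b
    simp only [map_smul, real_inner_smul_left, smul_eq_mul]
    exact integral_const_mul _ _
  · intro a b c
    simp only [map_add, inner_add_right]
    exact integral_add (hint _ _) (hint _ _)
  · intro r a b
    simp only [map_smul, real_inner_smul_right, smul_eq_mul]
    exact integral_const_mul _ _
  · intro a b
    simp only [LinearMap.mk₂_apply, real_inner_comm]
  · intro a ha
    simp only [LinearMap.mk₂_apply]
    refine (hcont a a).integral_pos_of_hasCompactSupport_nonneg_nonzero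
      (HasCompactSupport.of_compactSpace _) (fun h => real_inner_self_nonneg) (x := 1) ?_
    simpa [Ad_one] using ha
  · intro g a b
    simp only [LinearMap.mk₂_apply]
    rw [← integral_mul_left_eq_self (μ := μ) _ g]
    refine integral_congr_ae (Eventually.of_forall fun h => ?_)
    simp only [mul_inv_rev, Ad_mul, ContinuousLinearMap.comp_apply, Ad_inv_apply]

/-- The Cartan–Killing metric of a compact group is positive semidefinite: the operators `ad a` are
skew for an invariant inner product. -/
lemma cartanKilling_nonneg [CompactSpace G] (a : EuclideanSpace ℝ (Fin k)) :
    0 ≤ cartanKilling G a a := by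
  obtain ⟨B, hs, hpos, hB⟩ := exists_invariant_inner (k := k) (G := G)
  rw [cartanKilling_eq, neg_nonneg]
  refine trace_sq_nonpos_of_skew B hs hpos _ fun x y => ?_
  let L : EuclideanSpace ℝ (Fin k) →ₗ[ℝ] EuclideanSpace ℝ (Fin k) →L[ℝ] ℝ :=
    LinearMap.toContinuousLinearMap.toLinearMap ∘ₗ B
  let L' : EuclideanSpace ℝ (Fin k) →L[ℝ] EuclideanSpace ℝ (Fin k) →L[ℝ] ℝ :=
    LinearMap.toContinuousLinearMap L
  have hd := (differentiableAt_chartAd (k := k) (G := G)).1.hasFDerivAt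
  have h1 := (L'.hasFDerivAt.comp (unitPt k G) (hd.clm_apply
    (hasFDerivAt_const x (unitPt k G)))).clm_apply (hd.clm_apply (hasFDerivAt_const y (unitPt k G)))
  -- differentiate the constant function `z ↦ B (Ad z x) (Ad z y)` at the unit
  have h2 : (fun z => (L' ∘ fun z => chartAd (G := G) z x) z (chartAd (G := G) z y)) =
      fun _ => B x y := funext fun z => hB _ x y
  rw [h2] at h1
  have h3 := congrArg (fun M => M a) (h1.unique (hasFDerivAt_const _ _))
  simp only [add_apply, ContinuousLinearMap.comp_apply, ContinuousLinearMap.flip_apply, zero_apply,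
    map_zero, zero_add, Function.comp, chartAd_unitPt, ContinuousLinearMap.id_apply] at h3
  rw [add_comm]
  exact h3

end Killing

/-! ### Gauge fields -/

section TraceForm

variable {k : ℕ}

variable (k) in
/-- The trace form `(P, Q) ↦ -tr(PQ)` on endomorphisms. -/
noncomputable def negTrace :
    (EuclideanSpace ℝ (Fin k) →L[ℝ] EuclideanSpace ℝ (Fin k)) →ₗ[ℝ]
      (EuclideanSpace ℝ (Fin k) →L[ℝ] EuclideanSpace ℝ (Fin k)) →ₗ[ℝ] ℝ :=
  LinearMap.mk₂ ℝ (fun P Q => -LinearMap.trace ℝ _ (P.toLinearMap ∘ₗ Q.toLinearMap))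
    (fun P P' Q => by
      simp only [ContinuousLinearMap.toLinearMap_add, LinearMap.add_comp, map_add]; ring)
    (fun r P Q => by
      simp only [ContinuousLinearMap.toLinearMap_smul, LinearMap.smul_comp, map_smul,
        smul_eq_mul]; ring)
    (fun P Q Q' => by
      simp only [ContinuousLinearMap.toLinearMap_add, LinearMap.comp_add, map_add]; ring)
    (fun r P Q => by
      simp only [ContinuousLinearMap.toLinearMap_smul, LinearMap.comp_smul, map_smul,
        smul_eq_mul]; ring)

/-- The trace form is invariant under conjugation. -/
lemma negTrace_conj {c d P Q P' Q' : EuclideanSpace ℝ (Fin k) →L[ℝ] EuclideanSpace ℝ (Fin k)}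
    (hdc : ∀ v, d (c v) = v) (hP : c * P' = P * c) (hQ : c * Q' = Q * c) :
    negTrace k P' Q' = negTrace k P Q := by
  have hdc' : d * c = 1 := by ext1 v; exact hdc v
  have hcd : c.toLinearMap ∘ₗ d.toLinearMap = LinearMap.id := by
    have h1 : d.toLinearMap ∘ₗ c.toLinearMap = LinearMap.id := by ext1 v; exact hdc v
    exact (LinearMap.comp_eq_id_comm ℝ _).1 h1
  have hP' : P' * Q' = d * (P * Q) * c := by
    calc P' * Q' = (d * c) * P' * Q' := by rw [hdc', one_mul]
      _ = d * (c * P') * Q' := by simp only [mul_assoc]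
      _ = d * P * (c * Q') := by rw [hP]; simp only [mul_assoc]
      _ = _ := by rw [hQ]; simp only [mul_assoc]
  simp only [negTrace, LinearMap.mk₂_apply, neg_inj]
  calc LinearMap.trace ℝ _ (P'.toLinearMap ∘ₗ Q'.toLinearMap)
      = LinearMap.trace ℝ _ ((P' * Q').toLinearMap) := rfl
    _ = LinearMap.trace ℝ _ ((d.toLinearMap ∘ₗ (P * Q).toLinearMap) ∘ₗ c.toLinearMap) := by
      rw [hP']; rfl
    _ = LinearMap.trace ℝ _ ((P * Q).toLinearMap) := by
      rw [LinearMap.trace_comp_comm', ← LinearMap.comp_assoc, hcd, LinearMap.id_comp]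
    _ = _ := rfl

end TraceForm

section Gauge

variable {k : ℕ} {G : Type*} [TopologicalSpace G] [ChartedSpace (EuclideanSpace ℝ (Fin k)) G]
  [Group G] {n : ℕ} {S : Type*} [TopologicalSpace S] [ChartedSpace (EuclideanSpace ℝ (Fin n)) S]
  {ι : Type*} {Z : VectorBundleCore ℝ S (EuclideanSpace ℝ (Fin k)) ι}

lemma coordChange_left_inv {i j : ι} {x : S} (hi : x ∈ Z.baseSet i) (hj : x ∈ Z.baseSet j)
    (v : EuclideanSpace ℝ (Fin k)) : Z.coordChange j i x (Z.coordChange i j x v) = v := by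
  rw [Z.coordChange_comp i j i x ⟨⟨hi, hj⟩, hi⟩, Z.coordChange_self i x hi]

/-- The part of the image of the chart at `p` over which the trivialization `i` is defined. -/
def trivDom (Z : VectorBundleCore ℝ S (EuclideanSpace ℝ (Fin k)) ι) (i : ι) (p : S) :
    Set (EuclideanSpace ℝ (Fin n)) :=
  (extChartAt (𝓡 n) p).target ∩ (extChartAt (𝓡 n) p).symm ⁻¹' Z.baseSet i

lemma isOpen_trivDom (i : ι) (p : S) : IsOpen (trivDom (n := n) Z i p) :=
  (continuousOn_extChartAt_symm p).isOpen_inter_preimage (isOpen_target p) (Z.isOpen_baseSet i)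

lemma chart_mem_trivDom {i : ι} {p x : S} (hp : x ∈ (extChartAt (𝓡 n) p).source)
    (hi : x ∈ Z.baseSet i) : extChartAt (𝓡 n) p x ∈ trivDom (n := n) Z i p :=
  ⟨(extChartAt (𝓡 n) p).map_source hp, by
    rw [Set.mem_preimage, (extChartAt (𝓡 n) p).left_inv hp]; exact hi⟩

variable [IsManifold (𝓡 n) ∞ S]

/-- The connection form in the trivialization `i` and the chart at `p`, a `1`-form on `ℝⁿ`. -/
noncomputable def connForm (A : AdConnection G (n := n) Z) (i : ι) (p : S)
    (y : EuclideanSpace ℝ (Fin n)) : EuclideanSpace ℝ (Fin n) →L[ℝ] EuclideanSpace ℝ (Fin k) :=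
  (A.form i ((extChartAt (𝓡 n) p).symm y) :
    EuclideanSpace ℝ (Fin n) →L[ℝ] EuclideanSpace ℝ (Fin k)).comp (dsymm p y)

lemma contDiffOn_connForm (A : AdConnection G (n := n) Z) (i : ι) (p : S) :
    ContDiffOn ℝ ∞ (connForm A i p) (trivDom Z i p) := by
  refine contDiffOn_clm_apply.2 fun X => ?_
  have h1 := (A.smooth i).comp ((contMDiffOn_extChartAt_symm (I := 𝓡 n) (n := ∞) p).mono
    (Set.inter_subset_left (t := (extChartAt (𝓡 n) p).symm ⁻¹' Z.baseSet i)))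
    Set.inter_subset_right
  have h2 := ContMDiffOn.clm_bundle_apply (F₁ := EuclideanSpace ℝ (Fin n))
    (E₁ := fun x : S => TangentSpace (𝓡 n) x) (F₂ := EuclideanSpace ℝ (Fin k))
    (E₂ := Bundle.Trivial S (EuclideanSpace ℝ (Fin k)))
    (b := (extChartAt (𝓡 n) p).symm) (ϕ := fun y => A.form i ((extChartAt (𝓡 n) p).symm y))
    (v := fun y => dsymm p y X) h1 ((contMDiffOn_dsymm p X).mono Set.inter_subset_left)
  intro y hy
  have h3 := h2 y hy
  simp only [contMDiffWithinAt_totalSpace] at h3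
  exact h3.2.contDiffWithinAt

lemma differentiableAt_connForm (A : AdConnection G (n := n) Z) {i : ι} {p : S}
    {y : EuclideanSpace ℝ (Fin n)} (hy : y ∈ trivDom Z i p) :
    DifferentiableAt ℝ (connForm A i p) y :=
  ((contDiffOn_connForm A i p).contDiffAt ((isOpen_trivDom i p).mem_nhds hy)).differentiableAt
    (by simp)

lemma connForm_trans (A : AdConnection G (n := n) Z) (i : ι) {p q : S}
    {y : EuclideanSpace ℝ (Fin n)} (hy : y ∈ overlap p q) (X : EuclideanSpace ℝ (Fin n)) :
    connForm A i p y X = connForm A i q (transMap p q y) (fderiv ℝ (transMap p q) y X) := by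
  rw [connForm, connForm, symm_transMap hy, dsymm_eq_comp hy]
  rfl

/-- The change of trivialization in the chart at `p`. -/
noncomputable def chartGauge (Z : VectorBundleCore ℝ S (EuclideanSpace ℝ (Fin k)) ι) (i j : ι)
    (p : S) (y : EuclideanSpace ℝ (Fin n)) :
    EuclideanSpace ℝ (Fin k) →L[ℝ] EuclideanSpace ℝ (Fin k) :=
  Z.coordChange i j ((extChartAt (𝓡 n) p).symm y)

lemma contDiffOn_chartGauge [Z.IsContMDiff (𝓡 n) ∞] (i j : ι) (p : S) :
    ContDiffOn ℝ ∞ (chartGauge (n := n) Z i j p) (trivDom Z i p ∩ trivDom Z j p) :=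
  ((Z.contMDiffOn_coordChange (𝓡 n) (n := ∞) i j).comp
    ((contMDiffOn_extChartAt_symm (I := 𝓡 n) (n := ∞) p).mono
      (fun _ hy => hy.1.1)) (fun _ hy => ⟨hy.1.2, hy.2.2⟩)).contDiffOn

lemma contDiffAt_chartGauge [Z.IsContMDiff (𝓡 n) ∞] {i j : ι} {p : S}
    {y : EuclideanSpace ℝ (Fin n)} (hi : y ∈ trivDom Z i p) (hj : y ∈ trivDom Z j p) :
    ContDiffAt ℝ ∞ (chartGauge (n := n) Z i j p) y :=
  (contDiffOn_chartGauge i j p).contDiffAt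
    (((isOpen_trivDom i p).inter (isOpen_trivDom j p)).mem_nhds ⟨hi, hj⟩)

lemma fderiv_chartGauge [Z.IsContMDiff (𝓡 n) ∞] {i j : ι} {p : S}
    {y : EuclideanSpace ℝ (Fin n)} (hi : y ∈ trivDom Z i p) (hj : y ∈ trivDom Z j p)
    (X : EuclideanSpace ℝ (Fin n)) : fderiv ℝ (chartGauge Z i j p) y X =
      (mfderiv (𝓡 n) 𝓘(ℝ, EuclideanSpace ℝ (Fin k) →L[ℝ] EuclideanSpace ℝ (Fin k))
        (Z.coordChange i j) ((extChartAt (𝓡 n) p).symm y) (dsymm p y X) :) := by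
  have h1 : MDifferentiableAt (𝓡 n) 𝓘(ℝ, EuclideanSpace ℝ (Fin k) →L[ℝ] EuclideanSpace ℝ (Fin k))
      (Z.coordChange i j) ((extChartAt (𝓡 n) p).symm y) :=
    ((Z.contMDiffOn_coordChange (𝓡 n) (n := ∞) i j).contMDiffAt
      (((Z.isOpen_baseSet i).inter (Z.isOpen_baseSet j)).mem_nhds ⟨hi.2, hj.2⟩)).mdifferentiableAt
      (by simp)
  have h2 := mfderiv_comp y h1 (mdifferentiableAt_symm hi.1)
  have h3 : mfderiv 𝓘(ℝ, EuclideanSpace ℝ (Fin n))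
      𝓘(ℝ, EuclideanSpace ℝ (Fin k) →L[ℝ] EuclideanSpace ℝ (Fin k))
      (Z.coordChange i j ∘ (extChartAt (𝓡 n) p).symm) y = fderiv ℝ (chartGauge Z i j p) y :=
    mfderiv_eq_fderiv
  rw [← h3, h2]
  rfl

/-- The adjoint action of the connection form. It is a connection form with values in an associative
algebra, so that `curvForm` applies to it. -/
noncomputable def adForm [LieGroup (𝓡 k) ∞ G] (A : AdConnection G (n := n) Z) (i : ι) (p : S)
    (y : EuclideanSpace ℝ (Fin n)) :
    EuclideanSpace ℝ (Fin n) →L[ℝ] EuclideanSpace ℝ (Fin k) →L[ℝ] EuclideanSpace ℝ (Fin k) :=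
  (adMap k G).comp (connForm A i p y)

variable [LieGroup (𝓡 k) ∞ G]

lemma adForm_apply (A : AdConnection G (n := n) Z) (i : ι) (p : S)
    (y X : EuclideanSpace ℝ (Fin n)) : adForm A i p y X = adMap k G (connForm A i p y X) := rfl

lemma contDiffOn_adForm (A : AdConnection G (n := n) Z) (i : ι) (p : S) :
    ContDiffOn ℝ ∞ (adForm A i p) (trivDom Z i p) :=
  contDiffOn_const.clm_comp (contDiffOn_connForm A i p)

lemma differentiableAt_adForm (A : AdConnection G (n := n) Z) {i : ι} {p : S}
    {y : EuclideanSpace ℝ (Fin n)} (hy : y ∈ trivDom Z i p) :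
    DifferentiableAt ℝ (adForm A i p) y :=
  ((contDiffOn_adForm A i p).contDiffAt ((isOpen_trivDom i p).mem_nhds hy)).differentiableAt
    (by simp)

/-- The gauge transformation law of the connection, in coordinates. -/
lemma adForm_gauge [Z.IsContMDiff (𝓡 n) ∞] (A : AdConnection G (n := n) Z) {i j : ι} {p q : S}
    {y : EuclideanSpace ℝ (Fin n)} (hy : y ∈ overlap p q) (hi : y ∈ trivDom Z i p)
    (hj : y ∈ trivDom Z j p) (X : EuclideanSpace ℝ (Fin n)) :
    chartGauge Z i j p y * adForm A i p y X =
      adForm A j q (transMap p q y) (fderiv ℝ (transMap p q) y X) * chartGauge Z i j p y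
        + fderiv ℝ (chartGauge Z i j p) y X := by
  ext1 ξ
  have h := A.compat i j ((extChartAt (𝓡 n) p).symm y) ⟨hi.2, hj.2⟩ (dsymm p y X) ξ
  simp only [add_apply, mul_apply_eq_comp, adForm_apply, ← connForm_trans A j hy, adMap_apply]
  rw [fderiv_chartGauge hi hj, add_comm]
  exact h.symm

/-- The curvature transforms tensorially. -/
lemma curvForm_adForm_gauge [Z.IsContMDiff (𝓡 n) ∞] (A : AdConnection G (n := n) Z) {i j : ι}
    {p q : S} {y : EuclideanSpace ℝ (Fin n)} (hy : y ∈ overlap p q) (hi : y ∈ trivDom Z i p)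
    (hj : y ∈ trivDom Z j p) (X Y : EuclideanSpace ℝ (Fin n)) :
    chartGauge Z i j p y * curvForm (adForm A i p) y X Y =
      curvForm (adForm A j q) (transMap p q y) (fderiv ℝ (transMap p q) y X)
        (fderiv ℝ (transMap p q) y Y) * chartGauge Z i j p y := by
  have hj' : transMap p q y ∈ trivDom Z j q := ⟨transMap_mem_target hy, by
    rw [Set.mem_preimage, symm_transMap hy]; exact hj.2⟩
  refine curvForm_gauge ((contDiffAt_transMap hy).of_le ENat.LEInfty.out)
    ((contDiffAt_chartGauge hi hj).of_le ENat.LEInfty.out) (differentiableAt_adForm A hj')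
    (differentiableAt_adForm A hi) ?_ X Y
  filter_upwards [(isOpen_overlap p q).mem_nhds hy, (isOpen_trivDom i p).mem_nhds hi,
    (isOpen_trivDom j p).mem_nhds hj] with z hz hiz hjz X
  exact adForm_gauge A hz hiz hjz X

/-- The function `F_{ij}F^{ij}` in the trivialization `i` and the chart at `p`: as the Cartan–Killing
metric is the trace form of the adjoint representation, it only involves the curvature of
`adForm A i p`. -/
noncomputable def curvSqLoc (A : AdConnection G (n := n) Z) (g : RMetric n S) (i : ι) (p : S)
    (y : EuclideanSpace ℝ (Fin n)) : ℝ :=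
  ∑ a, ∑ b, ∑ r, ∑ l, metricInv g p y a r * metricInv g p y b l *
    negTrace k (curvForm (adForm A i p) y (stdE a) (stdE b))
      (curvForm (adForm A i p) y (stdE r) (stdE l))

/-- The fourfold sum as two successive contractions with the inverse metric. -/
lemma curvSqLoc_eq_contract (A : AdConnection G (n := n) Z) (g : RMetric n S) (i : ι) (p : S)
    (y : EuclideanSpace ℝ (Fin n)) : curvSqLoc A g i p y =
      ∑ b, ∑ l, metricInv g p y b l • ∑ a, ∑ r, metricInv g p y a r •
        (negTrace k).compl₁₂ ((curvForm (adForm A i p) y).flip (stdE b))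
          ((curvForm (adForm A i p) y).flip (stdE l)) (stdE a) (stdE r) := by
  simp only [curvSqLoc, smul_eq_mul, Finset.mul_sum, LinearMap.compl₁₂_apply, LinearMap.flip_apply]
  rw [Finset.sum_comm]
  refine Finset.sum_congr rfl fun b _ => ?_
  rw [Finset.sum_comm' (t' := Finset.univ) (s' := fun _ => Finset.univ) (by simp)]
  rw [Finset.sum_comm]
  conv_rhs => rw [Finset.sum_comm]
  refine Finset.sum_congr rfl fun a _ => ?_
  rw [Finset.sum_comm]
  exact Finset.sum_congr rfl fun l _ => Finset.sum_congr rfl fun r _ => by ring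

end Gauge

/-! ### Positivity of contractions -/

section Positivity

variable {m : Type*} [Fintype m] {V : Type*} [AddCommGroup V] [Module ℝ V]

/-- The contraction of a positive semidefinite bilinear form with a positive semidefinite matrix. -/
lemma Matrix.PosSemidef.sum_mul_nonneg {P : Matrix m m ℝ} (hP : P.PosSemidef)
    (κ : V →ₗ[ℝ] V →ₗ[ℝ] ℝ) (hκ : ∀ v, 0 ≤ κ v v) (v : m → V) :
    0 ≤ ∑ i, ∑ j, P i j * κ (v i) (v j) := by
  obtain ⟨r, a, ha⟩ := Matrix.posSemidef_iff_eq_sum_vecMulVec.1 hP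
  have h : ∑ i, ∑ j, P i j * κ (v i) (v j) =
      ∑ s, κ (∑ i, a s i • v i) (∑ j, a s j • v j) := by
    have hP' : ∀ i j, P i j = ∑ s, a s i * a s j := fun i j => by
      rw [ha, Matrix.sum_apply]
      exact Finset.sum_congr rfl fun s _ => by simp [Matrix.vecMulVec_apply]
    simp only [map_sum, LinearMap.sum_apply, map_smul, LinearMap.smul_apply, smul_eq_mul, hP',
      Finset.sum_mul, Finset.mul_sum]
    rw [Finset.sum_comm]
    conv_rhs => rw [Finset.sum_comm]
    refine Finset.sum_congr rfl fun j _ => ?_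
    conv_rhs => rw [Finset.sum_comm]
    exact Finset.sum_congr rfl fun i _ => Finset.sum_congr rfl fun s _ => by ring
  rw [h]
  exact Finset.sum_nonneg fun s _ => hκ _

lemma Matrix.PosSemidef.sum_mul_mul_nonneg {P : Matrix m m ℝ} (hP : P.PosSemidef)
    (κ : V →ₗ[ℝ] V →ₗ[ℝ] ℝ) (hκ : ∀ v, 0 ≤ κ v v) (v : m → m → V) :
    0 ≤ ∑ i, ∑ j, ∑ r, ∑ l, P i r * P j l * κ (v i j) (v r l) := by
  classical
  let κ₂ : (m → V) →ₗ[ℝ] (m → V) →ₗ[ℝ] ℝ :=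
    ∑ j, ∑ l, P j l • κ.compl₁₂ (LinearMap.proj j) (LinearMap.proj l)
  have hκ₂ : ∀ x y, κ₂ x y = ∑ j, ∑ l, P j l * κ (x j) (y l) := fun x y => by
    simp [κ₂, LinearMap.sum_apply]
  have h := hP.sum_mul_nonneg κ₂ (fun x => by rw [hκ₂]; exact hP.sum_mul_nonneg κ hκ x) v
  refine h.trans_eq ?_
  refine Finset.sum_congr rfl fun i _ => ?_
  rw [Finset.sum_comm]
  refine Finset.sum_congr rfl fun r _ => ?_
  rw [hκ₂, Finset.mul_sum]
  refine Finset.sum_congr rfl fun j _ => ?_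
  rw [Finset.mul_sum]
  exact Finset.sum_congr rfl fun l _ => by ring

end Positivity

section CurvForm

variable {E : Type*} [NormedAddCommGroup E] [NormedSpace ℝ E] {𝔸 : Type*} [NormedRing 𝔸]
  [NormedAlgebra ℝ 𝔸]

lemma continuousOn_curvForm {η : E → E →L[ℝ] 𝔸} {U : Set E} (hU : IsOpen U)
    (hη : ContDiffOn ℝ ∞ η U) (X Y : E) : ContinuousOn (fun y => curvForm η y X Y) U := by
  simp only [curvForm_apply]
  have h1 : ∀ X, ContinuousOn (fun y => η y X) U := fun X =>
    hη.continuousOn.clm_apply continuousOn_const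
  have h2 : ∀ X Y, ContinuousOn (fun y => fderiv ℝ η y X Y) U := fun X Y =>
    ((hη.continuousOn_fderiv_of_isOpen hU (by simp)).clm_apply continuousOn_const).clm_apply
      continuousOn_const
  exact ((h2 X Y).sub (h2 Y X)).add (((h1 X).mul (h1 Y)).sub ((h1 Y).mul (h1 X)))

end CurvForm

section Gauge

variable {k n : ℕ} {S : Type*} [TopologicalSpace S] [ChartedSpace (EuclideanSpace ℝ (Fin n)) S]
  {ι : Type*}

lemma nhds_chart_triv (Z : VectorBundleCore ℝ S (EuclideanSpace ℝ (Fin k)) ι) (p : S) :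
    (extChartAt (𝓡 n) p).source ∩ Z.baseSet (Z.indexAt p) ∈ 𝓝 p :=
  inter_mem (extChartAt_source_mem_nhds p)
    ((Z.isOpen_baseSet _).mem_nhds (Z.mem_baseSet_at p))

variable {Z : VectorBundleCore ℝ S (EuclideanSpace ℝ (Fin k)) ι}

/-- A section of the adjoint bundle in the trivialization `i` and the chart at `p`. -/
noncomputable def secLoc (Φ : (x : S) → Z.Fiber x) (i : ι) (p : S)
    (y : EuclideanSpace ℝ (Fin n)) : EuclideanSpace ℝ (Fin k) :=
  Z.coordChange (Z.indexAt ((extChartAt (𝓡 n) p).symm y)) i ((extChartAt (𝓡 n) p).symm y)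
    (Φ ((extChartAt (𝓡 n) p).symm y))

lemma secLoc_trans (Φ : (x : S) → Z.Fiber x) {i j : ι} {p q : S}
    {y : EuclideanSpace ℝ (Fin n)} (hy : y ∈ overlap p q) (hi : y ∈ trivDom Z i p)
    (hj : y ∈ trivDom Z j p) :
    secLoc Φ j q (transMap p q y) = chartGauge Z i j p y (secLoc Φ i p y) := by
  rw [secLoc, symm_transMap hy]
  exact (Z.coordChange_comp _ i j _ ⟨⟨Z.mem_baseSet_at _, hi.2⟩, hj.2⟩ _).symm

end Gauge

section Gauge

variable {k : ℕ} {G : Type*} [TopologicalSpace G] [ChartedSpace (EuclideanSpace ℝ (Fin k)) G]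
  [Group G] [LieGroup (𝓡 k) ∞ G] {n : ℕ} {S : Type*} [TopologicalSpace S]
  [ChartedSpace (EuclideanSpace ℝ (Fin n)) S] [IsManifold (𝓡 n) ∞ S]
  {ι : Type*} {Z : VectorBundleCore ℝ S (EuclideanSpace ℝ (Fin k)) ι}

/-- The function `F_{ij}F^{ij}` depends neither on the chart nor on the trivialization. -/
lemma curvSqLoc_trans [Z.IsContMDiff (𝓡 n) ∞] (A : AdConnection G (n := n) Z) (g : RMetric n S)
    {i j : ι} {p q : S} {y : EuclideanSpace ℝ (Fin n)} (hy : y ∈ overlap p q)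
    (hi : y ∈ trivDom Z i p) (hj : y ∈ trivDom Z j p) :
    curvSqLoc A g i p y = curvSqLoc A g j q (transMap p q y) := by
  have hconj : ∀ X Y X' Y', negTrace k (curvForm (adForm A i p) y X Y)
      (curvForm (adForm A i p) y X' Y') =
      negTrace k (curvForm (adForm A j q) (transMap p q y) (fderiv ℝ (transMap p q) y X)
        (fderiv ℝ (transMap p q) y Y)) (curvForm (adForm A j q) (transMap p q y)
        (fderiv ℝ (transMap p q) y X') (fderiv ℝ (transMap p q) y Y')) := fun X Y X' Y' =>
    negTrace_conj (d := chartGauge Z j i p y) (fun v => coordChange_left_inv hi.2 hj.2 v)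
      (curvForm_adForm_gauge A hy hi hj X Y) (curvForm_adForm_gauge A hy hi hj X' Y')
  set J := fderiv ℝ (transMap p q) y with hJ
  set Ω := curvForm (adForm A j q) (transMap p q y) with hΩ
  -- the curvature contracted in one pair of indices
  let β : EuclideanSpace ℝ (Fin n) →ₗ[ℝ] EuclideanSpace ℝ (Fin n) →ₗ[ℝ] ℝ :=
    ∑ a, ∑ r, metricInv g q (transMap p q y) a r •
      (negTrace k).compl₁₂ (Ω (stdE a)) (Ω (stdE r))
  have hβ : ∀ X Y, β X Y = ∑ a, ∑ r, metricInv g q (transMap p q y) a r •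
      (negTrace k) (Ω (stdE a) X) (Ω (stdE r) Y) := fun X Y => by
    simp [β, LinearMap.sum_apply]
  calc curvSqLoc A g i p y = ∑ b, ∑ l, metricInv g p y b l • β (J (stdE b)) (J (stdE l)) := by
        rw [curvSqLoc_eq_contract]
        refine Finset.sum_congr rfl fun b _ => Finset.sum_congr rfl fun l _ => ?_
        congr 1
        have h := metricInv_contract g hy ((negTrace k).compl₁₂ (Ω.flip (J (stdE b)))
          (Ω.flip (J (stdE l))))
        rw [hβ]
        simp only [LinearMap.compl₁₂_apply, LinearMap.flip_apply] at h ⊢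
        rw [← h]
        simp only [hconj]
        rfl
    _ = ∑ b, ∑ l, metricInv g q (transMap p q y) b l • β (stdE b) (stdE l) :=
        metricInv_contract g hy β
    _ = curvSqLoc A g j q (transMap p q y) := by
        rw [curvSqLoc_eq_contract]
        simp only [hβ, LinearMap.compl₁₂_apply, LinearMap.flip_apply]
        rfl

/-- The adjoint representation maps the curvature of `A` to the curvature of its adjoint action, by the
Jacobi identity. -/
lemma adMap_curv (A : AdConnection G (n := n) Z) (p : S) (a b : Fin n) :
    adMap k G (A.curv p a b) =
      curvForm (adForm A (Z.indexAt p) p) (extChartAt (𝓡 n) p p) (stdE a) (stdE b) := by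
  have hd := differentiableAt_connForm A
    (chart_mem_trivDom (Z := Z) (mem_extChartAt_source (I := 𝓡 n) p) (Z.mem_baseSet_at p))
  have h1 : ∀ a b, pd a (A.coeff p b) (extChartAt (𝓡 n) p p) =
      fderiv ℝ (connForm A (Z.indexAt p) p) (extChartAt (𝓡 n) p p) (stdE a) (stdE b) :=
    fun a b => by
      have h2 : A.coeff p b = fun y => connForm A (Z.indexAt p) p y (stdE b) := rfl
      rw [h2, pd, fderiv_clm_apply hd (differentiableAt_const _)]
      simp [stdE]
  have h3 : ∀ X Y, fderiv ℝ (adForm A (Z.indexAt p) p) (extChartAt (𝓡 n) p p) X Y =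
      adMap k G (fderiv ℝ (connForm A (Z.indexAt p) p) (extChartAt (𝓡 n) p p) X Y) := fun X Y => by
    have h4 : HasFDerivAt (adForm A (Z.indexAt p) p) _ _ :=
      (hasFDerivAt_const (adMap k G) _).clm_comp hd.hasFDerivAt
    rw [h4.fderiv]
    simp
  rw [curvForm_apply, h3, h3, AdConnection.curv, map_add, map_sub, h1, h1, adMap_lieBr]
  rfl

lemma curvSq_eq_curvSqLoc (A : AdConnection G (n := n) Z) (g : RMetric n S) (p : S) :
    A.curvSq g p = curvSqLoc A g (Z.indexAt p) p (extChartAt (𝓡 n) p p) := by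
  simp only [AdConnection.curvSq, curvSqLoc, ← adMap_curv, cartanKilling_eq, negTrace,
    LinearMap.mk₂_apply]

lemma continuous_negTrace (k : ℕ) : Continuous fun z : (EuclideanSpace ℝ (Fin k) →L[ℝ] EuclideanSpace ℝ (Fin k)) ×
    (EuclideanSpace ℝ (Fin k) →L[ℝ] EuclideanSpace ℝ (Fin k)) => negTrace k z.1 z.2 := by
  have h : ∀ z : (EuclideanSpace ℝ (Fin k) →L[ℝ] EuclideanSpace ℝ (Fin k)) ×
      (EuclideanSpace ℝ (Fin k) →L[ℝ] EuclideanSpace ℝ (Fin k)), negTrace k z.1 z.2 =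
      -∑ a, (z.1 (z.2 (stdE a))) a := fun z => by
    simp only [negTrace, LinearMap.mk₂_apply, trace_eq_sum_stdE]
    rfl
  simp only [h]
  fun_prop

lemma continuousOn_curvSqLoc (A : AdConnection G (n := n) Z) (g : RMetric n S) (i : ι) (p : S) :
    ContinuousOn (curvSqLoc A g i p) (trivDom (n := n) Z i p) := by
  have hΩ := fun X Y => continuousOn_curvForm (isOpen_trivDom i p) (contDiffOn_adForm A i p) X Y
  refine continuousOn_finsetSum _ fun a _ => continuousOn_finsetSum _ fun b _ =>
    continuousOn_finsetSum _ fun r _ => continuousOn_finsetSum _ fun l _ => ?_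
  have hg : ∀ a b, ContinuousOn (fun y => metricInv g p y a b) (trivDom (n := n) Z i p) := fun a b =>
    (contDiffOn_metricInv g p a b).continuousOn.mono Set.inter_subset_left
  have h : ContinuousOn (fun y => negTrace k (curvForm (adForm A i p) y (stdE a) (stdE b))
      (curvForm (adForm A i p) y (stdE r) (stdE l))) (trivDom (n := n) Z i p) :=
    (continuous_negTrace k).comp_continuousOn (f := fun y => (curvForm (adForm A i p) y (stdE a)
      (stdE b), curvForm (adForm A i p) y (stdE r) (stdE l))) ((hΩ _ _).prodMk (hΩ _ _))
  exact ((hg a r).mul (hg b l)).mul h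

lemma continuous_curvSq [Z.IsContMDiff (𝓡 n) ∞] (A : AdConnection G (n := n) Z)
    (g : RMetric n S) : Continuous (A.curvSq g) := by
  refine continuous_of_chart (n := n) fun p => ⟨curvSqLoc A g (Z.indexAt p) p, _, nhds_chart_triv (n := n) Z p,
    ?_, fun x hx => ?_⟩
  · exact (continuousOn_curvSqLoc A g _ p).continuousAt ((isOpen_trivDom _ p).mem_nhds
      (chart_mem_trivDom (mem_extChartAt_source (I := 𝓡 n) p) (Z.mem_baseSet_at p)))
  · rw [curvSq_eq_curvSqLoc, curvSqLoc_trans A g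
      (chart_mem_overlap (mem_extChartAt_source (I := 𝓡 n) x) hx.1)
      (chart_mem_trivDom (mem_extChartAt_source (I := 𝓡 n) x) (Z.mem_baseSet_at x))
      (chart_mem_trivDom (mem_extChartAt_source (I := 𝓡 n) x) hx.2),
      transMap_chart (mem_extChartAt_source (I := 𝓡 n) x)]

lemma curvSq_nonneg [CompactSpace G] (A : AdConnection G (n := n) Z) (g : RMetric n S) (p : S) :
    0 ≤ A.curvSq g p := by
  have h := (metricInv_posDef g (mem_extChartAt_target (I := 𝓡 n) p)).posSemidef
  exact h.sum_mul_mul_nonneg (killBilin k G) cartanKilling_nonneg (A.curv p)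

lemma higgsSq_nonneg [CompactSpace G] (A : AdConnection G (n := n) Z) (g : RMetric n S)
    (Φ : (x : S) → Z.Fiber x) (p : S) : 0 ≤ A.higgsSq g Φ p := by
  have h := (metricInv_posDef g (mem_extChartAt_target (I := 𝓡 n) p)).posSemidef
  exact h.sum_mul_nonneg (killBilin k G) cartanKilling_nonneg (A.covDeriv Φ p)

lemma contDiffOn_secLoc [Z.IsContMDiff (𝓡 n) ∞] {Φ : (x : S) → Z.Fiber x}
    (hΦ : ContMDiff (𝓡 n) ((𝓡 n).prod 𝓘(ℝ, EuclideanSpace ℝ (Fin k))) ∞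
      (fun x => TotalSpace.mk' (EuclideanSpace ℝ (Fin k)) x (Φ x))) (i : ι) (p : S) :
    ContDiffOn ℝ ∞ (secLoc (n := n) Φ i p) (trivDom (n := n) Z i p) := by
  have : MemTrivializationAtlas (Z.localTriv i) := ⟨⟨i, rfl⟩⟩
  have h := ((Z.localTriv i).contMDiffOn_section_baseSet_iff (IB := 𝓡 n) (n := ∞) (s := Φ)).1
    hΦ.contMDiffOn
  exact (h.comp ((contMDiffOn_extChartAt_symm (I := 𝓡 n) (n := ∞) p).mono
      (fun _ hy => hy.1)) (fun _ hy => hy.2)).contDiffOn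

lemma differentiableAt_secLoc [Z.IsContMDiff (𝓡 n) ∞] {Φ : (x : S) → Z.Fiber x}
    (hΦ : ContMDiff (𝓡 n) ((𝓡 n).prod 𝓘(ℝ, EuclideanSpace ℝ (Fin k))) ∞
      (fun x => TotalSpace.mk' (EuclideanSpace ℝ (Fin k)) x (Φ x))) {i : ι} {p : S}
    {y : EuclideanSpace ℝ (Fin n)} (hy : y ∈ trivDom Z i p) :
    DifferentiableAt ℝ (secLoc (n := n) Φ i p) y :=
  ((contDiffOn_secLoc hΦ i p).contDiffAt ((isOpen_trivDom i p).mem_nhds hy)).differentiableAt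
    (by simp)

/-- The covariant derivative of a section in the trivialization `i` and the chart at `p`. -/
noncomputable def covLoc (A : AdConnection G (n := n) Z) (Φ : (x : S) → Z.Fiber x) (i : ι) (p : S)
    (y : EuclideanSpace ℝ (Fin n)) : EuclideanSpace ℝ (Fin n) →ₗ[ℝ] EuclideanSpace ℝ (Fin k) :=
  (fderiv ℝ (secLoc (n := n) Φ i p) y + (adForm A i p y).flip (secLoc Φ i p y)).toLinearMap

lemma covLoc_apply (A : AdConnection G (n := n) Z) (Φ : (x : S) → Z.Fiber x) (i : ι) (p : S)
    (y X : EuclideanSpace ℝ (Fin n)) : covLoc A Φ i p y X =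
      fderiv ℝ (secLoc (n := n) Φ i p) y X + adForm A i p y X (secLoc Φ i p y) := rfl

/-- The covariant derivative of a section transforms tensorially. -/
lemma covLoc_trans [Z.IsContMDiff (𝓡 n) ∞] (A : AdConnection G (n := n) Z)
    {Φ : (x : S) → Z.Fiber x}
    (hΦ : ContMDiff (𝓡 n) ((𝓡 n).prod 𝓘(ℝ, EuclideanSpace ℝ (Fin k))) ∞
      (fun x => TotalSpace.mk' (EuclideanSpace ℝ (Fin k)) x (Φ x))) {i j : ι} {p q : S}
    {y : EuclideanSpace ℝ (Fin n)} (hy : y ∈ overlap p q) (hi : y ∈ trivDom Z i p)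
    (hj : y ∈ trivDom Z j p) (X : EuclideanSpace ℝ (Fin n)) :
    covLoc A Φ j q (transMap p q y) (fderiv ℝ (transMap p q) y X) =
      chartGauge Z i j p y (covLoc A Φ i p y X) := by
  have hj' : transMap p q y ∈ trivDom Z j q := ⟨transMap_mem_target hy, by
    rw [Set.mem_preimage, symm_transMap hy]; exact hj.2⟩
  have h1 : (fun z => secLoc Φ j q (transMap p q z)) =ᶠ[𝓝 y]
      fun z => chartGauge Z i j p z (secLoc Φ i p z) := by
    filter_upwards [(isOpen_overlap p q).mem_nhds hy, (isOpen_trivDom i p).mem_nhds hi,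
      (isOpen_trivDom j p).mem_nhds hj] with z hz hiz hjz
    exact secLoc_trans Φ hz hiz hjz
  have h2 := ((differentiableAt_secLoc hΦ hj').hasFDerivAt.comp y
    (differentiableAt_transMap hy).hasFDerivAt)
  have h3 := ((contDiffAt_chartGauge hi hj).differentiableAt (by simp)).hasFDerivAt.clm_apply
    (differentiableAt_secLoc hΦ hi).hasFDerivAt
  have h4 := DFunLike.congr_fun (h2.unique (h3.congr_of_eventuallyEq h1)) X
  simp only [ContinuousLinearMap.comp_apply, add_apply, ContinuousLinearMap.flip_apply] at h4
  have h5 := DFunLike.congr_fun (adForm_gauge A hy hi hj X) (secLoc Φ i p y)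
  simp only [mul_apply_eq_comp, add_apply] at h5
  rw [covLoc_apply, covLoc_apply, h4, map_add, h5, secLoc_trans Φ hy hi hj]
  abel

/-- The function `γ_{ab} g^{ij} Φ^a_i Φ^b_j` in the trivialization `i` and the chart at `p`. -/
noncomputable def higgsSqLoc (A : AdConnection G (n := n) Z) (g : RMetric n S)
    (Φ : (x : S) → Z.Fiber x) (i : ι) (p : S) (y : EuclideanSpace ℝ (Fin n)) : ℝ :=
  ∑ a, ∑ b, metricInv g p y a b •
    (killBilin k G).compl₁₂ (covLoc A Φ i p y) (covLoc A Φ i p y) (stdE a) (stdE b)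

/-- The function `γ_{ab} g^{ij} Φ^a_i Φ^b_j` depends neither on the chart nor on the trivialization, as
the transition functions preserve the Cartan–Killing metric. -/
lemma higgsSqLoc_trans [Z.IsContMDiff (𝓡 n) ∞] (hZ : HasAdStructureGroup G Z)
    (A : AdConnection G (n := n) Z) (g : RMetric n S) {Φ : (x : S) → Z.Fiber x}
    (hΦ : ContMDiff (𝓡 n) ((𝓡 n).prod 𝓘(ℝ, EuclideanSpace ℝ (Fin k))) ∞
      (fun x => TotalSpace.mk' (EuclideanSpace ℝ (Fin k)) x (Φ x))) {i j : ι} {p q : S}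
    {y : EuclideanSpace ℝ (Fin n)} (hy : y ∈ overlap p q) (hi : y ∈ trivDom Z i p)
    (hj : y ∈ trivDom Z j p) :
    higgsSqLoc A g Φ i p y = higgsSqLoc A g Φ j q (transMap p q y) := by
  obtain ⟨h, hh⟩ := hZ i j _ ⟨hi.2, hj.2⟩
  rw [higgsSqLoc, higgsSqLoc, ← metricInv_contract g hy]
  refine Finset.sum_congr rfl fun a _ => Finset.sum_congr rfl fun b _ => ?_
  simp only [LinearMap.compl₁₂_apply, covLoc_trans A hΦ hy hi hj, killBilin_apply, chartGauge, hh,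
    cartanKilling_Ad]

lemma higgsSq_eq_higgsSqLoc (A : AdConnection G (n := n) Z) (g : RMetric n S)
    (Φ : (x : S) → Z.Fiber x) (p : S) :
    A.higgsSq g Φ p = higgsSqLoc A g Φ (Z.indexAt p) p (extChartAt (𝓡 n) p p) := by
  have h : ∀ a, A.covDeriv Φ p a = covLoc A Φ (Z.indexAt p) p (extChartAt (𝓡 n) p p) (stdE a) :=
    fun a => by
      have h1 : secLoc Φ (Z.indexAt p) p (extChartAt (𝓡 n) p p) = Φ p := by
        rw [secLoc, extChartAt_to_inv p]
        exact Z.coordChange_self _ _ (Z.mem_baseSet_at p) _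
      rw [covLoc_apply, h1]
      exact congrArg _ (adMap_apply _ _).symm
  simp only [AdConnection.higgsSq, higgsSqLoc, h, LinearMap.compl₁₂_apply, killBilin_apply,
    smul_eq_mul]

lemma continuousOn_higgsSqLoc [Z.IsContMDiff (𝓡 n) ∞] (A : AdConnection G (n := n) Z)
    (g : RMetric n S) {Φ : (x : S) → Z.Fiber x}
    (hΦ : ContMDiff (𝓡 n) ((𝓡 n).prod 𝓘(ℝ, EuclideanSpace ℝ (Fin k))) ∞
      (fun x => TotalSpace.mk' (EuclideanSpace ℝ (Fin k)) x (Φ x))) (i : ι) (p : S) :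
    ContinuousOn (higgsSqLoc A g Φ i p) (trivDom (n := n) Z i p) := by
  have hs := contDiffOn_secLoc hΦ i p
  have hs' : ContinuousOn (fderiv ℝ (secLoc (n := n) Φ i p)) (trivDom (n := n) Z i p) :=
    hs.continuousOn_fderiv_of_isOpen (isOpen_trivDom i p) (by simp)
  have hc : ∀ X, ContinuousOn (fun y => covLoc A Φ i p y X) (trivDom (n := n) Z i p) := fun X => by
    simp only [covLoc_apply]
    exact (hs'.clm_apply continuousOn_const).add
      (((contDiffOn_adForm A i p).continuousOn.clm_apply continuousOn_const).clm_apply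
        hs.continuousOn)
  refine continuousOn_finsetSum _ fun a _ => continuousOn_finsetSum _ fun b _ =>
    ((contDiffOn_metricInv g p a b).continuousOn.mono Set.inter_subset_left).smul ?_
  exact (continuous_cartanKilling (G := G)).comp_continuousOn
    (f := fun y => (covLoc A Φ i p y (stdE a), covLoc A Φ i p y (stdE b)))
    ((hc (stdE a)).prodMk (hc (stdE b)))

lemma continuous_higgsSq [Z.IsContMDiff (𝓡 n) ∞] (hZ : HasAdStructureGroup G Z)
    (A : AdConnection G (n := n) Z) (g : RMetric n S) {Φ : (x : S) → Z.Fiber x}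
    (hΦ : ContMDiff (𝓡 n) ((𝓡 n).prod 𝓘(ℝ, EuclideanSpace ℝ (Fin k))) ∞
      (fun x => TotalSpace.mk' (EuclideanSpace ℝ (Fin k)) x (Φ x))) :
    Continuous (A.higgsSq g Φ) := by
  refine continuous_of_chart (n := n) fun p => ⟨higgsSqLoc A g Φ (Z.indexAt p) p, _, nhds_chart_triv (n := n) Z p,
    ?_, fun x hx => ?_⟩
  · exact (continuousOn_higgsSqLoc A g hΦ _ p).continuousAt ((isOpen_trivDom _ p).mem_nhds
      (chart_mem_trivDom (mem_extChartAt_source (I := 𝓡 n) p) (Z.mem_baseSet_at p)))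
  · rw [higgsSq_eq_higgsSqLoc, higgsSqLoc_trans hZ A g hΦ
      (chart_mem_overlap (mem_extChartAt_source (I := 𝓡 n) x) hx.1)
      (chart_mem_trivDom (mem_extChartAt_source (I := 𝓡 n) x) (Z.mem_baseSet_at x))
      (chart_mem_trivDom (mem_extChartAt_source (I := 𝓡 n) x) hx.2),
      transMap_chart (mem_extChartAt_source (I := 𝓡 n) x)]

end Gauge

/-! ### The pairing of differentials -/

section Gradient

variable {n : ℕ} {S : Type*} [TopologicalSpace S] [ChartedSpace (EuclideanSpace ℝ (Fin n)) S]

/-- The differential of a complex-valued function, read in the chart at `p`. -/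
noncomputable def diffLoc (u : S → ℂ) (p : S) (y : EuclideanSpace ℝ (Fin n)) :
    EuclideanSpace ℝ (Fin n) →L[ℝ] ℂ :=
  fderiv ℝ (fun z => u ((extChartAt (𝓡 n) p).symm z)) y

variable [IsManifold (𝓡 n) ∞ S]

lemma contDiffOn_comp_symm {u : S → ℂ} (hu : ContMDiff (𝓡 n) 𝓘(ℝ, ℂ) ∞ u) (p : S) :
    ContDiffOn ℝ ∞ (fun z => u ((extChartAt (𝓡 n) p).symm z)) (extChartAt (𝓡 n) p).target :=
  (hu.comp_contMDiffOn (contMDiffOn_extChartAt_symm (I := 𝓡 n) (n := ∞) p)).contDiffOn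

lemma differentiableAt_comp_symm {u : S → ℂ} (hu : ContMDiff (𝓡 n) 𝓘(ℝ, ℂ) ∞ u) {p : S}
    {y : EuclideanSpace ℝ (Fin n)} (hy : y ∈ (extChartAt (𝓡 n) p).target) :
    DifferentiableAt ℝ (fun z => u ((extChartAt (𝓡 n) p).symm z)) y :=
  ((contDiffOn_comp_symm hu p).contDiffAt ((isOpen_target p).mem_nhds hy)).differentiableAt
    (by simp)

lemma contDiffOn_diffLoc {u : S → ℂ} (hu : ContMDiff (𝓡 n) 𝓘(ℝ, ℂ) ∞ u) (p : S) :
    ContDiffOn ℝ ∞ (diffLoc (n := n) u p) (extChartAt (𝓡 n) p).target :=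
  (contDiffOn_comp_symm hu p).fderiv_of_isOpen (isOpen_target p) (by simp)

lemma diffLoc_trans {u : S → ℂ} (hu : ContMDiff (𝓡 n) 𝓘(ℝ, ℂ) ∞ u) {p q : S}
    {y : EuclideanSpace ℝ (Fin n)} (hy : y ∈ overlap p q) (X : EuclideanSpace ℝ (Fin n)) :
    diffLoc u p y X = diffLoc u q (transMap p q y) (fderiv ℝ (transMap p q) y X) := by
  have h1 : (fun z => u ((extChartAt (𝓡 n) p).symm z)) =ᶠ[𝓝 y]
      (fun z => u ((extChartAt (𝓡 n) q).symm z)) ∘ transMap p q := by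
    filter_upwards [(isOpen_overlap p q).mem_nhds hy] with z hz
    rw [Function.comp_apply, symm_transMap hz]
  rw [diffLoc, h1.fderiv_eq, fderiv_comp y (differentiableAt_comp_symm hu (transMap_mem_target hy))
    (differentiableAt_transMap hy)]
  rfl

lemma diffLoc_add {u v : S → ℂ} (hu : ContMDiff (𝓡 n) 𝓘(ℝ, ℂ) ∞ u)
    (hv : ContMDiff (𝓡 n) 𝓘(ℝ, ℂ) ∞ v) {p : S} {y : EuclideanSpace ℝ (Fin n)}
    (hy : y ∈ (extChartAt (𝓡 n) p).target) :
    diffLoc (fun x => u x + v x) p y = diffLoc u p y + diffLoc v p y :=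
  fderiv_fun_add (differentiableAt_comp_symm hu hy) (differentiableAt_comp_symm hv hy)

lemma diffLoc_const_mul {u : S → ℂ} (hu : ContMDiff (𝓡 n) 𝓘(ℝ, ℂ) ∞ u) (c : ℂ) {p : S}
    {y : EuclideanSpace ℝ (Fin n)} (hy : y ∈ (extChartAt (𝓡 n) p).target) :
    diffLoc (fun x => c * u x) p y = c • diffLoc u p y :=
  fderiv_const_mul (differentiableAt_comp_symm hu hy) c

/-- The pairing `g^{ij} conj(∂ᵢu) ∂ⱼv` of the differentials of two functions, in the chart
at `p`. -/
noncomputable def gradLoc (g : RMetric n S) (u v : S → ℂ) (p : S)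
    (y : EuclideanSpace ℝ (Fin n)) : ℂ :=
  ∑ i, ∑ j, metricInv g p y i j • (conj (diffLoc u p y (stdE i)) * diffLoc v p y (stdE j))

/-- The pairing `⟨du, dv⟩` of the differentials of two complex-valued functions, antilinear in the
first argument. -/
noncomputable def gradPair (g : RMetric n S) (u v : S → ℂ) (x : S) : ℂ :=
  gradLoc g u v x (extChartAt (𝓡 n) x x)

lemma gradLoc_trans (g : RMetric n S) {u v : S → ℂ} (hu : ContMDiff (𝓡 n) 𝓘(ℝ, ℂ) ∞ u)
    (hv : ContMDiff (𝓡 n) 𝓘(ℝ, ℂ) ∞ v) {p q : S} {y : EuclideanSpace ℝ (Fin n)}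
    (hy : y ∈ overlap p q) : gradLoc g u v p y = gradLoc g u v q (transMap p q y) := by
  have h := metricInv_contract g hy (LinearMap.mk₂ ℝ (fun X Y =>
    conj (diffLoc u q (transMap p q y) X) * diffLoc v q (transMap p q y) Y)
    (fun X X' Y => by simp [add_mul]) (fun r X Y => by simp [mul_assoc])
    (fun X Y Y' => by simp [mul_add]) (fun r X Y => by simp; ring))
  simp only [LinearMap.mk₂_apply, ← diffLoc_trans hu hy, ← diffLoc_trans hv hy] at h
  exact h

lemma gradPair_eq (g : RMetric n S) {u v : S → ℂ} (hu : ContMDiff (𝓡 n) 𝓘(ℝ, ℂ) ∞ u)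
    (hv : ContMDiff (𝓡 n) 𝓘(ℝ, ℂ) ∞ v) {p x : S} (hx : x ∈ (extChartAt (𝓡 n) p).source) :
    gradPair g u v x = gradLoc g u v p (extChartAt (𝓡 n) p x) := by
  rw [gradPair, gradLoc_trans g hu hv
    (chart_mem_overlap (mem_extChartAt_source (I := 𝓡 n) x) hx),
    transMap_chart (mem_extChartAt_source (I := 𝓡 n) x)]

lemma contDiffOn_gradLoc (g : RMetric n S) {u v : S → ℂ} (hu : ContMDiff (𝓡 n) 𝓘(ℝ, ℂ) ∞ u)
    (hv : ContMDiff (𝓡 n) 𝓘(ℝ, ℂ) ∞ v) (p : S) :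
    ContDiffOn ℝ ∞ (gradLoc g u v p) (extChartAt (𝓡 n) p).target := by
  refine ContDiffOn.sum fun i _ => ContDiffOn.sum fun j _ => (contDiffOn_metricInv g p i j).smul ?_
  exact (Complex.conjCLE.contDiff.comp_contDiffOn
    ((contDiffOn_diffLoc hu p).clm_apply contDiffOn_const)).mul
    ((contDiffOn_diffLoc hv p).clm_apply contDiffOn_const)

lemma continuous_gradPair (g : RMetric n S) {u v : S → ℂ} (hu : ContMDiff (𝓡 n) 𝓘(ℝ, ℂ) ∞ u)
    (hv : ContMDiff (𝓡 n) 𝓘(ℝ, ℂ) ∞ v) : Continuous (gradPair g u v) :=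
  continuous_of_chart (n := n) fun p => ⟨gradLoc g u v p, _, extChartAt_source_mem_nhds p,
    (contDiffOn_gradLoc g hu hv p).continuousOn.continuousAt
      (extChartAt_target_mem_nhds p), fun _ hx => gradPair_eq g hu hv hx⟩

lemma gradPair_add_right (g : RMetric n S) (u : S → ℂ) {v w : S → ℂ}
    (hv : ContMDiff (𝓡 n) 𝓘(ℝ, ℂ) ∞ v) (hw : ContMDiff (𝓡 n) 𝓘(ℝ, ℂ) ∞ w) (x : S) :
    gradPair g u (fun y => v y + w y) x = gradPair g u v x + gradPair g u w x := by
  simp only [gradPair, gradLoc, diffLoc_add hv hw (mem_extChartAt_target x), add_apply, mul_add,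
    smul_add, Finset.sum_add_distrib]

lemma gradPair_const_mul_right (g : RMetric n S) (u : S → ℂ) {v : S → ℂ}
    (hv : ContMDiff (𝓡 n) 𝓘(ℝ, ℂ) ∞ v) (c : ℂ) (x : S) :
    gradPair g u (fun y => c * v y) x = c * gradPair g u v x := by
  simp only [gradPair, gradLoc, diffLoc_const_mul hv c (mem_extChartAt_target x), smul_apply,
    Finset.mul_sum, smul_eq_mul, Complex.real_smul]
  exact Finset.sum_congr rfl fun i _ => Finset.sum_congr rfl fun j _ => by ring

lemma gradPair_conj_symm (g : RMetric n S) (u v : S → ℂ) (x : S) :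
    conj (gradPair g u v x) = gradPair g v u x := by
  simp only [gradPair, gradLoc, map_sum, Complex.real_smul, map_mul, Complex.conj_conj,
    Complex.conj_ofReal]
  rw [Finset.sum_comm]
  refine Finset.sum_congr rfl fun i _ => Finset.sum_congr rfl fun j _ => ?_
  rw [metricInv_symm g (mem_extChartAt_target x) i j]
  ring

lemma gradNormSq_eq_re (g : RMetric n S) (u : S → ℂ) (x : S) :
    gradNormSq g u x = (gradPair g u u x).re := by
  simp only [gradPair, gradLoc, Complex.re_sum, Complex.real_smul, Complex.re_ofReal_mul]
  rfl

lemma gradPair_self (g : RMetric n S) (u : S → ℂ) (x : S) :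
    gradPair g u u x = gradNormSq g u x := by
  rw [gradNormSq_eq_re]
  exact (Complex.conj_eq_iff_re.1 (gradPair_conj_symm g u u x)).symm

lemma gradNormSq_nonneg (g : RMetric n S) (u : S → ℂ) (x : S) : 0 ≤ gradNormSq g u x := by
  have h := (metricInv_posDef g (mem_extChartAt_target (I := 𝓡 n) x)).posSemidef
  refine (h.sum_mul_nonneg (innerₗ ℂ) (fun v => by
    rw [innerₗ_apply_apply]; exact real_inner_self_nonneg)
    (fun i => diffLoc u x (extChartAt (𝓡 n) x x) (stdE i))).trans_eq ?_
  refine Finset.sum_congr rfl fun i _ => Finset.sum_congr rfl fun j _ => ?_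
  rw [innerₗ_apply_apply, Complex.inner, mul_comm (diffLoc _ _ _ _)]
  rfl

lemma continuous_gradNormSq (g : RMetric n S) {u : S → ℂ} (hu : ContMDiff (𝓡 n) 𝓘(ℝ, ℂ) ∞ u) :
    Continuous (gradNormSq g u) := by
  have h : gradNormSq g u = fun x => (gradPair g u u x).re := funext fun x => gradNormSq_eq_re g u x
  rw [h]
  exact Complex.continuous_re.comp (continuous_gradPair g hu hu)

lemma gradPair_eq_zero (g : RMetric n S) (u : S → ℂ) {ψ : S → ℂ} {x : S} (hx : x ∉ tsupport ψ) :
    gradPair g u ψ x = 0 := by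
  have h1 : (fun z => ψ ((extChartAt (𝓡 n) x).symm z)) =ᶠ[𝓝 (extChartAt (𝓡 n) x x)]
      fun _ => 0 := by
    have h2 := notMem_tsupport_iff_eventuallyEq.1 hx
    have h3 := (continuousAt_extChartAt_symm (I := 𝓡 n) x).tendsto
    rw [extChartAt_to_inv] at h3
    exact h3.eventually h2
  have h4 : diffLoc ψ x (extChartAt (𝓡 n) x x) = 0 := by
    rw [diffLoc, h1.fderiv_eq, fderiv_fun_const]
    rfl
  simp only [gradPair, gradLoc, h4, zero_apply, mul_zero, smul_zero, Finset.sum_const_zero]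

end Gradient

/-! ### The Riemannian volume -/

section Volume

variable {n : ℕ} {S : Type*} [TopologicalSpace S] [ChartedSpace (EuclideanSpace ℝ (Fin n)) S]
  [IsManifold (𝓡 n) ∞ S]

lemma aemeasurable_density (g : RMetric n S) (p : S) :
    AEMeasurable (fun y => ENNReal.ofReal (metricDensity g p y))
      (volume.restrict (extChartAt (𝓡 n) p).target) :=
  ((contDiffOn_metricDensity g p).continuousOn.aemeasurable
    (isOpen_target p).measurableSet).ennreal_ofReal

variable [MeasurableSpace S]

lemma chartVolume_le (g : RMetric n S) (p : S) : chartVolume g p ≤ riemannianVolume g :=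
  le_iSup (chartVolume g) p

variable [BorelSpace S]

lemma aemeasurable_symm (g : RMetric n S) (p : S) :
    AEMeasurable (extChartAt (𝓡 n) p).symm ((volume.restrict (extChartAt (𝓡 n) p).target).withDensity
      (fun y => ENNReal.ofReal (metricDensity g p y))) :=
  ((continuousOn_extChartAt_symm p).aemeasurable (isOpen_target p).measurableSet).mono_ac
    (withDensity_absolutelyContinuous _ _)

lemma chartVolume_apply (g : RMetric n S) (p : S) {B : Set S} (hB : MeasurableSet B) :
    chartVolume g p B = ∫⁻ y in (extChartAt (𝓡 n) p).target ∩ (extChartAt (𝓡 n) p).symm ⁻¹' B,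
      ENNReal.ofReal (metricDensity g p y) := by
  rw [chartVolume, Measure.map_apply_of_aemeasurable (aemeasurable_symm g p) hB,
    withDensity_apply', Measure.restrict_restrict' (isOpen_target p).measurableSet, Set.inter_comm]

lemma lintegral_chartVolume (g : RMetric n S) (p : S) {f : S → ENNReal}
    (hf : AEMeasurable f (chartVolume g p)) : ∫⁻ x, f x ∂(chartVolume g p) =
      ∫⁻ y in (extChartAt (𝓡 n) p).target,
        ENNReal.ofReal (metricDensity g p y) * f ((extChartAt (𝓡 n) p).symm y) := by
  rw [chartVolume, lintegral_map' hf (aemeasurable_symm g p),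
    lintegral_withDensity_eq_lintegral_mul₀' (aemeasurable_density g p)
      (g := fun y => f ((extChartAt (𝓡 n) p).symm y)) (hf.comp_aemeasurable (aemeasurable_symm g p))]
  rfl

lemma integral_chartVolume (g : RMetric n S) (p : S) {f : S → ℂ}
    (hf : AEStronglyMeasurable f (chartVolume g p)) : ∫ x, f x ∂(chartVolume g p) =
      ∫ y in (extChartAt (𝓡 n) p).target,
        metricDensity g p y • f ((extChartAt (𝓡 n) p).symm y) := by
  rw [chartVolume, integral_map (aemeasurable_symm g p) hf,
    integral_withDensity_eq_integral_toReal_smul₀ (aemeasurable_density g p)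
      (Eventually.of_forall fun _ => ENNReal.ofReal_lt_top)]
  refine setIntegral_congr_fun (isOpen_target p).measurableSet fun y hy => ?_
  simp only [ENNReal.toReal_ofReal (metricDensity_pos g hy).le]

lemma chartVolume_inter_source (g : RMetric n S) (p : S) {B : Set S} (hB : MeasurableSet B) :
    chartVolume g p (B ∩ (extChartAt (𝓡 n) p).source) = chartVolume g p B := by
  rw [chartVolume_apply g p hB,
    chartVolume_apply g p (hB.inter (isOpen_extChartAt_source p).measurableSet)]
  congr 2
  ext y
  simp only [Set.mem_inter_iff, Set.mem_preimage]
  exact ⟨fun h => ⟨h.1, h.2.1⟩, fun h => ⟨h.1, h.2, (extChartAt (𝓡 n) p).map_target h.1⟩⟩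

/-- The volume measures of two charts agree where both are defined. -/
lemma chartVolume_congr (g : RMetric n S) {p q : S} {B : Set S} (hB : MeasurableSet B)
    (hp : B ⊆ (extChartAt (𝓡 n) p).source) (hq : B ⊆ (extChartAt (𝓡 n) q).source) :
    chartVolume g p B = chartVolume g q B := by
  have hms : MeasurableSet ((extChartAt (𝓡 n) p).target ∩ (extChartAt (𝓡 n) p).symm ⁻¹' B) := by
    have h := (isOpen_target p).measurableSet.subtype_image
      ((continuousOn_extChartAt_symm (I := 𝓡 n) p).domRestrict.measurable hB)
    rwa [Set.domRestrict_eq, Set.preimage_comp, Subtype.image_preimage_coe] at h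
  have hov : ∀ y ∈ (extChartAt (𝓡 n) p).target ∩ (extChartAt (𝓡 n) p).symm ⁻¹' B,
      y ∈ overlap p q := fun y hy => ⟨hy.1, hq hy.2⟩
  have himg : (extChartAt (𝓡 n) q).target ∩ (extChartAt (𝓡 n) q).symm ⁻¹' B =
      transMap p q '' ((extChartAt (𝓡 n) p).target ∩ (extChartAt (𝓡 n) p).symm ⁻¹' B) := by
    ext z
    constructor
    · intro hz
      have hz' : z ∈ overlap q p := ⟨hz.1, hp hz.2⟩
      refine ⟨transMap q p z, ⟨transMap_mem_target hz', ?_⟩, transMap_transMap hz'⟩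
      rw [Set.mem_preimage, symm_transMap hz']
      exact hz.2
    · rintro ⟨y, hy, rfl⟩
      refine ⟨transMap_mem_target (hov y hy), ?_⟩
      rw [Set.mem_preimage, symm_transMap (hov y hy)]
      exact hy.2
  -- the change of variables formula
  rw [chartVolume_apply g p hB, chartVolume_apply g q hB, himg,
    lintegral_image_eq_lintegral_abs_det_fderiv_mul volume hms
      (fun y hy => (differentiableAt_transMap (hov y hy)).hasFDerivAt.hasFDerivWithinAt)
      (fun y hy z hz h => by
        rw [← transMap_transMap (hov y hy), h, transMap_transMap (hov z hz)])]
  refine setLIntegral_congr_fun hms fun y hy => ?_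
  simp only [metricDensity_trans g (hov y hy), ENNReal.ofReal_mul (abs_nonneg _)]

/-- On the domain of the chart at `p`, the Riemannian volume is the volume measure of this chart:
gluing the measures of finitely many charts gives a measure which dominates all of them. -/
lemma riemannianVolume_apply [CompactSpace S] (g : RMetric n S) {p : S} {B : Set S}
    (hB : MeasurableSet B) (hp : B ⊆ (extChartAt (𝓡 n) p).source) :
    riemannianVolume g B = chartVolume g p B := by
  refine le_antisymm ?_ (chartVolume_le g p B)
  obtain ⟨t, ht⟩ := isCompact_univ.elim_finite_subcover
    (fun q : S => (extChartAt (𝓡 n) q).source) (fun q => isOpen_extChartAt_source q)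
    (fun x _ => Set.mem_iUnion.2 ⟨x, mem_extChartAt_source x⟩)
  -- a measurable partition subordinate to the cover
  let e := t.equivFin.symm
  let A : Fin t.card → Set S := disjointed fun i => (extChartAt (𝓡 n) (e i : S)).source
  have hAm : ∀ i, MeasurableSet (A i) := fun i =>
    disjointedRec (fun _ j hs => hs.diff (isOpen_extChartAt_source (e j : S)).measurableSet)
      (isOpen_extChartAt_source (e i : S)).measurableSet
  have hAd : Pairwise (Function.onFun Disjoint A) := disjoint_disjointed _
  have hAs : ∀ i, A i ⊆ (extChartAt (𝓡 n) (e i : S)).source := fun i => disjointed_subset _ i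
  have hAu : ⋃ i, A i = Set.univ := by
    rw [iUnion_disjointed, Set.eq_univ_iff_forall]
    intro x
    obtain ⟨q, hq, hx⟩ := Set.mem_iUnion₂.1 (ht (Set.mem_univ x))
    exact Set.mem_iUnion.2 ⟨t.equivFin ⟨q, hq⟩, by simpa [e] using hx⟩
  -- the glued measure
  let ν : Measure S := Measure.sum fun i => (chartVolume g (e i : S)).restrict (A i)
  have hdec : ∀ (μ : Measure S) (C : Set S), MeasurableSet C → μ C = ∑' i, μ (C ∩ A i) := by
    intro μ C hC
    rw [← measure_iUnion (fun i j hij => (hAd hij).mono Set.inter_subset_right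
      Set.inter_subset_right) (fun i => hC.inter (hAm i)), ← Set.inter_iUnion, hAu, Set.inter_univ]
  have hle : riemannianVolume g ≤ ν := iSup_le fun q => Measure.le_iff.2 fun C hC => by
    rw [hdec _ C hC, Measure.sum_apply _ hC]
    refine ENNReal.tsum_le_tsum fun i => ?_
    rw [Measure.restrict_apply hC, ← chartVolume_inter_source g q (hC.inter (hAm i)),
      chartVolume_congr g (q := (e i : S))
        ((hC.inter (hAm i)).inter (isOpen_extChartAt_source q).measurableSet)
        Set.inter_subset_right (fun x hx => hAs i hx.1.2)]
    exact measure_mono Set.inter_subset_left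
  refine (hle B).trans_eq ?_
  rw [hdec (chartVolume g p) B hB, Measure.sum_apply _ hB]
  refine tsum_congr fun i => ?_
  rw [Measure.restrict_apply hB]
  exact chartVolume_congr g (hB.inter (hAm i)) (fun x hx => hAs i hx.2) fun x hx => hp hx.1

lemma restrict_riemannianVolume [CompactSpace S] (g : RMetric n S) (p : S) :
    (riemannianVolume g).restrict (extChartAt (𝓡 n) p).source = chartVolume g p := by
  ext B hB
  rw [Measure.restrict_apply hB, riemannianVolume_apply g
    (hB.inter (isOpen_extChartAt_source p).measurableSet) Set.inter_subset_right,
    chartVolume_inter_source g p hB]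

instance isFiniteMeasure_riemannianVolume [CompactSpace S] (g : RMetric n S) :
    IsFiniteMeasure (riemannianVolume g) := by
  have : IsLocallyFiniteMeasure (riemannianVolume g) := by
    refine ⟨fun p => ?_⟩
    obtain ⟨r, hr, hball⟩ := Metric.nhds_basis_closedBall.mem_iff.1
      (extChartAt_target_mem_nhds (I := 𝓡 n) p)
    have hU : (extChartAt (𝓡 n) p).source ∩
        extChartAt (𝓡 n) p ⁻¹' Metric.ball (extChartAt (𝓡 n) p p) r ∈ 𝓝 p :=
      inter_mem (extChartAt_source_mem_nhds p)
        ((continuousAt_extChartAt p).preimage_mem_nhds (Metric.ball_mem_nhds _ hr))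
    have hUo : IsOpen ((extChartAt (𝓡 n) p).source ∩
        extChartAt (𝓡 n) p ⁻¹' Metric.ball (extChartAt (𝓡 n) p p) r) :=
      (continuousOn_extChartAt p).isOpen_inter_preimage (isOpen_extChartAt_source p)
        Metric.isOpen_ball
    refine ⟨_, hU, ?_⟩
    rw [riemannianVolume_apply g hUo.measurableSet Set.inter_subset_left,
      chartVolume_apply g p hUo.measurableSet]
    have hsub : (extChartAt (𝓡 n) p).target ∩ (extChartAt (𝓡 n) p).symm ⁻¹'
        ((extChartAt (𝓡 n) p).source ∩
          extChartAt (𝓡 n) p ⁻¹' Metric.ball (extChartAt (𝓡 n) p p) r) ⊆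
        Metric.closedBall (extChartAt (𝓡 n) p p) r := fun y hy => by
      have h := hy.2.2
      rw [Set.mem_preimage, (extChartAt (𝓡 n) p).right_inv hy.1] at h
      exact Metric.ball_subset_closedBall h
    refine (lintegral_mono_set hsub).trans_lt ?_
    have hint := ((contDiffOn_metricDensity g p).continuousOn.mono hball).integrableOn_compact
      (isCompact_closedBall (extChartAt (𝓡 n) p p) r) (μ := volume)
    exact hint.lintegral_lt_top
  exact ⟨isCompact_univ.measure_lt_top⟩

instance isOpenPosMeasure_riemannianVolume (g : RMetric n S) :
    (riemannianVolume g).IsOpenPosMeasure := by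
  refine ⟨fun U hU ⟨p, hp⟩ h0 => ?_⟩
  have h1 : chartVolume g p U = 0 := le_antisymm ((chartVolume_le g p U).trans_eq h0) zero_le
  have hV : IsOpen ((extChartAt (𝓡 n) p).target ∩ (extChartAt (𝓡 n) p).symm ⁻¹' U) :=
    (continuousOn_extChartAt_symm p).isOpen_inter_preimage (isOpen_target p) hU
  rw [chartVolume_apply g p hU.measurableSet, setLIntegral_eq_zero_iff' hV.measurableSet
    ((aemeasurable_density g p).mono_measure (Measure.restrict_mono_set _ Set.inter_subset_left))]
    at h1
  have h2 : volume ((extChartAt (𝓡 n) p).target ∩ (extChartAt (𝓡 n) p).symm ⁻¹' U) = 0 := by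
    refine measure_mono_null (fun y hy => ?_) (ae_iff.1 h1)
    simp only [Set.mem_ofPred_eq, Classical.not_imp, ENNReal.ofReal_eq_zero, not_le]
    exact ⟨hy, metricDensity_pos g hy.1⟩
  have h3 := hV.measure_pos volume ⟨extChartAt (𝓡 n) p p, mem_extChartAt_target p, by
    rw [Set.mem_preimage, extChartAt_to_inv]; exact hp⟩
  exact h3.ne' h2

end Volume

/-! ### Green's formula -/

section Euclidean

variable {X : Type*} [TopologicalSpace X] [T2Space X] [MeasurableSpace X] [BorelSpace X]
  {ν : Measure X}

lemma integrable_mul_of_hasCompactSupport [IsFiniteMeasureOnCompacts ν] {a b : X → ℂ} {U : Set X}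
    (ha : ContinuousOn a U) (hb : Continuous b) (hc : HasCompactSupport b) (hU : tsupport b ⊆ U) :
    Integrable (fun y => a y * b y) ν := by
  refine (integrableOn_iff_integrable_of_support_subset (s := tsupport b) fun y hy => ?_).1
    (((ha.mono hU).mul hb.continuousOn).integrableOn_compact hc)
  exact subset_tsupport b fun h => hy (by simp [h])

variable {E : Type*} [NormedAddCommGroup E] [NormedSpace ℝ E] [FiniteDimensional ℝ E]
  [MeasurableSpace E] [BorelSpace E] {μ : Measure E}

/-- Integration by parts against a compactly supported function. -/
lemma integral_conj_fderiv_mul [μ.IsAddHaarMeasure] {F ψ : E → ℂ} {U : Set E} (hU : IsOpen U)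
    (hF : ContDiffOn ℝ ∞ F U) (hψ : ContDiff ℝ ∞ ψ) (hc : HasCompactSupport ψ)
    (hs : tsupport ψ ⊆ U) (v : E) :
    ∫ y, conj (fderiv ℝ F y v) * ψ y ∂μ = -∫ y, conj (F y) * fderiv ℝ ψ y v ∂μ := by
  have hF1 : ContinuousOn (fun y => conj (F y)) U :=
    Complex.continuous_conj.comp_continuousOn hF.continuousOn
  have hF2 : ContinuousOn (fun y => conj (fderiv ℝ F y v)) U :=
    Complex.continuous_conj.comp_continuousOn
      ((hF.continuousOn_fderiv_of_isOpen hU (by simp)).clm_apply continuousOn_const)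
  have hψ1 : Continuous fun y => fderiv ℝ ψ y v :=
    (hψ.continuous_fderiv (by simp)).clm_apply continuous_const
  have hψs : tsupport (fun y => fderiv ℝ ψ y v) ⊆ tsupport ψ := by
    refine closure_minimal (fun y hy => ?_) (isClosed_tsupport ψ)
    by_contra h
    exact hy (by simp [fderiv_of_notMem_tsupport ℝ h])
  have h := integral_bilinear_hasLineDerivAt_right_eq_neg_left_of_integrable (μ := μ)
    (B := ContinuousLinearMap.mul ℝ ℂ) (f := fun y => conj (F y))
    (f' := fun y => conj (fderiv ℝ F y v)) (g := ψ) (g' := fun y => fderiv ℝ ψ y v) (v := v)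
    (integrable_mul_of_hasCompactSupport hF2 hψ.continuous hc hs)
    (integrable_mul_of_hasCompactSupport hF1 hψ1 (hc.mono' (subset_closure.trans hψs))
      (hψs.trans hs))
    (integrable_mul_of_hasCompactSupport hF1 hψ.continuous hc hs)
    (fun y hy => ?_) (fun y _ => ((hψ.differentiable (by simp)) y).hasFDerivAt.hasLineDerivAt v)
  · simp only [ContinuousLinearMap.mul_apply'] at h
    rw [h, neg_neg]
  · have h1 := (((hF.contDiffAt (hU.mem_nhds (hs hy))).differentiableAt
      (by simp)).hasFDerivAt.hasLineDerivAt v)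
    exact Complex.conjCLE.toContinuousLinearMap.hasFDerivAt.comp_hasDerivAt 0 h1

end Euclidean

section Green

variable {n : ℕ} {S : Type*} [TopologicalSpace S] [ChartedSpace (EuclideanSpace ℝ (Fin n)) S]

open Classical in
/-- A function supported in the domain of the chart at `p`, read in this chart and extended by
zero. -/
noncomputable def chartExt (p : S) (ψ : S → ℂ) : EuclideanSpace ℝ (Fin n) → ℂ :=
  (extChartAt (𝓡 n) p).target.indicator fun y => ψ ((extChartAt (𝓡 n) p).symm y)

lemma chartExt_apply {p : S} {ψ : S → ℂ} {y : EuclideanSpace ℝ (Fin n)}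
    (hy : y ∈ (extChartAt (𝓡 n) p).target) :
    chartExt p ψ y = ψ ((extChartAt (𝓡 n) p).symm y) := Set.indicator_of_mem hy _

lemma chartExt_eventuallyEq {p : S} {ψ : S → ℂ} {y : EuclideanSpace ℝ (Fin n)}
    (hy : y ∈ (extChartAt (𝓡 n) p).target) :
    chartExt p ψ =ᶠ[𝓝 y] fun y => ψ ((extChartAt (𝓡 n) p).symm y) := by
  filter_upwards [(isOpen_target p).mem_nhds hy] with z hz using chartExt_apply hz

lemma support_chartExt_subset {p : S} {ψ : S → ℂ} :
    Function.support (chartExt (n := n) p ψ) ⊆ extChartAt (𝓡 n) p '' (tsupport ψ) := by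
  intro y hy
  have hyt : y ∈ (extChartAt (𝓡 n) p).target := by
    by_contra h
    exact hy (Set.indicator_of_notMem h _)
  rw [Function.mem_support, chartExt_apply hyt] at hy
  exact ⟨_, subset_tsupport ψ hy, (extChartAt (𝓡 n) p).right_inv hyt⟩

variable [CompactSpace S]

lemma isCompact_chart_tsupport {p : S} {ψ : S → ℂ}
    (hs : tsupport ψ ⊆ (extChartAt (𝓡 n) p).source) :
    IsCompact (extChartAt (𝓡 n) p '' (tsupport ψ)) :=
  (isClosed_tsupport ψ).isCompact.image_of_continuousOn ((continuousOn_extChartAt p).mono hs)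

lemma tsupport_chartExt_subset {p : S} {ψ : S → ℂ}
    (hs : tsupport ψ ⊆ (extChartAt (𝓡 n) p).source) :
    tsupport (chartExt (n := n) p ψ) ⊆ extChartAt (𝓡 n) p '' (tsupport ψ) :=
  closure_minimal support_chartExt_subset (isCompact_chart_tsupport hs).isClosed

lemma tsupport_chartExt_subset_target {p : S} {ψ : S → ℂ}
    (hs : tsupport ψ ⊆ (extChartAt (𝓡 n) p).source) :
    tsupport (chartExt (n := n) p ψ) ⊆ (extChartAt (𝓡 n) p).target := by
  refine (tsupport_chartExt_subset hs).trans ?_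
  rintro _ ⟨x, hx, rfl⟩
  exact (extChartAt (𝓡 n) p).map_source (hs hx)

lemma hasCompactSupport_chartExt {p : S} {ψ : S → ℂ}
    (hs : tsupport ψ ⊆ (extChartAt (𝓡 n) p).source) : HasCompactSupport (chartExt (n := n) p ψ) :=
  (isCompact_chart_tsupport hs).of_isClosed_subset (isClosed_tsupport _)
    (tsupport_chartExt_subset hs)

variable [IsManifold (𝓡 n) ∞ S]

lemma contDiff_chartExt {p : S} {ψ : S → ℂ} (hψ : ContMDiff (𝓡 n) 𝓘(ℝ, ℂ) ∞ ψ)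
    (hs : tsupport ψ ⊆ (extChartAt (𝓡 n) p).source) : ContDiff ℝ ∞ (chartExt (n := n) p ψ) := by
  refine contDiff_iff_contDiffAt.2 fun y => ?_
  by_cases hy : y ∈ tsupport (chartExt (n := n) p ψ)
  swap
  · exact contDiffAt_const.congr_of_eventuallyEq (notMem_tsupport_iff_eventuallyEq.1 hy)
  have hy' := tsupport_chartExt_subset_target hs hy
  exact ((contDiffOn_comp_symm hψ p).contDiffAt ((isOpen_target p).mem_nhds hy')).congr_of_eventuallyEq
    (chartExt_eventuallyEq hy')

end Green

section Laplace

variable {n : ℕ} {S : Type*} [TopologicalSpace S] [ChartedSpace (EuclideanSpace ℝ (Fin n)) S]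
  [IsManifold (𝓡 n) ∞ S]

/-- The vector field `√det g · grad u` in the chart at `p`. -/
noncomputable def fluxLoc (g : RMetric n S) (u : S → ℂ) (p : S) (i : Fin n)
    (y : EuclideanSpace ℝ (Fin n)) : ℂ :=
  ∑ j, ((metricDensity g p y * metricInv g p y i j : ℝ) : ℂ) * diffLoc u p y (stdE j)

/-- The Laplace–Beltrami operator in the chart at `p`. -/
noncomputable def lapLoc (g : RMetric n S) (u : S → ℂ) (p : S) (y : EuclideanSpace ℝ (Fin n)) : ℂ :=
  ((metricDensity g p y : ℝ) : ℂ)⁻¹ * ∑ i, fderiv ℝ (fluxLoc g u p i) y (stdE i)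

lemma laplaceBeltrami_eq_lapLoc (g : RMetric n S) (u : S → ℂ) (x : S) :
    laplaceBeltrami g u x = lapLoc g u x (extChartAt (𝓡 n) x x) := rfl

lemma contDiffOn_fluxLoc (g : RMetric n S) {u : S → ℂ} (hu : ContMDiff (𝓡 n) 𝓘(ℝ, ℂ) ∞ u) (p : S)
    (i : Fin n) : ContDiffOn ℝ ∞ (fluxLoc g u p i) (extChartAt (𝓡 n) p).target :=
  ContDiffOn.sum fun j _ => (Complex.ofRealCLM.contDiff.comp_contDiffOn
    ((contDiffOn_metricDensity g p).mul (contDiffOn_metricInv g p i j))).mul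
    ((contDiffOn_diffLoc hu p).clm_apply contDiffOn_const)

lemma continuousOn_lapLoc (g : RMetric n S) {u : S → ℂ} (hu : ContMDiff (𝓡 n) 𝓘(ℝ, ℂ) ∞ u)
    (p : S) : ContinuousOn (lapLoc g u p) (extChartAt (𝓡 n) p).target := by
  refine ContinuousOn.mul (ContinuousOn.inv₀ (Complex.continuous_ofReal.comp_continuousOn
    (contDiffOn_metricDensity g p).continuousOn) fun y hy => ?_) ?_
  · exact_mod_cast (metricDensity_pos g hy).ne'
  · exact continuousOn_finsetSum _ fun i _ => (((contDiffOn_fluxLoc g hu p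
      i).continuousOn_fderiv_of_isOpen (isOpen_target p) (by simp)).clm_apply continuousOn_const)

/-- Green's formula in a chart. -/
lemma integral_conj_lapLoc [CompactSpace S] (g : RMetric n S) {u ψ : S → ℂ}
    (hu : ContMDiff (𝓡 n) 𝓘(ℝ, ℂ) ∞ u) (hψ : ContMDiff (𝓡 n) 𝓘(ℝ, ℂ) ∞ ψ) {p : S}
    (hs : tsupport ψ ⊆ (extChartAt (𝓡 n) p).source) :
    ∫ y in (extChartAt (𝓡 n) p).target,
        metricDensity g p y • (conj (lapLoc g u p y) * ψ ((extChartAt (𝓡 n) p).symm y)) =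
      -∫ y in (extChartAt (𝓡 n) p).target, metricDensity g p y • gradLoc g u ψ p y := by
  have hψ' := contDiff_chartExt hψ hs
  have hc := hasCompactSupport_chartExt hs
  have ht := tsupport_chartExt_subset_target hs
  have hzero : ∀ y, y ∉ (extChartAt (𝓡 n) p).target →
      chartExt p ψ y = 0 ∧ fderiv ℝ (chartExt p ψ) y = 0 := fun y hy =>
    ⟨Set.indicator_of_notMem hy _, fderiv_of_notMem_tsupport ℝ fun h => hy (ht h)⟩
  have hi1 : ∀ i, Integrable fun y =>
      conj (fderiv ℝ (fluxLoc g u p i) y (stdE i)) * chartExt p ψ y := fun i =>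
    integrable_mul_of_hasCompactSupport (Complex.continuous_conj.comp_continuousOn
      (((contDiffOn_fluxLoc g hu p i).continuousOn_fderiv_of_isOpen (isOpen_target p)
        (by simp)).clm_apply continuousOn_const)) hψ'.continuous hc ht
  -- differentiation does not enlarge the support
  have hψs : ∀ i, tsupport (fun y => fderiv ℝ (chartExt p ψ) y (stdE i)) ⊆
      tsupport (chartExt (n := n) p ψ) := fun i => by
    refine closure_minimal (fun y hy => ?_) (isClosed_tsupport _)
    by_contra h
    exact hy (by simp [fderiv_of_notMem_tsupport ℝ h])
  have hi2 : ∀ i, Integrable fun y =>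
      conj (fluxLoc g u p i y) * fderiv ℝ (chartExt p ψ) y (stdE i) := fun i =>
    integrable_mul_of_hasCompactSupport (Complex.continuous_conj.comp_continuousOn
      (contDiffOn_fluxLoc g hu p i).continuousOn)
      ((hψ'.continuous_fderiv (by simp)).clm_apply continuous_const)
      (hc.mono' (subset_closure.trans (hψs i))) ((hψs i).trans ht)
  -- the density cancels against the factor `1 / √det g` of the Laplacian
  have h1 : ∫ y in (extChartAt (𝓡 n) p).target,
      metricDensity g p y • (conj (lapLoc g u p y) * ψ ((extChartAt (𝓡 n) p).symm y)) =
      ∫ y, ∑ i, conj (fderiv ℝ (fluxLoc g u p i) y (stdE i)) * chartExt p ψ y := by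
    refine Eq.trans ?_ (setIntegral_eq_integral_of_forall_compl_eq_zero
      (s := (extChartAt (𝓡 n) p).target) fun y hy => by simp [(hzero y hy).1])
    refine setIntegral_congr_fun (isOpen_target p).measurableSet fun y hy => ?_
    have hd : ((metricDensity g p y : ℝ) : ℂ) ≠ 0 := by
      exact_mod_cast (metricDensity_pos g hy).ne'
    simp only [chartExt_apply hy, lapLoc, map_mul, map_inv₀, Complex.conj_ofReal, map_sum,
      Complex.real_smul, ← Finset.sum_mul]
    field_simp
  have h2 : ∫ y in (extChartAt (𝓡 n) p).target, metricDensity g p y • gradLoc g u ψ p y =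
      ∫ y, ∑ i, conj (fluxLoc g u p i y) * fderiv ℝ (chartExt p ψ) y (stdE i) := by
    refine Eq.trans ?_ (setIntegral_eq_integral_of_forall_compl_eq_zero
      (s := (extChartAt (𝓡 n) p).target) fun y hy => by simp [(hzero y hy).2])
    refine setIntegral_congr_fun (isOpen_target p).measurableSet fun y hy => ?_
    have hf : fderiv ℝ (chartExt p ψ) y = diffLoc ψ p y := (chartExt_eventuallyEq hy).fderiv_eq
    simp only [hf, gradLoc, fluxLoc, map_sum, map_mul, Complex.conj_ofReal, Complex.real_smul,
      Finset.mul_sum, Finset.sum_mul]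
    rw [Finset.sum_comm]
    refine Finset.sum_congr rfl fun i _ => Finset.sum_congr rfl fun j _ => ?_
    rw [metricInv_symm g hy]
    push_cast
    ring
  rw [h1, h2, integral_finsetSum _ fun i _ => hi1 i, integral_finsetSum _ fun i _ => hi2 i,
    ← Finset.sum_neg_distrib]
  exact Finset.sum_congr rfl fun i _ => integral_conj_fderiv_mul (isOpen_target p)
    (contDiffOn_fluxLoc g hu p i) hψ' hc ht _

end Laplace

section GreenGlobal

variable {n : ℕ} {S : Type*} [TopologicalSpace S] [ChartedSpace (EuclideanSpace ℝ (Fin n)) S]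
  [IsManifold (𝓡 n) ∞ S] [CompactSpace S]

/-- A finite smooth partition of unity subordinate to chart domains. -/
lemma exists_partition_of_unity [T2Space S] : ∃ (t : Finset S) (ρ : t → S → ℝ),
    (∀ p, ContMDiff (𝓡 n) 𝓘(ℝ, ℝ) ∞ (ρ p)) ∧
    (∀ p : t, tsupport (ρ p) ⊆ (extChartAt (𝓡 n) (p : S)).source) ∧ ∀ x, ∑ p, ρ p x = 1 := by
  obtain ⟨t, ht⟩ := isCompact_univ.elim_finite_subcover
    (fun q : S => (extChartAt (𝓡 n) q).source) (fun q => isOpen_extChartAt_source q)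
    (fun x _ => Set.mem_iUnion.2 ⟨x, mem_extChartAt_source x⟩)
  obtain ⟨f, hf⟩ := SmoothPartitionOfUnity.exists_isSubordinate (𝓡 n) (isClosed_univ (X := S))
    (fun p : t => (extChartAt (𝓡 n) (p : S)).source) (fun p => isOpen_extChartAt_source _)
    (fun x hx => by
      obtain ⟨q, hq, hx⟩ := Set.mem_iUnion₂.1 (ht hx)
      exact Set.mem_iUnion.2 ⟨⟨q, hq⟩, hx⟩)
  refine ⟨t, fun p => f p, fun p => (f p).contMDiff, hf, fun x => ?_⟩
  rw [← finsum_eq_sum_of_fintype]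
  exact f.sum_eq_one (Set.mem_univ x)

variable [MeasurableSpace S] [BorelSpace S]

/-- An integral of a function supported in the domain of a chart is computed in this chart. -/
lemma integral_eq_chart (g : RMetric n S) {f : S → ℂ} {p : S}
    (hf : ContinuousOn f (extChartAt (𝓡 n) p).source)
    (h0 : ∀ x, x ∉ (extChartAt (𝓡 n) p).source → f x = 0) :
    ∫ x, f x ∂(riemannianVolume g) = ∫ y in (extChartAt (𝓡 n) p).target,
      metricDensity g p y • f ((extChartAt (𝓡 n) p).symm y) := by
  rw [← setIntegral_eq_integral_of_forall_compl_eq_zero h0, restrict_riemannianVolume,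
    integral_chartVolume]
  rw [← restrict_riemannianVolume]
  have : SecondCountableTopology S :=
    ChartedSpace.secondCountable_of_sigmaCompact (EuclideanSpace ℝ (Fin n)) S
  exact hf.aestronglyMeasurable (isOpen_extChartAt_source p).measurableSet

/-- Green's formula against a function supported in the domain of the chart at `p`, with the Laplacian
computed in this chart. -/
lemma integral_conj_lapLoc_comp (g : RMetric n S) {u ψ : S → ℂ}
    (hu : ContMDiff (𝓡 n) 𝓘(ℝ, ℂ) ∞ u) (hψ : ContMDiff (𝓡 n) 𝓘(ℝ, ℂ) ∞ ψ) {p : S}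
    (hs : tsupport ψ ⊆ (extChartAt (𝓡 n) p).source) :
    ∫ x, conj (lapLoc g u p (extChartAt (𝓡 n) p x)) * ψ x ∂(riemannianVolume g) =
      -∫ x, gradPair g u ψ x ∂(riemannianVolume g) := by
  have hout : ∀ x, x ∉ (extChartAt (𝓡 n) p).source → x ∉ tsupport ψ := fun x hx h => hx (hs h)
  rw [integral_eq_chart g (p := p) _ fun x hx => by
      rw [image_eq_zero_of_notMem_tsupport (hout x hx), mul_zero],
    integral_eq_chart g (p := p) (continuous_gradPair g hu hψ).continuousOn
      fun x hx => gradPair_eq_zero g u (hout x hx)]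
  · have h1 : ∫ y in (extChartAt (𝓡 n) p).target, metricDensity g p y •
        gradPair g u ψ ((extChartAt (𝓡 n) p).symm y) =
        ∫ y in (extChartAt (𝓡 n) p).target, metricDensity g p y • gradLoc g u ψ p y :=
      setIntegral_congr_fun (isOpen_target p).measurableSet fun y hy => by
        simp only [gradPair_eq g hu hψ ((extChartAt (𝓡 n) p).map_target hy),
          (extChartAt (𝓡 n) p).right_inv hy]
    rw [h1, ← integral_conj_lapLoc g hu hψ hs]
    exact setIntegral_congr_fun (isOpen_target p).measurableSet fun y hy => by
      simp only [(extChartAt (𝓡 n) p).right_inv hy]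
  · exact (Complex.continuous_conj.comp_continuousOn ((continuousOn_lapLoc g hu p).comp
      (continuousOn_extChartAt p) (extChartAt (𝓡 n) p).mapsTo)).mul hψ.continuous.continuousOn

variable [T2Space S]

/-- The Laplace–Beltrami operator does not depend on the chart: both sides are continuous and have
the same integral against test functions, by Green's formula in the two charts. -/
lemma laplaceBeltrami_eq (g : RMetric n S) {u : S → ℂ} (hu : ContMDiff (𝓡 n) 𝓘(ℝ, ℂ) ∞ u)
    {p x : S} (hx : x ∈ (extChartAt (𝓡 n) p).source) :
    laplaceBeltrami g u x = lapLoc g u p (extChartAt (𝓡 n) p x) := by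
  have : SecondCountableTopology S :=
    ChartedSpace.secondCountable_of_sigmaCompact (EuclideanSpace ℝ (Fin n)) S
  set U := (extChartAt (𝓡 n) x).source ∩ (extChartAt (𝓡 n) p).source with hU
  have hUo : IsOpen U := (isOpen_extChartAt_source x).inter (isOpen_extChartAt_source p)
  have hcont : ∀ q, ContinuousOn (fun z => conj (lapLoc g u q (extChartAt (𝓡 n) q z)))
      (extChartAt (𝓡 n) q).source := fun q =>
    Complex.continuous_conj.comp_continuousOn ((continuousOn_lapLoc g hu q).comp
      (continuousOn_extChartAt q) (extChartAt (𝓡 n) q).mapsTo)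
  have hcx := (hcont x).mono (Set.inter_subset_left : U ⊆ _)
  have hcp := (hcont p).mono (Set.inter_subset_right : U ⊆ _)
  -- the fundamental lemma of the calculus of variations
  have hae := hUo.ae_eq_zero_of_integral_contMDiff_smul_eq_zero (𝓡 n)
    (μ := riemannianVolume g)
    ((hcx.sub hcp).locallyIntegrableOn hUo.measurableSet)
    (fun ρ hρ _ hs => by
      have hψ : ContMDiff (𝓡 n) 𝓘(ℝ, ℂ) ∞ fun z => (ρ z : ℂ) :=
        Complex.ofRealCLM.contDiff.comp_contMDiff hρ
      have hψs : tsupport (fun z => (ρ z : ℂ)) ⊆ U :=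
        (tsupport_comp_subset (g := Complex.ofReal) Complex.ofReal_zero ρ).trans hs
      have hi : ∀ q, tsupport (fun z => (ρ z : ℂ)) ⊆ (extChartAt (𝓡 n) q).source →
          Integrable (fun z => conj (lapLoc g u q (extChartAt (𝓡 n) q z)) * (ρ z : ℂ))
            (riemannianVolume g) := fun q hq =>
        integrable_mul_of_hasCompactSupport (hcont q) hψ.continuous
          (HasCompactSupport.of_compactSpace _) hq
      have h1 := hψs.trans Set.inter_subset_left
      have h2 := hψs.trans Set.inter_subset_right
      calc ∫ z, ρ z • (conj (lapLoc g u x (extChartAt (𝓡 n) x z)) -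
            conj (lapLoc g u p (extChartAt (𝓡 n) p z))) ∂(riemannianVolume g)
          = ∫ z, (conj (lapLoc g u x (extChartAt (𝓡 n) x z)) * (ρ z : ℂ) -
            conj (lapLoc g u p (extChartAt (𝓡 n) p z)) * (ρ z : ℂ)) ∂(riemannianVolume g) :=
          integral_congr_ae (Eventually.of_forall fun z => by
            simp only [Complex.real_smul]; ring)
        _ = 0 := by
          rw [integral_sub (hi x h1) (hi p h2), integral_conj_lapLoc_comp g hu hψ h1,
            integral_conj_lapLoc_comp g hu hψ h2, sub_self])
  have heq : Set.EqOn (fun z => conj (lapLoc g u x (extChartAt (𝓡 n) x z)))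
      (fun z => conj (lapLoc g u p (extChartAt (𝓡 n) p z))) U := by
    refine Measure.eqOn_open_of_ae_eq (μ := riemannianVolume g) ?_ hUo hcx hcp
    rw [EventuallyEq, ae_restrict_iff' hUo.measurableSet]
    filter_upwards [hae] with z hz hzU using sub_eq_zero.1 (hz hzU)
  have h := heq ⟨mem_extChartAt_source x, hx⟩
  rw [laplaceBeltrami_eq_lapLoc]
  exact (starRingEnd ℂ).injective h

lemma continuous_laplaceBeltrami (g : RMetric n S) {u : S → ℂ}
    (hu : ContMDiff (𝓡 n) 𝓘(ℝ, ℂ) ∞ u) : Continuous (laplaceBeltrami g u) :=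
  continuous_of_chart (n := n) fun p => ⟨lapLoc g u p, _, extChartAt_source_mem_nhds p,
    (continuousOn_lapLoc g hu p).continuousAt (extChartAt_target_mem_nhds p),
    fun _ hx => laplaceBeltrami_eq g hu hx⟩

/-- Green's formula on a closed manifold. -/
lemma integral_conj_laplaceBeltrami_mul (g : RMetric n S) {u v : S → ℂ}
    (hu : ContMDiff (𝓡 n) 𝓘(ℝ, ℂ) ∞ u) (hv : ContMDiff (𝓡 n) 𝓘(ℝ, ℂ) ∞ v) :
    ∫ x, conj (laplaceBeltrami g u x) * v x ∂(riemannianVolume g) =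
      -∫ x, gradPair g u v x ∂(riemannianVolume g) := by
  obtain ⟨t, ρ, hρ, hs, h1⟩ := exists_partition_of_unity (n := n) (S := S)
  have hψ : ∀ p, ContMDiff (𝓡 n) 𝓘(ℝ, ℂ) ∞ fun z => (ρ p z : ℂ) * v z := fun p =>
    ((hρ p).smul hv).congr fun z => by rw [Pi.smul_apply', Complex.real_smul]
  have hψs : ∀ p : t, tsupport (fun z => (ρ p z : ℂ) * v z) ⊆
      (extChartAt (𝓡 n) (p : S)).source := fun p =>
    (tsupport_mul_subset_left.trans
      (tsupport_comp_subset (g := Complex.ofReal) Complex.ofReal_zero (ρ p))).trans (hs p)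
  have hloc : ∀ p : t, ∫ x, conj (laplaceBeltrami g u x) * ((ρ p x : ℂ) * v x)
      ∂(riemannianVolume g) =
      -∫ x, gradPair g u (fun z => (ρ p z : ℂ) * v z) x ∂(riemannianVolume g) := fun p => by
    rw [← integral_conj_lapLoc_comp g hu (hψ p) (hψs p)]
    refine integral_congr_ae (Eventually.of_forall fun x => ?_)
    by_cases hx : x ∈ (extChartAt (𝓡 n) (p : S)).source
    · simp only [laplaceBeltrami_eq g hu hx]
    · have h0 : (ρ p x : ℂ) * v x = 0 :=
        image_eq_zero_of_notMem_tsupport (f := fun z => (ρ p z : ℂ) * v z) fun h => hx (hψs p h)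
      simp only [h0, mul_zero]
  have hsum : ∀ x, v x = ∑ p, (ρ p x : ℂ) * v x := fun x => by
    rw [← Finset.sum_mul, ← Complex.ofReal_sum, h1, Complex.ofReal_one, one_mul]
  -- the derivatives of the partition of unity cancel by linearity of the differential
  have hgsum : ∀ x, gradPair g u v x = ∑ p, gradPair g u (fun z => (ρ p z : ℂ) * v z) x :=
    fun x => by
      have key : ∀ s : Finset t, gradPair g u (fun z => ∑ p ∈ s, (ρ p z : ℂ) * v z) x =
          ∑ p ∈ s, gradPair g u (fun z => (ρ p z : ℂ) * v z) x := fun s => by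
        classical
        induction s using Finset.induction_on with
        | empty => simpa using gradPair_const_mul_right g u hv 0 x
        | insert a s ha ih =>
          rw [Finset.sum_insert ha, ← ih, ← gradPair_add_right g u (hψ a)
            (contMDiff_finsetSum fun p _ => hψ p)]
          simp only [Finset.sum_insert ha]
      rw [← key]
      exact congrArg (fun w => gradPair g u w x) (funext hsum)
  calc ∫ x, conj (laplaceBeltrami g u x) * v x ∂(riemannianVolume g)
      = ∫ x, ∑ p, conj (laplaceBeltrami g u x) * ((ρ p x : ℂ) * v x) ∂(riemannianVolume g) := by
        simp only [← Finset.mul_sum, ← hsum]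
    _ = ∑ p, -∫ x, gradPair g u (fun z => (ρ p z : ℂ) * v z) x ∂(riemannianVolume g) := by
        rw [integral_finsetSum]
        · exact Finset.sum_congr rfl fun p _ => hloc p
        · exact fun p _ => ((Complex.continuous_conj.comp (continuous_laplaceBeltrami g hu)).mul
            (hψ p).continuous).integrable_of_hasCompactSupport (HasCompactSupport.of_compactSpace _)
    _ = -∫ x, gradPair g u v x ∂(riemannianVolume g) := by
        simp only [hgsum]
        rw [integral_finsetSum, Finset.sum_neg_distrib]
        exact fun p _ => (continuous_gradPair g hu (hψ p)).integrable_of_hasCompactSupport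
          (HasCompactSupport.of_compactSpace _)

end GreenGlobal

/-! ### Poincaré inequalities in Euclidean space -/

section Poincare

/-- Cauchy–Schwarz against the constant function. -/
lemma sq_lintegral_le {α : Type*} [MeasurableSpace α] {μ : Measure α} {f : α → ENNReal}
    (hf : AEMeasurable f μ) : (∫⁻ x, f x ∂μ) ^ 2 ≤ μ Set.univ * ∫⁻ x, f x ^ 2 ∂μ := by
  have h := ENNReal.lintegral_mul_le_Lp_mul_Lq μ Real.HolderConjugate.two_two
    (aemeasurable_const (b := (1 : ENNReal))) hf
  simp only [Pi.mul_apply, one_mul, ENNReal.one_rpow, lintegral_const, one_div] at h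
  calc (∫⁻ x, f x ∂μ) ^ 2
      ≤ (μ Set.univ ^ (2⁻¹ : ℝ) * (∫⁻ x, f x ^ (2 : ℝ) ∂μ) ^ (2⁻¹ : ℝ)) ^ 2 := by gcongr
    _ = _ := by
      rw [mul_pow, ← ENNReal.rpow_natCast, ← ENNReal.rpow_natCast, ← ENNReal.rpow_mul,
        ← ENNReal.rpow_mul]
      simp

variable {E : Type*} [NormedAddCommGroup E] [NormedSpace ℝ E]

/-- The increment along a segment is controlled by the integral of the differential. -/
lemma enorm_sub_sq_le {f : E → ℂ} {B : Set E} (hB : Convex ℝ B) (hBo : IsOpen B)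
    (hf : ContDiffOn ℝ 1 f B) {x z : E} (hx : x ∈ B) (hz : x + z ∈ B) :
    ‖f (x + z) - f x‖ₑ ^ 2 ≤
      ‖z‖ₑ ^ 2 * ∫⁻ t in Set.Icc (0 : ℝ) 1, ‖fderiv ℝ f (x + t • z)‖ₑ ^ 2 := by
  have hmem : ∀ t ∈ Set.Icc (0 : ℝ) 1, x + t • z ∈ B := fun t ht =>
    hB.add_smul_mem hx hz ht
  have hline : Continuous fun t : ℝ => x + t • z := by fun_prop
  have hcont : ContinuousOn (fun t : ℝ => fderiv ℝ f (x + t • z)) (Set.Icc (0 : ℝ) 1) :=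
    (hf.continuousOn_fderiv_of_isOpen hBo le_rfl).comp hline.continuousOn hmem
  have hd : ∀ t ∈ Set.uIcc (0 : ℝ) 1,
      HasDerivAt (fun t : ℝ => f (x + t • z)) (fderiv ℝ f (x + t • z) z) t := fun t ht => by
    rw [Set.uIcc_of_le zero_le_one] at ht
    have h1 := ((hf.contDiffAt (hBo.mem_nhds (hmem t ht))).differentiableAt one_ne_zero).hasFDerivAt
    have h2 : HasDerivAt (fun t : ℝ => x + t • z) z t := by
      simpa using ((hasDerivAt_id t).smul_const z).const_add x
    exact h1.comp_hasDerivAt t h2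
  have hcont' : ContinuousOn (fun t : ℝ => fderiv ℝ f (x + t • z) z) (Set.uIcc (0 : ℝ) 1) := by
    rw [Set.uIcc_of_le zero_le_one]
    exact hcont.clm_apply continuousOn_const
  have hftc := intervalIntegral.integral_eq_sub_of_hasDerivAt hd hcont'.intervalIntegrable
  simp only [one_smul, zero_smul, add_zero] at hftc
  rw [← hftc, intervalIntegral.integral_of_le zero_le_one, ← integral_Icc_eq_integral_Ioc]
  have hm : AEMeasurable (fun t : ℝ => ‖fderiv ℝ f (x + t • z)‖ₑ)
      (volume.restrict (Set.Icc (0 : ℝ) 1)) :=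
    (hcont.enorm).aemeasurable measurableSet_Icc
  calc ‖∫ t in Set.Icc (0 : ℝ) 1, fderiv ℝ f (x + t • z) z‖ₑ ^ 2
      ≤ (∫⁻ t in Set.Icc (0 : ℝ) 1, ‖fderiv ℝ f (x + t • z)‖ₑ * ‖z‖ₑ) ^ 2 := by
        gcongr
        exact (enorm_integral_le_lintegral_enorm _).trans
          (lintegral_mono fun t => ContinuousLinearMap.le_opENorm _ _)
    _ = ‖z‖ₑ ^ 2 * (∫⁻ t in Set.Icc (0 : ℝ) 1, ‖fderiv ℝ f (x + t • z)‖ₑ) ^ 2 := by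
        rw [lintegral_mul_const'' _ hm, mul_pow, mul_comm]
    _ ≤ _ := by
        gcongr
        refine (sq_lintegral_le hm).trans_eq ?_
        simp

variable [FiniteDimensional ℝ E] [MeasurableSpace E] [BorelSpace E] (μ : Measure E)
  [μ.IsAddHaarMeasure]

/-- The `L²` distance of a function and its translate is controlled by the gradient. -/
lemma lintegral_translate_le {f : E → ℂ} {B : Set E} (hB : Convex ℝ B) (hBo : IsOpen B)
    (hf : ContDiffOn ℝ 1 f B) (z : E) :
    ∫⁻ x in B ∩ (fun x => x + z) ⁻¹' B, ‖f (x + z) - f x‖ₑ ^ 2 ∂μ ≤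
      ‖z‖ₑ ^ 2 * ∫⁻ x in B, ‖fderiv ℝ f x‖ₑ ^ 2 ∂μ := by
  let h : E → ENNReal := B.indicator fun x => ‖fderiv ℝ f x‖ₑ ^ 2
  have hm : Measurable h := ((measurable_fderiv ℝ f).enorm.pow_const 2).indicator hBo.measurableSet
  have hmeas : MeasurableSet (B ∩ (fun x => x + z) ⁻¹' B) :=
    hBo.measurableSet.inter ((measurable_id.add_const z) hBo.measurableSet)
  have hm2 : Measurable fun q : E × ℝ => h (q.1 + q.2 • z) := hm.comp (by fun_prop)
  calc ∫⁻ x in B ∩ (fun x => x + z) ⁻¹' B, ‖f (x + z) - f x‖ₑ ^ 2 ∂μ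
      ≤ ∫⁻ x in B ∩ (fun x => x + z) ⁻¹' B,
          ‖z‖ₑ ^ 2 * (∫⁻ t in Set.Icc (0 : ℝ) 1, h (x + t • z)) ∂μ := by
        refine setLIntegral_mono' hmeas fun x hx => (enorm_sub_sq_le hB hBo hf hx.1 hx.2).trans ?_
        gcongr ‖z‖ₑ ^ 2 * ?_
        refine setLIntegral_mono' measurableSet_Icc fun t ht => ?_
        exact (Set.indicator_of_mem (hB.add_smul_mem hx.1 hx.2 ht)
          fun x => ‖fderiv ℝ f x‖ₑ ^ 2).ge
    _ ≤ ∫⁻ x, ‖z‖ₑ ^ 2 * (∫⁻ t in Set.Icc (0 : ℝ) 1, h (x + t • z)) ∂μ := setLIntegral_le_lintegral _ _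
    _ = ‖z‖ₑ ^ 2 * ∫⁻ t in Set.Icc (0 : ℝ) 1, (∫⁻ x, h (x + t • z) ∂μ) := by
        rw [lintegral_const_mul _ hm2.lintegral_prod_right',
          lintegral_lintegral_swap hm2.aemeasurable]
    _ = _ := by
        simp only [lintegral_add_right_eq_self]
        simp [h, lintegral_indicator hBo.measurableSet]

/-- A Poincaré inequality on convex open sets, localized to pairs of points of distance at
most `d`. -/
lemma lintegral_lintegral_sub_le {f : E → ℂ} {B : Set E} (hB : Convex ℝ B) (hBo : IsOpen B)
    (hf : ContDiffOn ℝ 1 f B) (d : ℝ) :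
    ∫⁻ x in B, ∫⁻ y in B ∩ Metric.closedBall x d, ‖f y - f x‖ₑ ^ 2 ∂μ ∂μ ≤
      μ (Metric.closedBall 0 d) * (ENNReal.ofReal d ^ 2 * ∫⁻ x in B, ‖fderiv ℝ f x‖ₑ ^ 2 ∂μ) := by
  let fB : E → ℂ := B.indicator f
  have hfB : Measurable fB := by
    classical
    rw [show fB = B.piecewise f 0 from (Set.piecewise_eq_indicator).symm]
    exact hf.continuousOn.measurable_piecewise continuousOn_const hBo.measurableSet
  -- the integrand after the substitution `y = x + z`
  let K : E → E → ENNReal := fun x z =>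
    ((Metric.closedBall (0 : E) d).indicator 1 z) * (B.indicator 1 x * B.indicator 1 (x + z)) *
      ‖fB (x + z) - fB x‖ₑ ^ 2
  have h1B : Measurable (B.indicator (1 : E → ENNReal)) := measurable_one.indicator hBo.measurableSet
  have hK : Measurable fun q : E × E => K q.1 q.2 := by
    have h2 : Measurable fun q : E × E => q.1 + q.2 := by fun_prop
    exact (((measurable_one.indicator measurableSet_closedBall).comp measurable_snd).mul
      ((h1B.comp measurable_fst).mul (h1B.comp h2))).mul
      (((hfB.comp h2).sub (hfB.comp measurable_fst)).enorm.pow_const 2)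
  calc ∫⁻ x in B, ∫⁻ y in B ∩ Metric.closedBall x d, ‖f y - f x‖ₑ ^ 2 ∂μ ∂μ
      = ∫⁻ x, ∫⁻ z, K x z ∂μ ∂μ := by
        rw [← lintegral_indicator hBo.measurableSet]
        refine lintegral_congr fun x => ?_
        by_cases hx : x ∈ B
        · rw [Set.indicator_of_mem hx, ← lintegral_indicator
            (hBo.measurableSet.inter measurableSet_closedBall),
            ← lintegral_add_left_eq_self _ x]
          refine lintegral_congr fun z => ?_
          by_cases hz : x + z ∈ B <;> by_cases hzd : z ∈ Metric.closedBall (0 : E) d <;>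
            simp_all [K, fB, Set.indicator, Metric.mem_closedBall]
        · rw [Set.indicator_of_notMem hx]
          simp [K, hx]
    _ = ∫⁻ z, ∫⁻ x, K x z ∂μ ∂μ := lintegral_lintegral_swap hK.aemeasurable
    _ ≤ ∫⁻ z in Metric.closedBall (0 : E) d,
          ENNReal.ofReal d ^ 2 * ∫⁻ x in B, ‖fderiv ℝ f x‖ₑ ^ 2 ∂μ ∂μ := by
        rw [← lintegral_indicator measurableSet_closedBall]
        refine lintegral_mono fun z => ?_
        by_cases hz : z ∈ Metric.closedBall (0 : E) d
        · rw [Set.indicator_of_mem hz]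
          have hmeas : MeasurableSet (B ∩ (fun x => x + z) ⁻¹' B) :=
            hBo.measurableSet.inter ((measurable_id.add_const z) hBo.measurableSet)
          have hzd : ‖z‖ₑ ≤ ENNReal.ofReal d := by
            rw [← ofReal_norm]
            exact ENNReal.ofReal_le_ofReal (by simpa using hz)
          calc ∫⁻ x, K x z ∂μ
              = ∫⁻ x in B ∩ (fun x => x + z) ⁻¹' B, ‖f (x + z) - f x‖ₑ ^ 2 ∂μ := by
                rw [← lintegral_indicator hmeas]
                refine lintegral_congr fun x => ?_
                by_cases hx : x ∈ B <;> by_cases hxz : x + z ∈ B <;>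
                  simp_all [K, fB, Set.indicator]
            _ ≤ _ := lintegral_translate_le μ hB hBo hf z
            _ ≤ _ := by gcongr
        · rw [Set.indicator_of_notMem hz]
          simp [K, hz]
    _ = _ := by
        rw [setLIntegral_const, mul_comm]

end Poincare

section Cells

lemma ENNReal.add_sq_le_four (a b : ENNReal) : (a + b) ^ 2 ≤ 4 * (a ^ 2 + b ^ 2) := by
  have key : ∀ {a b : ENNReal}, a ≤ b → (a + b) ^ 2 ≤ 4 * (a ^ 2 + b ^ 2) := fun {a b} h =>
    calc (a + b) ^ 2 ≤ (b + b) ^ 2 := by gcongr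
      _ = 4 * b ^ 2 := by ring
      _ ≤ _ := by gcongr; exact le_add_self
  rcases le_total a b with h | h
  · exact key h
  · rw [add_comm a b, add_comm (a ^ 2)]; exact key h

variable {α : Type*} [MeasurableSpace α] {μ : Measure α}

/-- On a set of finite measure, the `L²` norm is controlled by the mean value and the mean
oscillation. -/
lemma lintegral_sq_le_mean_add_oscillation {f : α → ℂ} {C : Set α} (h0 : μ C ≠ 0)
    (h1 : μ C ≠ ⊤) (hf : IntegrableOn f C μ) :
    ∫⁻ x in C, ‖f x‖ₑ ^ 2 ∂μ ≤ 4 * (μ C)⁻¹ * (∫⁻ x in C, ∫⁻ y in C, ‖f y - f x‖ₑ ^ 2 ∂μ ∂μ) +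
      4 * (μ C)⁻¹ * ‖∫ x in C, f x ∂μ‖ₑ ^ 2 := by
  have hpt : ∀ x, (μ C) ^ 2 * ‖f x‖ₑ ^ 2 ≤
      4 * (‖∫ y in C, f y ∂μ‖ₑ ^ 2 + μ C * ∫⁻ y in C, ‖f y - f x‖ₑ ^ 2 ∂μ) := fun x => by
    -- write `μ(C) f(x)` as the integral of `f` minus that of `f - f(x)`
    have h2 : (μ.real C) • f x = (∫ y in C, f y ∂μ) - ∫ y in C, (f y - f x) ∂μ := by
      rw [integral_sub hf (integrableOn_const h1), setIntegral_const]
      ring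
    have h3 : μ C * ‖f x‖ₑ = ‖(μ.real C) • f x‖ₑ := by
      rw [enorm_smul, Real.enorm_of_nonneg measureReal_nonneg, ofReal_measureReal h1]
    have hm : AEMeasurable (fun y => ‖f y - f x‖ₑ) (μ.restrict C) :=
      (hf.aestronglyMeasurable.sub aestronglyMeasurable_const).enorm
    rw [← mul_pow, h3, h2]
    calc ‖(∫ y in C, f y ∂μ) - ∫ y in C, (f y - f x) ∂μ‖ₑ ^ 2
        ≤ (‖∫ y in C, f y ∂μ‖ₑ + ∫⁻ y in C, ‖f y - f x‖ₑ ∂μ) ^ 2 := by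
          gcongr
          refine (enorm_sub_le).trans ?_
          gcongr
          exact enorm_integral_le_lintegral_enorm _
      _ ≤ 4 * (‖∫ y in C, f y ∂μ‖ₑ ^ 2 + (∫⁻ y in C, ‖f y - f x‖ₑ ∂μ) ^ 2) :=
          ENNReal.add_sq_le_four _ _
      _ ≤ _ := by
          gcongr
          refine (sq_lintegral_le hm).trans_eq ?_
          rw [Measure.restrict_apply_univ]
  set O := ∫⁻ x in C, ∫⁻ y in C, ‖f y - f x‖ₑ ^ 2 ∂μ ∂μ with hO
  set M := ‖∫ x in C, f x ∂μ‖ₑ ^ 2 with hM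
  have hint : (μ C) ^ 2 * ∫⁻ x in C, ‖f x‖ₑ ^ 2 ∂μ ≤ 4 * (M * μ C + μ C * O) := by
    rw [← lintegral_const_mul' _ _ (ENNReal.pow_ne_top h1)]
    refine (lintegral_mono hpt).trans_eq ?_
    rw [lintegral_const_mul' _ _ (by simp), lintegral_add_left measurable_const,
      lintegral_const, Measure.restrict_apply_univ, lintegral_const_mul' _ _ h1]
  have hinv : (μ C)⁻¹ * μ C = 1 := ENNReal.inv_mul_cancel h0 h1
  calc ∫⁻ x in C, ‖f x‖ₑ ^ 2 ∂μ
      = ((μ C)⁻¹ * μ C) ^ 2 * ∫⁻ x in C, ‖f x‖ₑ ^ 2 ∂μ := by rw [hinv, one_pow, one_mul]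
    _ = (μ C)⁻¹ ^ 2 * ((μ C) ^ 2 * ∫⁻ x in C, ‖f x‖ₑ ^ 2 ∂μ) := by ring
    _ ≤ (μ C)⁻¹ ^ 2 * (4 * (M * μ C + μ C * O)) := by gcongr
    _ = ((μ C)⁻¹ * μ C) * (4 * (μ C)⁻¹ * O + 4 * (μ C)⁻¹ * M) := by ring
    _ = _ := by rw [hinv, one_mul]

end Cells

section Grid

variable {n : ℕ}

/-- The half-open cube of side `h` with index `a` in the grid `hℤⁿ`. -/
def gridCell (h : ℝ) (a : Fin n → ℤ) : Set (EuclideanSpace ℝ (Fin n)) :=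
  {y | ∀ i, y i ∈ Set.Ico (a i * h) ((a i + 1) * h)}

lemma gridCell_eq_preimage (h : ℝ) (a : Fin n → ℤ) : gridCell h a =
    WithLp.ofLp ⁻¹' (Set.univ.pi fun i => Set.Ico (a i * h) ((a i + 1) * h)) := by
  ext y
  simp [gridCell]

lemma measurableSet_gridCell (h : ℝ) (a : Fin n → ℤ) : MeasurableSet (gridCell h a) := by
  rw [gridCell_eq_preimage]
  exact (PiLp.volume_preserving_ofLp (Fin n)).measurable
    (MeasurableSet.univ_pi fun i => measurableSet_Ico)

lemma volume_gridCell {h : ℝ} (a : Fin n → ℤ) :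
    volume (gridCell h a) = ENNReal.ofReal h ^ n := by
  rw [gridCell_eq_preimage, (PiLp.volume_preserving_ofLp (Fin n)).measure_preimage
    (MeasurableSet.univ_pi fun i => measurableSet_Ico).nullMeasurableSet, volume_pi_pi]
  simp only [Real.volume_Ico]
  have : ∀ i, ((a i : ℝ) + 1) * h - a i * h = h := fun i => by ring
  simp [this]

lemma mem_gridCell_iff {h : ℝ} (hh : 0 < h) {a : Fin n → ℤ} {y : EuclideanSpace ℝ (Fin n)} :
    y ∈ gridCell h a ↔ ∀ i, ⌊y i / h⌋ = a i := by
  refine forall_congr' fun i => ?_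
  rw [Int.floor_eq_iff, Set.mem_Ico, le_div_iff₀ hh, div_lt_iff₀ hh]

lemma dist_le_of_mem_gridCell {h : ℝ} (hh : 0 < h) {a : Fin n → ℤ}
    {x y : EuclideanSpace ℝ (Fin n)} (hx : x ∈ gridCell h a) (hy : y ∈ gridCell h a) :
    dist x y ≤ (n + 1) * h := by
  have hi : ∀ i, dist (x i) (y i) ≤ h := fun i => by
    have h1 := hx i
    have h2 := hy i
    rw [Set.mem_Ico] at h1 h2
    rw [Real.dist_eq, abs_le]
    constructor <;> nlinarith
  rw [EuclideanSpace.dist_eq]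
  refine Real.sqrt_le_iff.2 ⟨by positivity, ?_⟩
  calc ∑ i, dist (x i) (y i) ^ 2 ≤ ∑ _i : Fin n, h ^ 2 :=
        Finset.sum_le_sum fun i _ => pow_le_pow_left₀ dist_nonneg (hi i) 2
    _ = n * h ^ 2 := by simp
    _ ≤ ((n + 1) * h) ^ 2 := by
      rw [mul_pow]
      have : (0 : ℝ) ≤ n := Nat.cast_nonneg n
      nlinarith [sq_nonneg h, sq_nonneg (n * h)]

lemma finite_gridCell_inter {h : ℝ} (hh : 0 < h) (M : ℝ) :
    {a : Fin n → ℤ | ∃ y ∈ gridCell h a, ‖y‖ ≤ M}.Finite := by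
  refine (Set.Finite.pi' fun _ : Fin n => Set.finite_Icc ⌊-M / h⌋ ⌊M / h⌋).subset ?_
  rintro a ⟨y, hy, hyM⟩ i
  have h1 : |y i| ≤ M := by
    simpa using (PiLp.norm_apply_le y i).trans hyM
  rw [abs_le] at h1
  rw [mem_gridCell_iff hh] at hy
  rw [Set.mem_Icc, ← hy i]
  exact ⟨Int.floor_le_floor (by gcongr; exact h1.1), Int.floor_le_floor (by gcongr; exact h1.2)⟩

/-- **Friedrichs' inequality** on balls: up to a small multiple of the gradient, the `L²` norm is
controlled by finitely many mean values, over the cubes of a fine grid. -/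
lemma exists_friedrichs_ball (c : EuclideanSpace ℝ (Fin n)) {R δ : ℝ} (hR : 0 < R) (hδ : 0 < δ) :
    ∃ (T : Finset (Fin n → ℤ)) (C : (Fin n → ℤ) → Set (EuclideanSpace ℝ (Fin n))) (V : ENNReal),
      V ≠ 0 ∧ V ≠ ⊤ ∧ (∀ a ∈ T, MeasurableSet (C a) ∧ C a ⊆ Metric.ball c R ∧ volume (C a) = V) ∧
      ∀ f : EuclideanSpace ℝ (Fin n) → ℂ, ContDiffOn ℝ 1 f (Metric.ball c R) →
        IntegrableOn f (Metric.ball c R) →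
        ∫⁻ y in Metric.ball c (R / 2), ‖f y‖ₑ ^ 2 ≤
          ENNReal.ofReal δ * (∫⁻ y in Metric.ball c R, ‖fderiv ℝ f y‖ₑ ^ 2) +
            4 * V⁻¹ * ∑ a ∈ T, ‖∫ y in C a, f y‖ₑ ^ 2 := by
  classical
  set v := (volume (Metric.ball (0 : EuclideanSpace ℝ (Fin n)) 1)).toReal with hv
  have hv0 : 0 ≤ v := ENNReal.toReal_nonneg
  -- the mesh `h` of the grid
  obtain ⟨h, hh, hhR, hhδ⟩ : ∃ h : ℝ, 0 < h ∧ (n + 1) * h < R / 2 ∧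
      4 * ((n + 1) ^ n * v * ((n + 1) * h) ^ 2) ≤ δ := by
    have h1 : Tendsto (fun h : ℝ => (n + 1) * h) (𝓝[>] 0) (𝓝 0) := by
      have : Tendsto (fun h : ℝ => (n + 1) * h) (𝓝 0) (𝓝 (((n : ℝ) + 1) * 0)) :=
        (continuous_const.mul continuous_id).tendsto 0
      rw [mul_zero] at this
      exact this.mono_left nhdsWithin_le_nhds
    have h2 : Tendsto (fun h : ℝ => 4 * ((n + 1) ^ n * v * ((n + 1) * h) ^ 2)) (𝓝[>] 0) (𝓝 0) := by
      simpa using ((h1.pow 2).const_mul (((n : ℝ) + 1) ^ n * v)).const_mul 4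
    obtain ⟨h, h3⟩ := ((h1.eventually_lt_const (half_pos hR)).and
      ((h2.eventually_le_const hδ).and self_mem_nhdsWithin)).exists
    exact ⟨h, h3.2.2, h3.1, h3.2.1⟩
  set d := (n + 1) * h with hd
  have hd0 : 0 ≤ d := by positivity
  -- the cubes which meet the smaller ball; by the choice of `h` they lie in the larger one
  let T := (finite_gridCell_inter (n := n) hh (‖c‖ + R)).toFinset.filter fun a =>
    ∃ y ∈ gridCell h a, y ∈ Metric.ball c (R / 2)
  have hV0 : ENNReal.ofReal h ^ n ≠ 0 := pow_ne_zero _ (by simpa using hh)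
  have hV1 : ENNReal.ofReal h ^ n ≠ ⊤ := ENNReal.pow_ne_top ENNReal.ofReal_ne_top
  have hsub : ∀ a ∈ T, gridCell h a ⊆ Metric.ball c R := fun a ha x hx => by
    obtain ⟨y, hy, hyR⟩ := (Finset.mem_filter.1 ha).2
    have := dist_triangle x y c
    have := dist_le_of_mem_gridCell hh hx hy
    rw [Metric.mem_ball] at hyR ⊢
    linarith
  have hcover : Metric.ball c (R / 2) ⊆ ⋃ a ∈ T, gridCell h a := fun y hy => by
    have hmem : y ∈ gridCell h fun i => ⌊y i / h⌋ := (mem_gridCell_iff hh).2 fun i => rfl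
    refine Set.mem_iUnion₂.2 ⟨_, Finset.mem_filter.2 ⟨?_, y, hmem, hy⟩, hmem⟩
    rw [Set.Finite.mem_toFinset]
    refine ⟨y, hmem, ?_⟩
    have h1 : ‖y‖ ≤ ‖y - c‖ + ‖c‖ := by simpa using norm_add_le (y - c) c
    rw [Metric.mem_ball, dist_eq_norm] at hy
    linarith
  have hdisj : Set.PairwiseDisjoint (T : Set (Fin n → ℤ)) (gridCell h) := fun a _ b _ hab =>
    Set.disjoint_left.2 fun y hya hyb => hab (funext fun i => by
      rw [← (mem_gridCell_iff hh).1 hya i, (mem_gridCell_iff hh).1 hyb i])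
  refine ⟨T, gridCell h, ENNReal.ofReal h ^ n, hV0, hV1, fun a ha =>
    ⟨measurableSet_gridCell h a, hsub a ha, volume_gridCell a⟩, fun f hf hfi => ?_⟩
  set V := ENNReal.ofReal h ^ n with hVdef
  set D := ∫⁻ y in Metric.ball c R, ‖fderiv ℝ f y‖ₑ ^ 2 with hD
  -- points in the same cube have distance at most `d`
  have hosc : ∑ a ∈ T, ∫⁻ x in gridCell h a, ∫⁻ y in gridCell h a, ‖f y - f x‖ₑ ^ 2 ≤
      volume (Metric.closedBall (0 : EuclideanSpace ℝ (Fin n)) d) * (ENNReal.ofReal d ^ 2 * D) := by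
    refine le_trans ?_ (lintegral_lintegral_sub_le volume (convex_ball c R) Metric.isOpen_ball hf d)
    calc ∑ a ∈ T, ∫⁻ x in gridCell h a, ∫⁻ y in gridCell h a, ‖f y - f x‖ₑ ^ 2
        ≤ ∑ a ∈ T, ∫⁻ x in gridCell h a, ∫⁻ y in Metric.ball c R ∩ Metric.closedBall x d,
            ‖f y - f x‖ₑ ^ 2 := Finset.sum_le_sum fun a ha =>
          setLIntegral_mono' (measurableSet_gridCell h a) fun x hx =>
            lintegral_mono_set fun y hy => ⟨hsub a ha hy, dist_le_of_mem_gridCell hh hy hx⟩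
      _ = ∫⁻ x in ⋃ a ∈ T, gridCell h a, ∫⁻ y in Metric.ball c R ∩ Metric.closedBall x d,
            ‖f y - f x‖ₑ ^ 2 :=
          (lintegral_biUnion_finset hdisj (fun a _ => measurableSet_gridCell h a) _).symm
      _ ≤ _ := lintegral_mono_set (Set.iUnion₂_subset hsub)
  -- the ball of radius `d` has volume `V (n+1)ⁿ v`, so that the factor `V⁻¹` disappears
  have hconst : 4 * V⁻¹ * (volume (Metric.closedBall (0 : EuclideanSpace ℝ (Fin n)) d) *
      (ENNReal.ofReal d ^ 2 * D)) ≤ ENNReal.ofReal δ * D := by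
    have h1 : volume (Metric.closedBall (0 : EuclideanSpace ℝ (Fin n)) d) =
        V * ENNReal.ofReal ((n + 1) ^ n * v) := by
      rw [Measure.addHaar_closedBall _ _ hd0, finrank_euclideanSpace_fin, hd, mul_pow, hVdef,
        ← ENNReal.ofReal_pow hh.le, ← ENNReal.ofReal_toReal (measure_ball_lt_top).ne, ← hv,
        ← ENNReal.ofReal_mul (by positivity), ← ENNReal.ofReal_mul (by positivity)]
      congr 1
      ring
    calc 4 * V⁻¹ * (volume (Metric.closedBall (0 : EuclideanSpace ℝ (Fin n)) d) *
          (ENNReal.ofReal d ^ 2 * D))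
        = (V⁻¹ * V) * (4 * (ENNReal.ofReal ((n + 1) ^ n * v) * ENNReal.ofReal d ^ 2)) * D := by
          rw [h1]; ring
      _ = ENNReal.ofReal (4 * ((n + 1) ^ n * v * d ^ 2)) * D := by
          rw [ENNReal.inv_mul_cancel hV0 hV1, one_mul, ← ENNReal.ofReal_pow hd0,
            ← ENNReal.ofReal_mul (by positivity), ENNReal.ofReal_mul (p := 4) (by norm_num),
            ENNReal.ofReal_ofNat]
      _ ≤ _ := by gcongr
  calc ∫⁻ y in Metric.ball c (R / 2), ‖f y‖ₑ ^ 2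
      ≤ ∫⁻ y in ⋃ a ∈ T, gridCell h a, ‖f y‖ₑ ^ 2 := lintegral_mono_set hcover
    _ = ∑ a ∈ T, ∫⁻ y in gridCell h a, ‖f y‖ₑ ^ 2 :=
        lintegral_biUnion_finset hdisj (fun a _ => measurableSet_gridCell h a) _
    _ ≤ ∑ a ∈ T, (4 * V⁻¹ * (∫⁻ x in gridCell h a, ∫⁻ y in gridCell h a, ‖f y - f x‖ₑ ^ 2) +
          4 * V⁻¹ * ‖∫ y in gridCell h a, f y‖ₑ ^ 2) := Finset.sum_le_sum fun a ha => by
        have h1 := lintegral_sq_le_mean_add_oscillation (f := f) (C := gridCell h a) (μ := volume)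
          (by rwa [volume_gridCell]) (by rwa [volume_gridCell]) (hfi.mono_set (hsub a ha))
        rwa [volume_gridCell] at h1
    _ = 4 * V⁻¹ * (∑ a ∈ T, ∫⁻ x in gridCell h a, ∫⁻ y in gridCell h a, ‖f y - f x‖ₑ ^ 2) +
          4 * V⁻¹ * ∑ a ∈ T, ‖∫ y in gridCell h a, f y‖ₑ ^ 2 := by
        rw [Finset.sum_add_distrib, Finset.mul_sum, Finset.mul_sum]
    _ ≤ _ := by
        exact add_le_add ((mul_le_mul_right hosc _).trans hconst) le_rfl

end Grid

/-! ### Poincaré and Friedrichs inequalities on the manifold -/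

section ChartBall

variable {n : ℕ} {S : Type*} [TopologicalSpace S] [ChartedSpace (EuclideanSpace ℝ (Fin n)) S]

/-- The coordinate ball of radius `r` around `p`. -/
def chartBall (p : S) (r : ℝ) : Set S :=
  (extChartAt (𝓡 n) p).source ∩ extChartAt (𝓡 n) p ⁻¹' Metric.ball (extChartAt (𝓡 n) p p) r

lemma isOpen_chartBall (p : S) (r : ℝ) : IsOpen (chartBall (n := n) p r) :=
  (continuousOn_extChartAt p).isOpen_inter_preimage (isOpen_extChartAt_source p) Metric.isOpen_ball

lemma chartBall_mem_nhds (p : S) {r : ℝ} (hr : 0 < r) : chartBall (n := n) p r ∈ 𝓝 p :=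
  (isOpen_chartBall p r).mem_nhds ⟨mem_extChartAt_source p, Metric.mem_ball_self hr⟩

lemma symm_mem_chartBall_iff {p : S} {r : ℝ} {y : EuclideanSpace ℝ (Fin n)}
    (hy : y ∈ (extChartAt (𝓡 n) p).target) :
    (extChartAt (𝓡 n) p).symm y ∈ chartBall (n := n) p r ↔
      y ∈ Metric.ball (extChartAt (𝓡 n) p p) r := by
  rw [chartBall, Set.mem_inter_iff, Set.mem_preimage, (extChartAt (𝓡 n) p).right_inv hy]
  exact and_iff_right ((extChartAt (𝓡 n) p).map_target hy)

variable [IsManifold (𝓡 n) ∞ S]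

lemma setLIntegral_chartBall [CompactSpace S] [MeasurableSpace S] [BorelSpace S] (g : RMetric n S)
    {p : S} {r : ℝ} (hr : Metric.ball (extChartAt (𝓡 n) p p) r ⊆ (extChartAt (𝓡 n) p).target)
    {F : S → ENNReal} (hF : Measurable F) :
    ∫⁻ x in chartBall (n := n) p r, F x ∂(riemannianVolume g) =
      ∫⁻ y in Metric.ball (extChartAt (𝓡 n) p p) r,
        ENNReal.ofReal (metricDensity g p y) * F ((extChartAt (𝓡 n) p).symm y) := by
  have hm := (isOpen_chartBall (n := n) p r).measurableSet
  have h1 : (riemannianVolume g).restrict (chartBall (n := n) p r) =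
      (chartVolume g p).restrict (chartBall (n := n) p r) := by
    rw [← restrict_riemannianVolume, Measure.restrict_restrict hm,
      Set.inter_eq_left.2 (show chartBall (n := n) p r ⊆ _ from Set.inter_subset_left)]
  rw [h1, ← lintegral_indicator hm, lintegral_chartVolume g p (hF.indicator hm).aemeasurable,
    ← lintegral_indicator (isOpen_target p).measurableSet,
    ← lintegral_indicator Metric.isOpen_ball.measurableSet]
  refine lintegral_congr fun y => ?_
  by_cases hy : y ∈ (extChartAt (𝓡 n) p).target
  · rw [Set.indicator_of_mem hy]
    by_cases hyb : y ∈ Metric.ball (extChartAt (𝓡 n) p p) r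
    · rw [Set.indicator_of_mem hyb, Set.indicator_of_mem ((symm_mem_chartBall_iff hy).2 hyb)]
    · rw [Set.indicator_of_notMem hyb,
        Set.indicator_of_notMem (fun h => hyb ((symm_mem_chartBall_iff hy).1 h)), mul_zero]
  · rw [Set.indicator_of_notMem hy, Set.indicator_of_notMem fun h => hy (hr h)]

/-- The quadratic form `g^{ij} Re(conj βᵢ βⱼ)` on complex-valued covectors. -/
noncomputable def covNormSq (g : RMetric n S) (p : S) (y : EuclideanSpace ℝ (Fin n))
    (β : EuclideanSpace ℝ (Fin n) →L[ℝ] ℂ) : ℝ :=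
  ∑ i, ∑ j, metricInv g p y i j * (conj (β (stdE i)) * β (stdE j)).re

lemma gradLoc_self_re (g : RMetric n S) (u : S → ℂ) (p : S) (y : EuclideanSpace ℝ (Fin n)) :
    (gradLoc g u u p y).re = covNormSq g p y (diffLoc u p y) := by
  simp only [gradLoc, covNormSq, Complex.re_sum, Complex.real_smul, Complex.re_ofReal_mul]

lemma covNormSq_pos (g : RMetric n S) {p : S} {y : EuclideanSpace ℝ (Fin n)}
    (hy : y ∈ (extChartAt (𝓡 n) p).target) {β : EuclideanSpace ℝ (Fin n) →L[ℝ] ℂ} (hβ : β ≠ 0) :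
    0 < covNormSq g p y β := by
  have hP := metricInv_posDef g hy
  set a : Fin n → ℝ := fun i => (β (stdE i)).re with ha
  set b : Fin n → ℝ := fun i => (β (stdE i)).im with hb
  have heq : covNormSq g p y β = a ⬝ᵥ (metricInv g p y *ᵥ a) + b ⬝ᵥ (metricInv g p y *ᵥ b) := by
    simp only [covNormSq, dotProduct, Matrix.mulVec, Finset.mul_sum, ← Finset.sum_add_distrib]
    refine Finset.sum_congr rfl fun i _ => Finset.sum_congr rfl fun j _ => ?_
    simp only [ha, hb, Complex.mul_re, Complex.conj_re, Complex.conj_im]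
    ring
  have hnn : ∀ c : Fin n → ℝ, 0 ≤ c ⬝ᵥ (metricInv g p y *ᵥ c) := fun c => by
    simpa using hP.posSemidef.dotProduct_mulVec_nonneg c
  have hpos : ∀ c : Fin n → ℝ, c ≠ 0 → 0 < c ⬝ᵥ (metricInv g p y *ᵥ c) := fun c hc => by
    simpa using hP.dotProduct_mulVec_pos hc
  rw [heq]
  by_cases h1 : a = 0
  · by_cases h2 : b = 0
    · refine absurd ?_ hβ
      ext1 X
      rw [← sum_smul_stdE X, map_sum]
      refine Finset.sum_eq_zero fun i _ => ?_
      rw [map_smul, show β (stdE i) = 0 from Complex.ext (congrFun h1 i) (congrFun h2 i),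
        smul_zero]
    · exact add_pos_of_nonneg_of_pos (hnn a) (hpos b h2)
  · exact add_pos_of_pos_of_nonneg (hpos a h1) (hnn b)

lemma covNormSq_smul (g : RMetric n S) (p : S) (y : EuclideanSpace ℝ (Fin n)) (r : ℝ)
    (β : EuclideanSpace ℝ (Fin n) →L[ℝ] ℂ) :
    covNormSq g p y (r • β) = r ^ 2 * covNormSq g p y β := by
  simp only [covNormSq, smul_apply, Finset.mul_sum, Complex.real_smul, map_mul, Complex.conj_ofReal]
  refine Finset.sum_congr rfl fun i _ => Finset.sum_congr rfl fun j _ => ?_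
  have : (r : ℂ) * conj (β (stdE i)) * ((r : ℂ) * β (stdE j)) =
      ((r ^ 2 : ℝ) : ℂ) * (conj (β (stdE i)) * β (stdE j)) := by push_cast; ring
  rw [this, Complex.re_ofReal_mul]
  ring

/-- Uniform comparison of the metric with the Euclidean one on compact sets. -/
lemma exists_metric_bounds (g : RMetric n S) {p : S} {K : Set (EuclideanSpace ℝ (Fin n))}
    (hK : IsCompact K) (hKt : K ⊆ (extChartAt (𝓡 n) p).target) :
    ∃ M m : ℝ, 0 < M ∧ 0 < m ∧ ∀ y ∈ K, metricDensity g p y ≤ M ∧ m ≤ metricDensity g p y ∧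
      ∀ β, m * ‖β‖ ^ 2 ≤ metricDensity g p y * covNormSq g p y β := by
  have hdens := (contDiffOn_metricDensity g p).continuousOn.mono hKt
  obtain ⟨M, hM⟩ := (hK.image_of_continuousOn hdens).bddAbove
  obtain ⟨m₁, hm₁, h₁⟩ := hK.exists_forall_le' hdens
    (fun y hy => metricDensity_pos g (hKt hy))
  have hcont : ContinuousOn (fun z : EuclideanSpace ℝ (Fin n) × (EuclideanSpace ℝ (Fin n) →L[ℝ] ℂ) =>
      metricDensity g p z.1 * covNormSq g p z.1 z.2) (K ×ˢ Metric.sphere 0 1) := by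
    refine (hdens.comp continuousOn_fst fun z hz => hz.1).mul
      (continuousOn_finsetSum _ fun i _ => continuousOn_finsetSum _ fun j _ => ?_)
    refine (((contDiffOn_metricInv g p i j).continuousOn.mono hKt).comp continuousOn_fst
      fun z hz => hz.1).mul (Continuous.continuousOn ?_)
    fun_prop
  obtain ⟨m₂, hm₂, h₂⟩ := (hK.prod (isCompact_sphere _ _)).exists_forall_le' hcont
    (a := 0) (fun z hz => mul_pos (metricDensity_pos g (hKt hz.1))
      (covNormSq_pos g (hKt hz.1) (by
        rintro h
        have := hz.2
        rw [h] at this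
        simp at this)))
  refine ⟨max M 1, min m₁ m₂, by positivity, lt_min hm₁ hm₂, fun y hy => ⟨(hM ⟨y, hy, rfl⟩).trans
    (le_max_left _ _), (min_le_left _ _).trans (h₁ y hy), fun β => ?_⟩⟩
  by_cases hβ : β = 0
  · simp [hβ, covNormSq]
  · have hβ' : 0 < ‖β‖ := norm_pos_iff.2 hβ
    have h3 := h₂ (y, ‖β‖⁻¹ • β) ⟨hy, by simp [norm_smul, hβ'.ne']⟩
    have h4 : β = ‖β‖ • (‖β‖⁻¹ • β) := by rw [smul_smul, mul_inv_cancel₀ hβ'.ne', one_smul]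
    calc min m₁ m₂ * ‖β‖ ^ 2 ≤ m₂ * ‖β‖ ^ 2 := by gcongr; exact min_le_right _ _
      _ ≤ (metricDensity g p y * covNormSq g p y (‖β‖⁻¹ • β)) * ‖β‖ ^ 2 := by gcongr
      _ = metricDensity g p y * covNormSq g p y (‖β‖ • (‖β‖⁻¹ • β)) := by
        rw [covNormSq_smul g p y ‖β‖]; ring
      _ = _ := by rw [← h4]

end ChartBall

section Local

variable {n : ℕ} {S : Type*} [TopologicalSpace S] [ChartedSpace (EuclideanSpace ℝ (Fin n)) S]
  [IsManifold (𝓡 n) ∞ S] [CompactSpace S] [MeasurableSpace S] [BorelSpace S]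

/-- The Dirichlet integral `∫ |du|²`, with values in `[0, ∞]`. -/
noncomputable def dirichletE (g : RMetric n S) (u : S → ℂ) : ENNReal :=
  ∫⁻ x, ENNReal.ofReal (gradNormSq g u x) ∂(riemannianVolume g)

/-- In a small coordinate ball, Lebesgue measure is comparable with the Riemannian volume, and the
Euclidean Dirichlet integral is controlled by the Riemannian one. -/
lemma exists_chart_comparison (g : RMetric n S) (p : S) : ∃ R : ℝ, 0 < R ∧ ∃ C : ENNReal, C ≠ ⊤ ∧
    Metric.closedBall (extChartAt (𝓡 n) p p) R ⊆ (extChartAt (𝓡 n) p).target ∧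
    (∀ r ≤ R, ∀ F : S → ENNReal, Measurable F →
      ∫⁻ x in chartBall (n := n) p r, F x ∂(riemannianVolume g) ≤
        C * ∫⁻ y in Metric.ball (extChartAt (𝓡 n) p p) r, F ((extChartAt (𝓡 n) p).symm y)) ∧
    (∀ F : S → ENNReal, Measurable F →
      ∫⁻ y in Metric.ball (extChartAt (𝓡 n) p p) R, F ((extChartAt (𝓡 n) p).symm y) ≤
        C * ∫⁻ x, F x ∂(riemannianVolume g)) ∧
    ∀ u : S → ℂ, ContMDiff (𝓡 n) 𝓘(ℝ, ℂ) ∞ u →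
      ∫⁻ y in Metric.ball (extChartAt (𝓡 n) p p) R, ‖diffLoc u p y‖ₑ ^ 2 ≤
        C * dirichletE g u := by
  obtain ⟨R, hR, hball⟩ := Metric.nhds_basis_closedBall.mem_iff.1
    (extChartAt_target_mem_nhds (I := 𝓡 n) p)
  obtain ⟨M, m, hM, hm, hb⟩ := exists_metric_bounds g
    (isCompact_closedBall (extChartAt (𝓡 n) p p) R) hball
  have hmul : ENNReal.ofReal m⁻¹ * ENNReal.ofReal m = 1 := by
    rw [← ENNReal.ofReal_mul (by positivity), inv_mul_cancel₀ hm.ne', ENNReal.ofReal_one]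
  -- integrating a lower bound for the density
  have hlow : ∀ (f : EuclideanSpace ℝ (Fin n) → ENNReal) (F : S → ENNReal), Measurable F →
      (∀ y ∈ Metric.ball (extChartAt (𝓡 n) p p) R, ENNReal.ofReal m * f y ≤
        ENNReal.ofReal (metricDensity g p y) * F ((extChartAt (𝓡 n) p).symm y)) →
      ∫⁻ y in Metric.ball (extChartAt (𝓡 n) p p) R, f y ≤
        ENNReal.ofReal m⁻¹ * ∫⁻ x, F x ∂(riemannianVolume g) := fun f F hF h => by
    calc ∫⁻ y in Metric.ball (extChartAt (𝓡 n) p p) R, f y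
        = ENNReal.ofReal m⁻¹ * (ENNReal.ofReal m *
            ∫⁻ y in Metric.ball (extChartAt (𝓡 n) p p) R, f y) := by
          rw [← mul_assoc, hmul, one_mul]
      _ = ENNReal.ofReal m⁻¹ *
            ∫⁻ y in Metric.ball (extChartAt (𝓡 n) p p) R, ENNReal.ofReal m * f y := by
          rw [lintegral_const_mul' _ _ ENNReal.ofReal_ne_top]
      _ ≤ ENNReal.ofReal m⁻¹ * ∫⁻ x in chartBall (n := n) p R, F x ∂(riemannianVolume g) := by
          rw [setLIntegral_chartBall g (Metric.ball_subset_closedBall.trans hball) hF]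
          exact mul_le_mul' le_rfl (setLIntegral_mono' Metric.isOpen_ball.measurableSet h)
      _ ≤ _ := mul_le_mul' le_rfl (setLIntegral_le_lintegral _ _)
  refine ⟨R, hR, ENNReal.ofReal M + ENNReal.ofReal m⁻¹, by simp, hball, fun r hr F hF => ?_,
    fun F hF => ?_, fun u hu => ?_⟩
  · have hsub : Metric.ball (extChartAt (𝓡 n) p p) r ⊆
        Metric.closedBall (extChartAt (𝓡 n) p p) R :=
      (Metric.ball_subset_ball hr).trans Metric.ball_subset_closedBall
    rw [setLIntegral_chartBall g (hsub.trans hball) hF, ← lintegral_const_mul' _ _ (by simp)]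
    refine setLIntegral_mono' Metric.isOpen_ball.measurableSet fun y hy => ?_
    gcongr
    exact (ENNReal.ofReal_le_ofReal (hb y (hsub hy)).1).trans le_self_add
  · refine (hlow _ F hF fun y hy => ?_).trans (mul_le_mul' le_add_self le_rfl)
    gcongr
    exact (hb y (Metric.ball_subset_closedBall hy)).2.1
  · refine (hlow _ _ (continuous_gradNormSq g hu).measurable.ennreal_ofReal fun y hy => ?_).trans
      (mul_le_mul' le_add_self le_rfl)
    have hyt := hball (Metric.ball_subset_closedBall hy)
    rw [gradNormSq_eq_re, gradPair_eq g hu hu ((extChartAt (𝓡 n) p).map_target hyt),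
      (extChartAt (𝓡 n) p).right_inv hyt, gradLoc_self_re, ← ofReal_norm,
      ← ENNReal.ofReal_pow (norm_nonneg _), ← ENNReal.ofReal_mul hm.le,
      ← ENNReal.ofReal_mul (metricDensity_pos g hyt).le]
    exact ENNReal.ofReal_le_ofReal ((hb y (Metric.ball_subset_closedBall hy)).2.2 _)

/-- A local Poincaré inequality. -/
lemma exists_poincare_nhds (g : RMetric n S) (p : S) : ∃ U : Set S, IsOpen U ∧ p ∈ U ∧
    ∃ C : ENNReal, C ≠ ⊤ ∧ ∀ u : S → ℂ, ContMDiff (𝓡 n) 𝓘(ℝ, ℂ) ∞ u →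
      ∫⁻ x in U, ∫⁻ y in U, ‖u y - u x‖ₑ ^ 2 ∂(riemannianVolume g) ∂(riemannianVolume g) ≤
        C * dirichletE g u := by
  obtain ⟨R, hR, C, hC, hball, h1, -, h3⟩ := exists_chart_comparison g p
  set c := extChartAt (𝓡 n) p p with hc
  have hsub : Metric.ball c R ⊆ (extChartAt (𝓡 n) p).target :=
    Metric.ball_subset_closedBall.trans hball
  refine ⟨chartBall (n := n) p R, isOpen_chartBall p R,
    mem_of_mem_nhds (chartBall_mem_nhds (n := n) p hR),
    C * (C * (volume (Metric.closedBall (0 : EuclideanSpace ℝ (Fin n)) (2 * R)) *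
      (ENNReal.ofReal (2 * R) ^ 2 * C))), ?_, fun u hu => ?_⟩
  · have : volume (Metric.closedBall (0 : EuclideanSpace ℝ (Fin n)) (2 * R)) ≠ ⊤ :=
      measure_closedBall_lt_top.ne
    finiteness
  · classical
    -- the function in the chart, extended by zero to make it measurable
    let w : EuclideanSpace ℝ (Fin n) → ℂ :=
      (Metric.ball c R).piecewise (fun y => u ((extChartAt (𝓡 n) p).symm y)) 0
    have hw : Measurable w := (((contDiffOn_comp_symm hu p).continuousOn).mono
      hsub).measurable_piecewise continuousOn_const Metric.isOpen_ball.measurableSet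
    have hww : ∀ z : ℂ, ∫⁻ y in Metric.ball c R, ‖u ((extChartAt (𝓡 n) p).symm y) - z‖ₑ ^ 2 =
        ∫⁻ y in Metric.ball c R, ‖w y - z‖ₑ ^ 2 := fun z =>
      setLIntegral_congr_fun Metric.isOpen_ball.measurableSet fun y hy => by
        simp only [w, Set.piecewise_eq_of_mem _ _ _ hy]
    have hmu := hu.continuous.measurable
    have hK : Measurable fun x => ∫⁻ y in Metric.ball c R, ‖w y - u x‖ₑ ^ 2 :=
      (((hw.comp measurable_snd).sub (hmu.comp measurable_fst)).enorm.pow_const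
        2).lintegral_prod_right'
    have hB := lintegral_lintegral_sub_le volume (convex_ball c R) Metric.isOpen_ball
      (((contDiffOn_comp_symm hu p).mono hsub).of_le (m := 1) (by simp)) (2 * R)
    calc ∫⁻ x in chartBall (n := n) p R, ∫⁻ y in chartBall (n := n) p R, ‖u y - u x‖ₑ ^ 2
          ∂(riemannianVolume g) ∂(riemannianVolume g)
        ≤ ∫⁻ x in chartBall (n := n) p R, C * (∫⁻ y in Metric.ball c R, ‖w y - u x‖ₑ ^ 2)
            ∂(riemannianVolume g) := lintegral_mono fun x => by
          rw [← hww]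
          exact h1 R le_rfl _ ((hmu.sub_const _).enorm.pow_const 2)
      _ ≤ C * ∫⁻ x in Metric.ball c R, C * (∫⁻ y in Metric.ball c R,
            ‖u ((extChartAt (𝓡 n) p).symm y) - u ((extChartAt (𝓡 n) p).symm x)‖ₑ ^ 2) := by
          simp only [hww]
          exact h1 R le_rfl _ (hK.const_mul C)
      -- two points of the ball have distance less than `2R`
      _ ≤ C * (C * ∫⁻ x in Metric.ball c R, ∫⁻ y in Metric.ball c R ∩ Metric.closedBall x (2 * R),
            ‖u ((extChartAt (𝓡 n) p).symm y) - u ((extChartAt (𝓡 n) p).symm x)‖ₑ ^ 2) := by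
          rw [lintegral_const_mul' _ _ hC]
          refine mul_le_mul' le_rfl (mul_le_mul' le_rfl
            (setLIntegral_mono' Metric.isOpen_ball.measurableSet fun x hx =>
              lintegral_mono_set fun y hy => ⟨hy, ?_⟩))
          have h := dist_triangle_right y x c
          rw [Metric.mem_ball] at hx hy
          rw [Metric.mem_closedBall]
          linarith
      _ ≤ C * (C * (volume (Metric.closedBall (0 : EuclideanSpace ℝ (Fin n)) (2 * R)) *
            (ENNReal.ofReal (2 * R) ^ 2 * (C * dirichletE g u)))) := by
          refine mul_le_mul' le_rfl (mul_le_mul' le_rfl (hB.trans ?_))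
          exact mul_le_mul' le_rfl (mul_le_mul' le_rfl (h3 u hu))
      _ = _ := by ring

end Local

/-! ### The variational principle -/

section Variational

universe w

variable {V : Type*} [AddCommGroup V] [Module ℂ V]

/-- The Cauchy–Schwarz inequality for a positive semidefinite Hermitian form. -/
lemma norm_sq_le_of_posSemidef {Q : V →ₗ⋆[ℂ] V →ₗ[ℂ] ℂ} (hsymm : ∀ u v, conj (Q u v) = Q v u)
    (hnn : ∀ u, 0 ≤ (Q u u).re) (u v : V) : ‖Q u v‖ ^ 2 ≤ (Q u u).re * (Q v v).re := by
  let core : PreInnerProductSpace.Core ℂ V :=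
    { inner := fun x y => Q x y
      conj_inner_symm := fun x y => hsymm y x
      re_inner_nonneg := hnn
      add_left := fun x y z => by
        change Q (x + y) z = Q x z + Q y z
        rw [map_add, LinearMap.add_apply]
      smul_left := fun x y r => by
        change Q (r • x) y = conj r * Q x y
        rw [LinearMap.map_smulₛₗ, LinearMap.smul_apply, smul_eq_mul] }
  have h := InnerProductSpace.Core.inner_mul_inner_self_le (c := core) u v
  have h2 : ‖Q v u‖ = ‖Q u v‖ := by rw [← hsymm u v, RCLike.norm_conj]
  change ‖Q u v‖ * ‖Q v u‖ ≤ (Q u u).re * (Q v v).re at h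
  rwa [h2, ← sq] at h

lemma form_sub_le {Q : V →ₗ⋆[ℂ] V →ₗ[ℂ] ℂ} (hnn : ∀ u, 0 ≤ (Q u u).re) (u v : V) :
    (Q (u - v) (u - v)).re ≤ 2 * (Q u u).re + 2 * (Q v v).re := by
  have h := hnn (u + v)
  simp only [map_add, map_sub, LinearMap.add_apply, LinearMap.sub_apply, Complex.add_re,
    Complex.sub_re] at h ⊢
  linarith

variable {H : Type*} [NormedAddCommGroup H] [InnerProductSpace ℂ H]

/-- Friedrichs' inequality gives compactness: from a sequence with bounded energy and bounded norm
one extracts a Cauchy sequence, by making the countably many functionals converge. -/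
lemma exists_cauchySeq_of_friedrichs {Q : V →ₗ⋆[ℂ] V →ₗ[ℂ] ℂ} (hnn : ∀ u, 0 ≤ (Q u u).re)
    (j : V →ₗ[ℂ] H)
    (hF : ∀ ε : ℝ, 0 < ε → ∃ (J : Type w) (_ : Fintype J) (w : J → ℝ) (ℓ : J → V →ₗ[ℂ] ℂ)
      (K : J → ℝ), (∀ i u, ‖ℓ i u‖ ≤ K i * ‖j u‖) ∧
      ∀ u, ‖j u‖ ^ 2 ≤ ε * (Q u u).re + ∑ i, w i * ‖ℓ i u‖ ^ 2)
    {u : ℕ → V} (hu : ∀ k, ‖j (u k)‖ = 1) {C : ℝ} (hC : ∀ k, (Q (u k) (u k)).re ≤ C) :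
    ∃ θ : ℕ → ℕ, StrictMono θ ∧ CauchySeq fun k => j (u (θ k)) := by
  choose J hJ w ℓ K hK hfr using fun m : ℕ => hF (1 / ((m : ℝ) + 1)) (by positivity)
  -- the values of all functionals range in a product of discs, which is sequentially compact
  let x : ℕ → (Σ m, J m) → ℂ := fun k a => ℓ a.1 a.2 (u k)
  obtain ⟨a, -, θ, hθ, hlim⟩ := (isCompact_univ_pi fun b : Σ m, J m =>
    isCompact_closedBall (0 : ℂ) (K b.1 b.2)).tendsto_subseq (x := x) (fun k b _ => by
      have h := hK b.1 b.2 (u k)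
      rw [hu, mul_one] at h
      simpa [x] using h)
  rw [tendsto_pi_nhds] at hlim
  refine ⟨θ, hθ, cauchySeq_iff_tendsto_dist_atTop_0.2 ?_⟩
  have hC0 : 0 ≤ C := (hnn (u 0)).trans (hC 0)
  -- Friedrichs' inequality for the difference of two members of the sequence
  have hle : ∀ (m : ℕ) (kl : ℕ × ℕ), dist (j (u (θ kl.1))) (j (u (θ kl.2))) ^ 2 ≤
      1 / ((m : ℝ) + 1) * (4 * C) +
        ∑ i, w m i * ‖ℓ m i (u (θ kl.1)) - ℓ m i (u (θ kl.2))‖ ^ 2 := fun m kl => by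
    have h1 := hfr m (u (θ kl.1) - u (θ kl.2))
    rw [map_sub] at h1
    simp only [map_sub (ℓ m _)] at h1
    rw [dist_eq_norm]
    refine h1.trans (add_le_add (mul_le_mul_of_nonneg_left ?_ (by positivity)) le_rfl)
    have := form_sub_le hnn (u (θ kl.1)) (u (θ kl.2))
    linarith [hC (θ kl.1), hC (θ kl.2)]
  have hsum : ∀ m, Tendsto (fun kl : ℕ × ℕ =>
      ∑ i, w m i * ‖ℓ m i (u (θ kl.1)) - ℓ m i (u (θ kl.2))‖ ^ 2) atTop (𝓝 0) := fun m => by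
    have h1 : ∀ i, Tendsto (fun kl : ℕ × ℕ => w m i *
        ‖ℓ m i (u (θ kl.1)) - ℓ m i (u (θ kl.2))‖ ^ 2) atTop (𝓝 0) := fun i => by
      have h2 := hlim ⟨m, i⟩
      have h3 := ((h2.comp (tendsto_fst (f := atTop) (g := atTop))).sub
        (h2.comp (tendsto_snd (f := atTop) (g := atTop)))).norm
      rw [sub_self, norm_zero, prod_atTop_atTop_eq] at h3
      simpa [x] using (h3.pow 2).const_mul (w m i)
    simpa using tendsto_finsetSum Finset.univ fun i _ => h1 i
  have hsq : Tendsto (fun kl : ℕ × ℕ => dist (j (u (θ kl.1))) (j (u (θ kl.2))) ^ 2) atTop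
      (𝓝 0) := by
    refine tendsto_order.2 ⟨fun b hb => Eventually.of_forall fun kl => hb.trans_le (sq_nonneg _),
      fun b hb => ?_⟩
    obtain ⟨m, hm⟩ := ((tendsto_one_div_add_atTop_nhds_zero_nat (𝕜 := ℝ)).mul_const
      (4 * C)).eventually (gt_mem_nhds (show 0 * (4 * C) < b by simpa using hb)) |>.exists
    have h1 := (hsum m).const_add (1 / ((m : ℝ) + 1) * (4 * C))
    rw [add_zero] at h1
    filter_upwards [h1.eventually (gt_mem_nhds hm)] with kl hkl using (hle m kl).trans_lt hkl
  have h := hsq.sqrt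
  simpa [Real.sqrt_sq dist_nonneg] using h

/-- Existence of a minimizer of the energy on the unit sphere. The weak Euler–Lagrange equation is
Cauchy–Schwarz for the form `Q - μ₀ ⟨·,·⟩`, and convergence in energy is the parallelogram law. -/
lemma exists_minimizer [CompleteSpace H] {Q : V →ₗ⋆[ℂ] V →ₗ[ℂ] ℂ}
    (hsymm : ∀ u v, conj (Q u v) = Q v u) (hnn : ∀ u, 0 ≤ (Q u u).re) (j : V →ₗ[ℂ] H)
    (hF : ∀ ε : ℝ, 0 < ε → ∃ (J : Type w) (_ : Fintype J) (w : J → ℝ) (ℓ : J → V →ₗ[ℂ] ℂ)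
      (K : J → ℝ), (∀ i u, ‖ℓ i u‖ ≤ K i * ‖j u‖) ∧
      ∀ u, ‖j u‖ ^ 2 ≤ ε * (Q u u).re + ∑ i, w i * ‖ℓ i u‖ ^ 2)
    (hne : ∃ u, j u ≠ 0) :
    ∃ (μ₀ : ℝ) (v : H) (u : ℕ → V), ‖v‖ = 1 ∧ (∀ w, μ₀ * ‖j w‖ ^ 2 ≤ (Q w w).re) ∧
      Tendsto (fun k => j (u k)) atTop (𝓝 v) ∧
      Tendsto (fun kl : ℕ × ℕ => (Q (u kl.1 - u kl.2) (u kl.1 - u kl.2)).re) atTop (𝓝 0) ∧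
      Tendsto (fun k => (Q (u k) (u k)).re) atTop (𝓝 μ₀) ∧
      ∀ φ, Tendsto (fun k => Q φ (u k)) atTop (𝓝 (μ₀ * inner ℂ (j φ) v)) := by
  have hscale : ∀ (c : ℂ) w, (Q (c • w) (c • w)).re = ‖c‖ ^ 2 * (Q w w).re := fun c w => by
    rw [(Q (c • w)).map_smul, LinearMap.map_smulₛₗ Q, LinearMap.smul_apply, smul_eq_mul,
      smul_eq_mul, ← mul_assoc, Complex.mul_conj', ← Complex.ofReal_pow, Complex.re_ofReal_mul]
  set A : Set ℝ := (fun w => (Q w w).re) '' {w | ‖j w‖ = 1} with hA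
  have hnorm : ∀ w, j w ≠ 0 → ‖j (((‖j w‖⁻¹ : ℝ) : ℂ) • w)‖ = 1 := fun w hw => by
    rw [map_smul, norm_smul, Complex.norm_real, norm_inv, norm_norm,
      inv_mul_cancel₀ (norm_ne_zero_iff.2 hw)]
  have hAne : A.Nonempty := by
    obtain ⟨w, hw⟩ := hne
    exact ⟨_, _, hnorm w hw, rfl⟩
  have hAbdd : BddBelow A := ⟨0, by rintro _ ⟨w, -, rfl⟩; exact hnn w⟩
  set μ₀ := sInf A with hμ₀
  have hmin : ∀ w, μ₀ * ‖j w‖ ^ 2 ≤ (Q w w).re := fun w => by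
    by_cases hw : j w = 0
    · rw [hw, norm_zero]; simpa using hnn w
    · have h1 : μ₀ ≤ _ := csInf_le hAbdd ⟨_, hnorm w hw, rfl⟩
      beta_reduce at h1
      rw [hscale, Complex.norm_real, norm_inv, norm_norm] at h1
      have h2 : 0 < ‖j w‖ := norm_pos_iff.2 hw
      rw [inv_pow, inv_mul_eq_div, le_div_iff₀ (by positivity)] at h1
      exact h1
  obtain ⟨s, -, hs, hsA⟩ := exists_seq_tendsto_sInf hAne hAbdd
  choose w hw hws using hsA
  replace hw : ∀ k, ‖j (w k)‖ = 1 := hw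
  have hQw : Tendsto (fun k => (Q (w k) (w k)).re) atTop (𝓝 μ₀) := by simpa only [hws] using hs
  obtain ⟨C, hC⟩ := hQw.bddAbove_range
  obtain ⟨θ, hθ, hcau⟩ := exists_cauchySeq_of_friedrichs hnn j hF hw (C := C)
    fun k => hC ⟨k, rfl⟩
  obtain ⟨v, hv⟩ := cauchySeq_tendsto_of_complete hcau
  have hQu : Tendsto (fun k => (Q (w (θ k)) (w (θ k))).re) atTop (𝓝 μ₀) :=
    hQw.comp hθ.tendsto_atTop
  -- the form `q = Q - μ₀ ⟨·,·⟩`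
  let q : V →ₗ⋆[ℂ] V →ₗ[ℂ] ℂ := Q - (μ₀ : ℂ) • LinearMap.mk₂'ₛₗ (starRingEnd ℂ) (RingHom.id ℂ)
    (fun x y => inner ℂ (j x) (j y))
    (fun x y z => by rw [map_add, inner_add_left])
    (fun c x z => by rw [map_smul, inner_smul_left, smul_eq_mul])
    (fun x y z => by rw [map_add, inner_add_right])
    (fun c x z => by rw [map_smul, inner_smul_right]; rfl)
  have hq : ∀ x y, q x y = Q x y - μ₀ * inner ℂ (j x) (j y) := fun x y => rfl
  have hqre : ∀ x, (q x x).re = (Q x x).re - μ₀ * ‖j x‖ ^ 2 := fun x => by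
    rw [hq, Complex.sub_re, Complex.re_ofReal_mul, inner_self_eq_norm_sq_to_K]
    norm_cast
  have hqs : ∀ x y, conj (q x y) = q y x := fun x y => by
    rw [hq, hq, map_sub, map_mul, Complex.conj_ofReal, inner_conj_symm, hsymm]
  have hqn : ∀ x, 0 ≤ (q x x).re := fun x => by rw [hqre]; linarith [hmin x]
  have hqu : Tendsto (fun k => (q (w (θ k)) (w (θ k))).re) atTop (𝓝 0) := by
    simp only [hqre, hw]
    have h := hQu.sub_const (μ₀ * 1 ^ 2)
    rwa [show μ₀ - μ₀ * 1 ^ 2 = 0 by ring] at h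
  refine ⟨μ₀, v, fun k => w (θ k), ?_, hmin, hv, ?_, hQu, fun φ => ?_⟩
  · have h1 := hv.norm
    simp only [hw] at h1
    exact (tendsto_nhds_unique tendsto_const_nhds h1).symm
  · have h1 : Tendsto (fun kl : ℕ × ℕ =>
        2 * (q (w (θ kl.1)) (w (θ kl.1))).re + 2 * (q (w (θ kl.2)) (w (θ kl.2))).re +
          |μ₀| * dist (j (w (θ kl.1))) (j (w (θ kl.2))) ^ 2) atTop (𝓝 0) := by
      have h2 := (cauchySeq_iff_tendsto_dist_atTop_0.1 hcau).pow 2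
      have h3 := ((hqu.comp (tendsto_fst (f := atTop) (g := atTop))).const_mul 2).add
        ((hqu.comp (tendsto_snd (f := atTop) (g := atTop))).const_mul 2)
      rw [prod_atTop_atTop_eq] at h3
      simpa using h3.add (h2.const_mul |μ₀|)
    refine squeeze_zero (fun kl => hnn _) (fun kl => ?_) h1
    have h2 := form_sub_le hqn (w (θ kl.1)) (w (θ kl.2))
    have h3 := hqre (w (θ kl.1) - w (θ kl.2))
    rw [map_sub j, ← dist_eq_norm] at h3
    have h4 := mul_le_mul_of_nonneg_right (le_abs_self μ₀)
      (sq_nonneg (dist (j (w (θ kl.1))) (j (w (θ kl.2)))))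
    linarith
  · have h1 : Tendsto (fun k => q φ (w (θ k))) atTop (𝓝 0) := by
      rw [tendsto_zero_iff_norm_tendsto_zero]
      have h2 : Tendsto (fun k => Real.sqrt ((q φ φ).re * (q (w (θ k)) (w (θ k))).re)) atTop
          (𝓝 0) := by
        simpa using (hqu.const_mul (q φ φ).re).sqrt
      exact squeeze_zero (fun k => norm_nonneg _)
        (fun k => Real.le_sqrt_of_sq_le (norm_sq_le_of_posSemidef hqs hqn _ _)) h2
    have h2 : Tendsto (fun k => (μ₀ : ℂ) * inner ℂ (j φ) (j (w (θ k)))) atTop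
        (𝓝 (μ₀ * inner ℂ (j φ) v)) := (tendsto_const_nhds.inner hv).const_mul _
    simpa [hq] using h1.add h2

/-- A weak eigenvalue is at least the lower bound of the energy: test the equation with the
approximating sequence. -/
lemma le_of_weak_eigenvector {Q : V →ₗ⋆[ℂ] V →ₗ[ℂ] ℂ}
    (hsymm : ∀ u v, conj (Q u v) = Q v u) (hnn : ∀ u, 0 ≤ (Q u u).re) (j : V →ₗ[ℂ] H) {L : V → H}
    (hL : ∀ φ w, inner ℂ (L φ) (j w) = Q φ w) {μ₀ μ : ℝ} (hmin : ∀ w, μ₀ * ‖j w‖ ^ 2 ≤ (Q w w).re)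
    {v : H} (hv : v ≠ 0) {u : ℕ → V} (hu : Tendsto (fun k => j (u k)) atTop (𝓝 v))
    (hQ : Tendsto (fun kl : ℕ × ℕ => (Q (u kl.1 - u kl.2) (u kl.1 - u kl.2)).re) atTop (𝓝 0))
    (hweak : ∀ φ, inner ℂ (L φ) v = μ * inner ℂ (j φ) v) : μ₀ ≤ μ := by
  obtain ⟨N₁, hN₁⟩ := (hQ.eventually (gt_mem_nhds one_pos)).exists_forall_of_atTop
  set B := 2 * 1 + 2 * (Q (u N₁.1) (u N₁.1)).re with hB
  -- the energies are bounded
  have hbound : ∀ᶠ k in atTop, (Q (u k) (u k)).re ≤ B + 2 * (Q (u N₁.2) (u N₁.2)).re := by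
    filter_upwards [eventually_ge_atTop N₁.1] with k hk
    have h1 := hN₁ (k, N₁.2) ⟨hk, le_rfl⟩
    have h2 := form_sub_le hnn (u k - u N₁.2) (-u N₁.2)
    have h3 : (Q (-u N₁.2) (-u N₁.2)).re = (Q (u N₁.2) (u N₁.2)).re := by simp
    rw [sub_neg_eq_add, sub_add_cancel, h3] at h2
    simp only at h1
    linarith [hnn (u N₁.1)]
  set B' := B + 2 * (Q (u N₁.2) (u N₁.2)).re with hB'
  have hB0 : 0 ≤ B' := by
    have := hnn (u N₁.1)
    have := hnn (u N₁.2)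
    simp only [hB', hB]
    linarith
  -- `μ ⟨u k, v⟩` is the limit of `Q (u k) (u l)` as `l → ∞`, which is close to `Q (u k) (u k)` by
  -- Cauchy–Schwarz for `Q`
  have hlim : Tendsto (fun k => Q (u k) (u k) - μ * inner ℂ (j (u k)) v) atTop (𝓝 0) := by
    rw [Metric.tendsto_atTop']
    intro ε hε
    have hev : ∀ᶠ kl : ℕ × ℕ in atTop,
        B' * (Q (u kl.1 - u kl.2) (u kl.1 - u kl.2)).re < (ε / 2) ^ 2 :=
      (hQ.const_mul B').eventually (gt_mem_nhds (by rw [mul_zero]; positivity))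
    obtain ⟨N₂, hN₂⟩ := hev.exists_forall_of_atTop
    obtain ⟨N₃, hN₃⟩ := hbound.exists_forall_of_atTop
    refine ⟨max N₂.1 N₃, fun k hk => ?_⟩
    rw [dist_zero_right]
    have hk2 : N₂.1 ≤ k := (le_max_left _ _).trans hk.le
    have hk3 : N₃ ≤ k := (le_max_right _ _).trans hk.le
    have h1 : Tendsto (fun l => ‖Q (u k) (u k) - Q (u k) (u l)‖) atTop
        (𝓝 ‖Q (u k) (u k) - μ * inner ℂ (j (u k)) v‖) := by
      refine (tendsto_const_nhds.sub ?_).norm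
      rw [← hweak]
      simp only [← hL]
      exact tendsto_const_nhds.inner hu
    refine (le_of_tendsto h1 ?_).trans_lt (half_lt_self hε)
    filter_upwards [eventually_ge_atTop N₂.2] with l hl
    have h2 := hN₂ (k, l) ⟨hk2, hl⟩
    rw [← map_sub]
    refine abs_le_of_sq_le_sq' ?_ (by positivity) |>.2
    calc ‖Q (u k) (u k - u l)‖ ^ 2 ≤ (Q (u k) (u k)).re * (Q (u k - u l) (u k - u l)).re :=
          norm_sq_le_of_posSemidef hsymm hnn _ _
      _ ≤ B' * (Q (u k - u l) (u k - u l)).re :=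
          mul_le_mul_of_nonneg_right (hN₃ k hk3) (hnn _)
      _ ≤ _ := h2.le
  -- hence the energies converge to `μ ‖v‖²`
  have h1 : Tendsto (fun k => (Q (u k) (u k)).re) atTop (𝓝 (μ * ‖v‖ ^ 2)) := by
    have h2 : Tendsto (fun k => (μ : ℂ) * inner ℂ (j (u k)) v) atTop (𝓝 (μ * inner ℂ v v)) :=
      (hu.inner tendsto_const_nhds).const_mul _
    have h3 := (Complex.continuous_re.tendsto _).comp (hlim.add h2)
    have h4 : (0 + (μ : ℂ) * inner ℂ v v).re = μ * ‖v‖ ^ 2 := by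
      rw [zero_add, Complex.re_ofReal_mul, inner_self_eq_norm_sq_to_K]
      norm_cast
    rw [h4] at h3
    simpa [Function.comp_def] using h3
  have h2 : μ₀ * ‖v‖ ^ 2 ≤ μ * ‖v‖ ^ 2 :=
    le_of_tendsto_of_tendsto' ((hu.norm.pow 2).const_mul μ₀) h1 fun k => hmin (u k)
  exact le_of_mul_le_mul_right h2 (by have := norm_pos_iff.2 hv; positivity)

end Variational

/-! ### The energy form on smooth functions -/

section Energy

lemma enorm_toLp_sq {α : Type*} [MeasurableSpace α] {μ : Measure α} {f : α → ℂ}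
    (hf : MemLp f 2 μ) : ‖hf.toLp f‖ₑ ^ 2 = ∫⁻ x, ‖f x‖ₑ ^ 2 ∂μ := by
  rw [Lp.enorm_toLp]
  have h := eLpNorm_nnreal_pow_eq_lintegral (f := f) (μ := μ) (p := 2) two_ne_zero
  simpa using h

lemma integral_norm_sq_eq {α : Type*} [MeasurableSpace α] {μ : Measure α} {f : α → ℂ}
    (hf : MemLp f 2 μ) : ∫ x, ‖f x‖ ^ 2 ∂μ = ‖hf.toLp f‖ ^ 2 := by
  have h1 := enorm_toLp_sq hf
  rw [integral_eq_lintegral_of_nonneg_ae (Eventually.of_forall fun x => sq_nonneg _)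
    (hf.aestronglyMeasurable.norm.pow 2)]
  have h2 : ∀ x, ENNReal.ofReal (‖f x‖ ^ 2) = ‖f x‖ₑ ^ 2 := fun x => by
    rw [ENNReal.ofReal_pow (norm_nonneg _), ofReal_norm]
  simp only [h2, ← h1, ENNReal.toReal_pow, toReal_enorm]

lemma inner_toLp_toLp {α : Type*} [MeasurableSpace α] {μ : Measure α} {f h : α → ℂ}
    (hf : MemLp f 2 μ) (hh : MemLp h 2 μ) :
    inner ℂ (hf.toLp f) (hh.toLp h) = ∫ x, conj (f x) * h x ∂μ := by
  rw [L2.inner_def]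
  refine integral_congr_ae ?_
  filter_upwards [hf.coeFn_toLp, hh.coeFn_toLp] with x h1 h2
  rw [h1, h2, RCLike.inner_apply, mul_comm]

variable {n : ℕ} {S : Type*} [TopologicalSpace S] [ChartedSpace (EuclideanSpace ℝ (Fin n)) S]

variable (n S) in
/-- The space of smooth complex-valued functions. -/
def smoothFun : Submodule ℂ (S → ℂ) where
  carrier := {u | ContMDiff (𝓡 n) 𝓘(ℝ, ℂ) ∞ u}
  add_mem' hu hv := ContMDiff.add hu hv
  zero_mem' := contMDiff_const
  smul_mem' c _ hu := (contDiff_const_smul c).comp_contMDiff hu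

variable [IsManifold (𝓡 n) ∞ S]

lemma gradPair_add_left (g : RMetric n S) {u₁ u₂ : S → ℂ} (h₁ : ContMDiff (𝓡 n) 𝓘(ℝ, ℂ) ∞ u₁)
    (h₂ : ContMDiff (𝓡 n) 𝓘(ℝ, ℂ) ∞ u₂) (v : S → ℂ) (x : S) :
    gradPair g (fun y => u₁ y + u₂ y) v x = gradPair g u₁ v x + gradPair g u₂ v x := by
  rw [← gradPair_conj_symm g v, gradPair_add_right g v h₁ h₂, map_add, gradPair_conj_symm,
    gradPair_conj_symm]

lemma gradPair_const_mul_left (g : RMetric n S) {u : S → ℂ} (hu : ContMDiff (𝓡 n) 𝓘(ℝ, ℂ) ∞ u)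
    (c : ℂ) (v : S → ℂ) (x : S) :
    gradPair g (fun y => c * u y) v x = conj c * gradPair g u v x := by
  rw [← gradPair_conj_symm g v, gradPair_const_mul_right g v hu, map_mul, gradPair_conj_symm]

/-- The integrand of the energy form. -/
noncomputable def energyDensity (g : RMetric n S) (W : S → ℝ) (u v : S → ℂ) (x : S) : ℂ :=
  ((n : ℂ) - 1) * gradPair g u v x + W x * (conj (u x) * v x)

lemma continuous_energyDensity (g : RMetric n S) {W : S → ℝ} (hW : Continuous W) {u v : S → ℂ}
    (hu : ContMDiff (𝓡 n) 𝓘(ℝ, ℂ) ∞ u) (hv : ContMDiff (𝓡 n) 𝓘(ℝ, ℂ) ∞ v) :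
    Continuous (energyDensity g W u v) :=
  (continuous_const.mul (continuous_gradPair g hu hv)).add
    ((Complex.continuous_ofReal.comp hW).mul
      ((Complex.continuous_conj.comp hu.continuous).mul hv.continuous))

variable [CompactSpace S] [MeasurableSpace S] [BorelSpace S]

lemma memLp_riemannianVolume (g : RMetric n S) {f : S → ℂ} (hf : Continuous f) :
    MemLp f 2 (riemannianVolume g) :=
  hf.memLp_of_hasCompactSupport (HasCompactSupport.of_compactSpace f)

lemma integrable_riemannianVolume (g : RMetric n S) {F : Type*} [NormedAddCommGroup F] {f : S → F}
    (hf : Continuous f) : Integrable f (riemannianVolume g) :=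
  hf.integrable_of_hasCompactSupport (HasCompactSupport.of_compactSpace f)

/-- Smooth functions as elements of `L²`. -/
noncomputable def smoothToLp (g : RMetric n S) : smoothFun n S →ₗ[ℂ] Lp ℂ 2 (riemannianVolume g) where
  toFun u := (memLp_riemannianVolume g u.2.continuous).toLp u.1
  map_add' _ _ := rfl
  map_smul' _ _ := rfl

/-- The energy form `(n-1) ∫ ⟨du, dv⟩ + ∫ W conj(u) v`. -/
noncomputable def energyForm (g : RMetric n S) {W : S → ℝ} (hW : Continuous W) :
    smoothFun n S →ₗ⋆[ℂ] smoothFun n S →ₗ[ℂ] ℂ :=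
  LinearMap.mk₂'ₛₗ (starRingEnd ℂ) (RingHom.id ℂ)
    (fun u v => ∫ x, energyDensity g W u.1 v.1 x ∂(riemannianVolume g))
    (fun u₁ u₂ v => by
      rw [← integral_add (integrable_riemannianVolume g (continuous_energyDensity g hW u₁.2 v.2))
        (integrable_riemannianVolume g (continuous_energyDensity g hW u₂.2 v.2))]
      refine integral_congr_ae (Eventually.of_forall fun x => ?_)
      have h := gradPair_add_left g u₁.2 u₂.2 v.1 x
      change ((n : ℂ) - 1) * gradPair g (fun y => u₁.1 y + u₂.1 y) v.1 x +
        W x * (conj (u₁.1 x + u₂.1 x) * v.1 x) = _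
      simp only [h, energyDensity, map_add]
      ring)
    (fun c u v => by
      rw [smul_eq_mul, ← integral_const_mul]
      refine integral_congr_ae (Eventually.of_forall fun x => ?_)
      have h := gradPair_const_mul_left g u.2 c v.1 x
      change ((n : ℂ) - 1) * gradPair g (fun y => c * u.1 y) v.1 x +
        W x * (conj (c * u.1 x) * v.1 x) = _
      simp only [h, energyDensity, map_mul]
      ring)
    (fun u v₁ v₂ => by
      rw [← integral_add (integrable_riemannianVolume g (continuous_energyDensity g hW u.2 v₁.2))
        (integrable_riemannianVolume g (continuous_energyDensity g hW u.2 v₂.2))]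
      refine integral_congr_ae (Eventually.of_forall fun x => ?_)
      have h := gradPair_add_right g u.1 v₁.2 v₂.2 x
      change ((n : ℂ) - 1) * gradPair g u.1 (fun y => v₁.1 y + v₂.1 y) x +
        W x * (conj (u.1 x) * (v₁.1 x + v₂.1 x)) = _
      simp only [h, energyDensity]
      ring)
    (fun c u v => by
      rw [RingHom.id_apply, smul_eq_mul, ← integral_const_mul]
      refine integral_congr_ae (Eventually.of_forall fun x => ?_)
      have h := gradPair_const_mul_right g u.1 v.2 c x
      change ((n : ℂ) - 1) * gradPair g u.1 (fun y => c * v.1 y) x +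
        W x * (conj (u.1 x) * (c * v.1 x)) = _
      simp only [h, energyDensity]
      ring)

lemma energyForm_apply (g : RMetric n S) {W : S → ℝ} (hW : Continuous W) (u v : smoothFun n S) :
    energyForm g hW u v = ∫ x, energyDensity g W u.1 v.1 x ∂(riemannianVolume g) := rfl

lemma conj_energyForm (g : RMetric n S) {W : S → ℝ} (hW : Continuous W) (u v : smoothFun n S) :
    conj (energyForm g hW u v) = energyForm g hW v u := by
  rw [energyForm_apply, energyForm_apply, ← integral_conj]
  refine integral_congr_ae (Eventually.of_forall fun x => ?_)
  have h := gradPair_conj_symm g u.1 v.1 x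
  simp only [energyDensity, map_add, map_mul, map_sub, map_natCast, map_one, Complex.conj_ofReal,
    Complex.conj_conj, h]
  ring

lemma re_energyForm_self (g : RMetric n S) {W : S → ℝ} (hW : Continuous W) (u : smoothFun n S) :
    (energyForm g hW u u).re = ((n : ℝ) - 1) * ∫ x, gradNormSq g u.1 x ∂(riemannianVolume g) +
      ∫ x, W x * ‖u.1 x‖ ^ 2 ∂(riemannianVolume g) := by
  rw [energyForm_apply]
  have h1 : ∀ x, energyDensity g W u.1 u.1 x =
      ((((n : ℝ) - 1) * gradNormSq g u.1 x + W x * ‖u.1 x‖ ^ 2 : ℝ) : ℂ) := fun x => by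
    rw [energyDensity, gradPair_self, Complex.conj_mul']
    push_cast
    ring
  simp only [h1]
  rw [integral_complex_ofReal, Complex.ofReal_re, integral_add, integral_const_mul]
  · exact (integrable_riemannianVolume g (continuous_gradNormSq g u.2)).const_mul _
  · exact integrable_riemannianVolume g (hW.mul (u.2.continuous.norm.pow 2))

lemma dirichletE_eq_ofReal (g : RMetric n S) {u : S → ℂ} (hu : ContMDiff (𝓡 n) 𝓘(ℝ, ℂ) ∞ u) :
    dirichletE g u = ENNReal.ofReal (∫ x, gradNormSq g u x ∂(riemannianVolume g)) :=
  (ofReal_integral_eq_lintegral_ofReal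
    (integrable_riemannianVolume g (continuous_gradNormSq g hu))
    (Eventually.of_forall (gradNormSq_nonneg g u))).symm

/-- The energy controls the Dirichlet integral. -/
lemma integral_gradNormSq_le_energyForm (hn : 2 ≤ n) (g : RMetric n S) {W : S → ℝ}
    (hW : Continuous W) (hW0 : ∀ x, 0 ≤ W x) (u : smoothFun n S) :
    ∫ x, gradNormSq g u.1 x ∂(riemannianVolume g) ≤ (energyForm g hW u u).re := by
  have h1 : 0 ≤ ∫ x, gradNormSq g u.1 x ∂(riemannianVolume g) :=
    integral_nonneg (gradNormSq_nonneg g u.1)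
  have h2 : (2 : ℝ) ≤ n := by exact_mod_cast hn
  have h3 : 0 ≤ ∫ x, W x * ‖u.1 x‖ ^ 2 ∂(riemannianVolume g) :=
    integral_nonneg fun x => mul_nonneg (hW0 x) (sq_nonneg _)
  rw [re_energyForm_self]
  nlinarith

lemma energyForm_self_nonneg (hn : 2 ≤ n) (g : RMetric n S) {W : S → ℝ} (hW : Continuous W)
    (hW0 : ∀ x, 0 ≤ W x) (u : smoothFun n S) : 0 ≤ (energyForm g hW u u).re :=
  (integral_nonneg (gradNormSq_nonneg g u.1)).trans
    (integral_gradNormSq_le_energyForm hn g hW hW0 u)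

/-- An upper bound for the energy in terms of the `H^{1,2}` norm. -/
lemma exists_energyForm_le (g : RMetric n S) {W : S → ℝ} (hW : Continuous W) :
    ∃ B : ℝ, ∀ u : smoothFun n S, (energyForm g hW u u).re ≤
      ((n : ℝ) - 1) * ∫ x, gradNormSq g u.1 x ∂(riemannianVolume g) +
        B * ‖smoothToLp g u‖ ^ 2 := by
  obtain ⟨B, hB⟩ := (isCompact_range hW).bddAbove
  refine ⟨B, fun u => ?_⟩
  rw [re_energyForm_self]
  refine add_le_add le_rfl ?_
  have h := integral_norm_sq_eq (memLp_riemannianVolume g u.2.continuous)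
  change _ ≤ B * ‖(memLp_riemannianVolume g u.2.continuous).toLp u.1‖ ^ 2
  rw [← h, ← integral_const_mul]
  have hc : Continuous fun x => ‖u.1 x‖ ^ 2 := u.2.continuous.norm.pow 2
  exact integral_mono (integrable_riemannianVolume g (hW.mul hc))
    (integrable_riemannianVolume g (continuous_const.mul hc))
    fun x => mul_le_mul_of_nonneg_right (hB ⟨x, rfl⟩) (sq_nonneg _)

variable [T2Space S]

lemma continuous_ellipticOp (g : RMetric n S) {W : S → ℝ} (hW : Continuous W) {u : S → ℂ}
    (hu : ContMDiff (𝓡 n) 𝓘(ℝ, ℂ) ∞ u) : Continuous (ellipticOp g W u) :=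
  (continuous_const.mul (continuous_laplaceBeltrami g hu)).add
    ((Complex.continuous_ofReal.comp hW).mul hu.continuous)

/-- The energy form represents the operator, by Green's formula. -/
lemma inner_ellipticOp (g : RMetric n S) {W : S → ℝ} (hW : Continuous W) (φ u : smoothFun n S) :
    inner ℂ ((memLp_riemannianVolume g (continuous_ellipticOp g hW φ.2)).toLp _)
      (smoothToLp g u) = energyForm g hW φ u := by
  have h1 := inner_toLp_toLp (memLp_riemannianVolume g (continuous_ellipticOp g hW φ.2))
    (memLp_riemannianVolume g u.2.continuous)
  refine h1.trans ?_
  rw [energyForm_apply]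
  have hΔ := continuous_laplaceBeltrami g φ.2
  have hWc : Continuous fun x => (W x : ℂ) * (conj (φ.1 x) * u.1 x) :=
    (Complex.continuous_ofReal.comp hW).mul
      ((Complex.continuous_conj.comp φ.2.continuous).mul u.2.continuous)
  have h2 : ∀ x, conj (ellipticOp g W φ.1 x) * u.1 x =
      -((n : ℂ) - 1) * (conj (laplaceBeltrami g φ.1 x) * u.1 x) +
        W x * (conj (φ.1 x) * u.1 x) := fun x => by
    simp only [ellipticOp, map_add, map_mul, map_neg, map_sub, map_natCast, map_one,
      Complex.conj_ofReal]
    ring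
  simp only [h2, energyDensity]
  rw [integral_add, integral_add, integral_const_mul, integral_const_mul,
    integral_conj_laplaceBeltrami_mul g φ.2 u.2]
  · ring
  · exact (integrable_riemannianVolume g (continuous_gradPair g φ.2 u.2)).const_mul _
  · exact integrable_riemannianVolume g hWc
  · exact (integrable_riemannianVolume g
      ((Complex.continuous_conj.comp hΔ).mul u.2.continuous)).const_mul _
  · exact integrable_riemannianVolume g hWc

end Energy

/-! ### Friedrichs' inequality on the manifold -/

section Friedrichs

universe w

variable {n : ℕ} {S : Type w} [TopologicalSpace S] [ChartedSpace (EuclideanSpace ℝ (Fin n)) S]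
  [IsManifold (𝓡 n) ∞ S] [CompactSpace S] [MeasurableSpace S] [BorelSpace S]

/-- Friedrichs' inequality near a point, on a neighbourhood which does not depend on `ε`: the
functionals are the integrals over the cubes of a fine grid in a chart. -/
lemma exists_friedrichs_nhds (g : RMetric n S) (p : S) : ∃ U : Set S, IsOpen U ∧ p ∈ U ∧
    ∀ ε : ℝ, 0 < ε → ∃ (J : Type) (_ : Fintype J) (w K : ℝ) (ℓ : J → smoothFun n S →ₗ[ℂ] ℂ),
      0 ≤ w ∧ (∀ i u, ‖ℓ i u‖ ≤ K * ‖smoothToLp g u‖) ∧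
      ∀ u : smoothFun n S, ∫⁻ x in U, ‖u.1 x‖ₑ ^ 2 ∂(riemannianVolume g) ≤
        ENNReal.ofReal (ε * ∫ x, gradNormSq g u.1 x ∂(riemannianVolume g) +
          w * ∑ i, ‖ℓ i u‖ ^ 2) := by
  obtain ⟨R, hR, C, hC, hball, h1, h2, h3⟩ := exists_chart_comparison g p
  set c := extChartAt (𝓡 n) p p with hc
  have hsub : Metric.ball c R ⊆ (extChartAt (𝓡 n) p).target :=
    Metric.ball_subset_closedBall.trans hball
  refine ⟨chartBall (n := n) p (R / 2), isOpen_chartBall p _,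
    mem_of_mem_nhds (chartBall_mem_nhds (n := n) p (half_pos hR)), fun ε hε => ?_⟩
  -- the constant `C` enters twice: in comparing the volumes and the Dirichlet integrals
  have hδ : 0 < ε / (C.toReal ^ 2 + 1) := by positivity
  set δ := ε / (C.toReal ^ 2 + 1) with hδ_def
  obtain ⟨T, Q, V, hV0, hV, hQ, hfr⟩ := exists_friedrichs_ball c hR hδ
  have hint : ∀ u : smoothFun n S, IntegrableOn (fun y => u.1 ((extChartAt (𝓡 n) p).symm y))
      (Metric.ball c R) := fun u =>
    (((contDiffOn_comp_symm u.2 p).continuousOn.mono hball).integrableOn_compact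
      (isCompact_closedBall c R)).mono_set Metric.ball_subset_closedBall
  let ℓ : {a // a ∈ T} → smoothFun n S →ₗ[ℂ] ℂ := fun a =>
    { toFun := fun u => ∫ y in Q a, u.1 ((extChartAt (𝓡 n) p).symm y)
      map_add' := fun u v => integral_add ((hint u).mono_set (hQ a a.2).2.1)
        ((hint v).mono_set (hQ a a.2).2.1)
      map_smul' := fun z u => integral_const_mul z _ }
  refine ⟨{a // a ∈ T}, inferInstance, C.toReal * (4 * V.toReal⁻¹), √((V * C).toReal), ℓ,
    by positivity, fun a u => ?_, fun u => ?_⟩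
  · obtain ⟨hm, hs, hv⟩ := hQ a a.2
    have hu2 : ‖smoothToLp g u‖ₑ ^ 2 = ∫⁻ x, ‖u.1 x‖ₑ ^ 2 ∂(riemannianVolume g) :=
      enorm_toLp_sq (memLp_riemannianVolume g u.2.continuous)
    have hle : ‖ℓ a u‖ₑ ^ 2 ≤ V * C * ‖smoothToLp g u‖ₑ ^ 2 := by
      calc ‖ℓ a u‖ₑ ^ 2
          ≤ (∫⁻ y in Q a, ‖u.1 ((extChartAt (𝓡 n) p).symm y)‖ₑ) ^ 2 :=
            pow_le_pow_left' (enorm_integral_le_lintegral_enorm _) 2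
        _ ≤ V * ∫⁻ y in Q a, ‖u.1 ((extChartAt (𝓡 n) p).symm y)‖ₑ ^ 2 := by
            have h := sq_lintegral_le ((hint u).mono_set hs).aestronglyMeasurable.enorm
            rwa [Measure.restrict_apply_univ, hv] at h
        _ ≤ V * (C * ∫⁻ x, ‖u.1 x‖ₑ ^ 2 ∂(riemannianVolume g)) :=
            mul_le_mul' le_rfl ((lintegral_mono_set hs).trans
              (h2 (fun x => ‖u.1 x‖ₑ ^ 2) (u.2.continuous.measurable.enorm.pow_const 2)))
        _ = _ := by rw [hu2, mul_assoc]
    have h := ENNReal.toReal_mono (by finiteness) hle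
    rw [ENNReal.toReal_mul, ENNReal.toReal_pow, ENNReal.toReal_pow, toReal_enorm, toReal_enorm] at h
    refine abs_le_of_sq_le_sq' ?_ (by positivity) |>.2
    rwa [mul_pow, Real.sq_sqrt ENNReal.toReal_nonneg]
  · have hG : 0 ≤ ∫ x, gradNormSq g u.1 x ∂(riemannianVolume g) :=
      integral_nonneg (gradNormSq_nonneg g u.1)
    have hsum : ∑ a ∈ T, ‖∫ y in Q a, u.1 ((extChartAt (𝓡 n) p).symm y)‖ₑ ^ 2 =
        ENNReal.ofReal (∑ i, ‖ℓ i u‖ ^ 2) := by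
      rw [ENNReal.ofReal_sum_of_nonneg fun i _ => sq_nonneg _, ← Finset.sum_coe_sort]
      refine Finset.sum_congr rfl fun i _ => ?_
      rw [ENNReal.ofReal_pow (norm_nonneg _), ofReal_norm]
      rfl
    have hC' : C = ENNReal.ofReal C.toReal := (ENNReal.ofReal_toReal hC).symm
    have hVpos : 0 < V.toReal := ENNReal.toReal_pos hV0 hV
    have hV' : 4 * V⁻¹ = ENNReal.ofReal (4 * V.toReal⁻¹) := by
      rw [ENNReal.ofReal_mul (by norm_num), ENNReal.ofReal_inv_of_pos hVpos,
        ENNReal.ofReal_toReal hV, ENNReal.ofReal_ofNat]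
    have hS : 0 ≤ ∑ i, ‖ℓ i u‖ ^ 2 := Finset.sum_nonneg fun i _ => sq_nonneg _
    calc ∫⁻ x in chartBall (n := n) p (R / 2), ‖u.1 x‖ₑ ^ 2 ∂(riemannianVolume g)
        ≤ C * ∫⁻ y in Metric.ball c (R / 2), ‖u.1 ((extChartAt (𝓡 n) p).symm y)‖ₑ ^ 2 :=
          h1 (R / 2) (by linarith) (fun x => ‖u.1 x‖ₑ ^ 2)
            (u.2.continuous.measurable.enorm.pow_const 2)
      _ ≤ C * (ENNReal.ofReal δ * (C * dirichletE g u.1) +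
            4 * V⁻¹ * ENNReal.ofReal (∑ i, ‖ℓ i u‖ ^ 2)) := by
          refine mul_le_mul' le_rfl ((hfr _ (((contDiffOn_comp_symm u.2 p).mono hsub).of_le
            (by simp)) (hint u)).trans (add_le_add (mul_le_mul' le_rfl (h3 u.1 u.2)) ?_))
          rw [hsum]
      _ = ENNReal.ofReal (C.toReal * (δ * (C.toReal *
            ∫ x, gradNormSq g u.1 x ∂(riemannianVolume g)) +
            4 * V.toReal⁻¹ * ∑ i, ‖ℓ i u‖ ^ 2)) := by
          rw [dirichletE_eq_ofReal g u.2, hV', hC', ENNReal.toReal_ofReal ENNReal.toReal_nonneg,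
            ← ENNReal.ofReal_mul ENNReal.toReal_nonneg, ← ENNReal.ofReal_mul hδ.le,
            ← ENNReal.ofReal_mul (by positivity), ← ENNReal.ofReal_add (by positivity)
            (by positivity), ← ENNReal.ofReal_mul ENNReal.toReal_nonneg]
      _ ≤ _ := by
          refine ENNReal.ofReal_le_ofReal ?_
          have h4 : C.toReal ^ 2 * δ ≤ ε := by
            rw [hδ_def, mul_div_assoc', div_le_iff₀ (by positivity)]
            nlinarith
          have h5 := mul_le_mul_of_nonneg_right h4 hG
          linarith

/-- Friedrichs' inequality: up to an arbitrarily small multiple of the Dirichlet integral, the `L²`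
norm is controlled by finitely many bounded functionals. -/
lemma exists_friedrichs (g : RMetric n S) {ε : ℝ} (hε : 0 < ε) :
    ∃ (J : Type w) (_ : Fintype J) (w : J → ℝ) (ℓ : J → smoothFun n S →ₗ[ℂ] ℂ) (K : J → ℝ),
      (∀ i u, ‖ℓ i u‖ ≤ K i * ‖smoothToLp g u‖) ∧
      ∀ u : smoothFun n S, ‖smoothToLp g u‖ ^ 2 ≤
        ε * ∫ x, gradNormSq g u.1 x ∂(riemannianVolume g) + ∑ i, w i * ‖ℓ i u‖ ^ 2 := by
  choose U hUo hpU hU using fun p : S => exists_friedrichs_nhds g p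
  obtain ⟨t, ht⟩ := isCompact_univ.elim_finite_subcover U hUo
    fun x _ => Set.mem_iUnion.2 ⟨x, hpU x⟩
  -- the Dirichlet integral is counted once for each set of the cover
  have hη : 0 < ε / (t.card + 1) := by positivity
  set η := ε / (t.card + 1) with hη_def
  choose J hJ w K ℓ hw hK hfr using fun p => hU p η hη
  refine ⟨Σ p : t, J p, inferInstance, fun b => w b.1, fun b => ℓ b.1 b.2, fun b => K b.1,
    fun b u => hK b.1 b.2 u, fun u => ?_⟩
  set D := ∫ x, gradNormSq g u.1 x ∂(riemannianVolume g) with hD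
  have hD0 : 0 ≤ D := integral_nonneg (gradNormSq_nonneg g u.1)
  have hnn : ∀ p, 0 ≤ η * D + w p * ∑ i, ‖ℓ p i u‖ ^ 2 := fun p =>
    add_nonneg (by positivity) (mul_nonneg (hw p) (Finset.sum_nonneg fun i _ => sq_nonneg _))
  have hu2 : ‖smoothToLp g u‖ₑ ^ 2 = ∫⁻ x, ‖u.1 x‖ₑ ^ 2 ∂(riemannianVolume g) :=
    enorm_toLp_sq (memLp_riemannianVolume g u.2.continuous)
  have h1 : ‖smoothToLp g u‖ₑ ^ 2 ≤
      ENNReal.ofReal (∑ p : t, (η * D + w p * ∑ i, ‖ℓ p i u‖ ^ 2)) := by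
    calc ‖smoothToLp g u‖ₑ ^ 2
        ≤ ∫⁻ x in ⋃ p : t, U p, ‖u.1 x‖ₑ ^ 2 ∂(riemannianVolume g) := by
          rw [hu2, ← setLIntegral_univ]
          refine lintegral_mono_set fun x hx => ?_
          obtain ⟨p, hp, hx⟩ := Set.mem_iUnion₂.1 (ht hx)
          exact Set.mem_iUnion.2 ⟨⟨p, hp⟩, hx⟩
      _ ≤ ∑' p : t, ∫⁻ x in U p, ‖u.1 x‖ₑ ^ 2 ∂(riemannianVolume g) := lintegral_iUnion_le _ _
      _ ≤ _ := by
          rw [tsum_fintype, ENNReal.ofReal_sum_of_nonneg fun (p : t) _ => hnn p]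
          exact Finset.sum_le_sum fun p _ => hfr p u
  have h2 := ENNReal.toReal_le_of_le_ofReal (Finset.sum_nonneg fun (p : t) _ => hnn p) h1
  rw [ENNReal.toReal_pow, toReal_enorm, Finset.sum_add_distrib, Finset.sum_const,
    Finset.card_univ, Fintype.card_coe, nsmul_eq_mul] at h2
  have h3 : (t.card : ℝ) * (η * D) ≤ ε * D := by
    rw [← mul_assoc]
    refine mul_le_mul_of_nonneg_right ?_ hD0
    rw [hη_def, mul_div_assoc', div_le_iff₀ (by positivity)]
    nlinarith
  rw [Fintype.sum_sigma]
  simp only [Finset.mul_sum] at h2 ⊢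
  linarith

end Friedrichs

/-! ### Limits of sequences with vanishing Dirichlet integral -/

section ZeroEnergy

variable {n : ℕ} {S : Type*} [TopologicalSpace S] [ChartedSpace (EuclideanSpace ℝ (Fin n)) S]
  [IsManifold (𝓡 n) ∞ S] [CompactSpace S] [MeasurableSpace S] [BorelSpace S]

/-- An `L²` limit of smooth functions whose Dirichlet integrals tend to zero is locally constant. -/
lemma exists_ae_eq_const_nhds (g : RMetric n S) {v : S → ℂ} (hv : Measurable v) {u : ℕ → S → ℂ}
    (hu : ∀ k, ContMDiff (𝓡 n) 𝓘(ℝ, ℂ) ∞ (u k))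
    (hlim : Tendsto (fun k => ∫⁻ x, ‖u k x - v x‖ₑ ^ 2 ∂(riemannianVolume g)) atTop (𝓝 0))
    (hE : Tendsto (fun k => dirichletE g (u k)) atTop (𝓝 0)) (p : S) :
    ∃ U, IsOpen U ∧ p ∈ U ∧ ∃ c : ℂ, ∀ᵐ x ∂(riemannianVolume g).restrict U, v x = c := by
  obtain ⟨U, hU, hp, C, hC, hpoin⟩ := exists_poincare_nhds g p
  refine ⟨U, hU, hp, ?_⟩
  set ν := (riemannianVolume g).restrict U with hν
  have hpt : ∀ k x y, ‖v y - v x‖ₑ ^ 2 ≤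
      4 * (‖u k y - v y‖ₑ ^ 2 + 4 * (‖u k y - u k x‖ₑ ^ 2 + ‖u k x - v x‖ₑ ^ 2)) :=
    fun k x y => by
    have h1 : ‖v y - v x‖ₑ ≤ ‖u k y - v y‖ₑ + ‖u k y - v x‖ₑ := by
      rw [show v y - v x = (u k y - v x) - (u k y - v y) by ring, add_comm]
      exact enorm_sub_le
    have h2 : ‖u k y - v x‖ₑ ≤ ‖u k y - u k x‖ₑ + ‖u k x - v x‖ₑ := by
      rw [show u k y - v x = (u k y - u k x) + (u k x - v x) by ring]
      exact enorm_add_le _ _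
    refine (pow_le_pow_left' h1 2).trans ((ENNReal.add_sq_le_four _ _).trans ?_)
    exact mul_le_mul' le_rfl (add_le_add le_rfl
      ((pow_le_pow_left' h2 2).trans (ENNReal.add_sq_le_four _ _)))
  -- the mean oscillation of `v` is zero, as that of `u k` tends to zero by Poincaré's inequality
  have hbound : ∀ k, ∫⁻ x, ∫⁻ y, ‖v y - v x‖ₑ ^ 2 ∂ν ∂ν ≤
      4 * (ν Set.univ * (∫⁻ x, ‖u k x - v x‖ₑ ^ 2 ∂(riemannianVolume g)) +
        4 * (C * dirichletE g (u k) +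
          ν Set.univ * ∫⁻ x, ‖u k x - v x‖ₑ ^ 2 ∂(riemannianVolume g))) := fun k => by
    have huk := (hu k).continuous.measurable
    have hm1 : Measurable fun x => ‖u k x - v x‖ₑ ^ 2 := (huk.sub hv).enorm.pow_const 2
    have hm2 : Measurable fun z : S × S => ‖u k z.2 - u k z.1‖ₑ ^ 2 :=
      ((huk.comp measurable_snd).sub (huk.comp measurable_fst)).enorm.pow_const 2
    have hin : ∀ x, ∫⁻ y, 4 * (‖u k y - v y‖ₑ ^ 2 +
        4 * (‖u k y - u k x‖ₑ ^ 2 + ‖u k x - v x‖ₑ ^ 2)) ∂ν =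
        4 * ((∫⁻ y, ‖u k y - v y‖ₑ ^ 2 ∂ν) + 4 * ((∫⁻ y, ‖u k y - u k x‖ₑ ^ 2 ∂ν) +
          ‖u k x - v x‖ₑ ^ 2 * ν Set.univ)) := fun x => by
      rw [lintegral_const_mul' _ _ (by norm_num), lintegral_add_left hm1,
        lintegral_const_mul' _ _ (by norm_num), lintegral_add_right _ measurable_const,
        lintegral_const]
    have hle : ∫⁻ x, ‖u k x - v x‖ₑ ^ 2 ∂ν ≤ ∫⁻ x, ‖u k x - v x‖ₑ ^ 2 ∂(riemannianVolume g) :=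
      lintegral_mono' Measure.restrict_le_self le_rfl
    calc ∫⁻ x, ∫⁻ y, ‖v y - v x‖ₑ ^ 2 ∂ν ∂ν
        ≤ ∫⁻ x, 4 * ((∫⁻ y, ‖u k y - v y‖ₑ ^ 2 ∂ν) + 4 * ((∫⁻ y, ‖u k y - u k x‖ₑ ^ 2 ∂ν) +
          ‖u k x - v x‖ₑ ^ 2 * ν Set.univ)) ∂ν :=
          lintegral_mono fun x => (lintegral_mono (hpt k x)).trans (hin x).le
      _ = 4 * ((∫⁻ y, ‖u k y - v y‖ₑ ^ 2 ∂ν) * ν Set.univ +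
            4 * ((∫⁻ x, ∫⁻ y, ‖u k y - u k x‖ₑ ^ 2 ∂ν ∂ν) +
              (∫⁻ x, ‖u k x - v x‖ₑ ^ 2 ∂ν) * ν Set.univ)) := by
          rw [lintegral_const_mul' _ _ (by norm_num), lintegral_add_left measurable_const,
            lintegral_const, lintegral_const_mul' _ _ (by norm_num),
            lintegral_add_left hm2.lintegral_prod_right', lintegral_mul_const _ hm1]
      _ ≤ _ := by
          rw [mul_comm _ (ν Set.univ)]
          exact mul_le_mul' le_rfl (add_le_add (mul_le_mul' le_rfl hle)
            (mul_le_mul' le_rfl (add_le_add (hpoin (u k) (hu k)) (mul_le_mul' le_rfl hle))))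
  have hzero : ∫⁻ x, ∫⁻ y, ‖v y - v x‖ₑ ^ 2 ∂ν ∂ν = 0 := by
    have hfin : ν Set.univ ≠ ⊤ := measure_ne_top _ _
    have h1 := ENNReal.Tendsto.const_mul hlim (Or.inr hfin)
    have h2 := ENNReal.Tendsto.const_mul hE (Or.inr hC)
    have h3 := ENNReal.Tendsto.const_mul (a := 4) (h1.add (ENNReal.Tendsto.const_mul (a := 4)
      (h2.add h1) (Or.inr (by norm_num)))) (Or.inr (by norm_num))
    simp only [mul_zero, add_zero] at h3
    exact le_antisymm (ge_of_tendsto' h3 hbound) zero_le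
  by_cases hν0 : ν = 0
  · exact ⟨0, by rw [hν0]; simp⟩
  have hm : Measurable fun z : S × S => ‖v z.2 - v z.1‖ₑ ^ 2 :=
    ((hv.comp measurable_snd).sub (hv.comp measurable_fst)).enorm.pow_const 2
  have h1 := (lintegral_eq_zero_iff hm.lintegral_prod_right').1 hzero
  have : (ae ν).NeBot := ae_neBot.2 hν0
  -- for almost every `x` one has `v y = v x` for almost every `y`
  obtain ⟨x, hx⟩ := h1.exists
  refine ⟨v x, ?_⟩
  have h2 := (lintegral_eq_zero_iff (((hv.sub_const (v x)).enorm).pow_const 2)).1 hx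
  filter_upwards [h2] with y hy
  simpa [sub_eq_zero] using hy

/-- On a connected manifold, an `L²` limit of smooth functions whose energies tend to zero
vanishes, if the potential is not identically zero: it is locally constant, and zero where the
potential is positive. -/
lemma ae_eq_zero_of_energy_tendsto_zero [ConnectedSpace S] (g : RMetric n S) {W : S → ℝ}
    (hW : Continuous W) (hW0 : ∀ x, 0 ≤ W x) (hWne : ∃ x, W x ≠ 0) {v : S → ℂ} (hv : Measurable v)
    {u : ℕ → S → ℂ} (hu : ∀ k, ContMDiff (𝓡 n) 𝓘(ℝ, ℂ) ∞ (u k))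
    (hlim : Tendsto (fun k => ∫⁻ x, ‖u k x - v x‖ₑ ^ 2 ∂(riemannianVolume g)) atTop (𝓝 0))
    (hE : Tendsto (fun k => dirichletE g (u k)) atTop (𝓝 0))
    (hP : Tendsto (fun k => ∫ x, W x * ‖u k x‖ ^ 2 ∂(riemannianVolume g)) atTop (𝓝 0)) :
    v =ᵐ[riemannianVolume g] 0 := by
  have hloc := exists_ae_eq_const_nhds g hv hu hlim hE
  -- the set of points near which `v` vanishes is open and closed
  let O : Set S := {x | ∃ U, IsOpen U ∧ x ∈ U ∧ ∀ᵐ y ∂(riemannianVolume g).restrict U, v y = 0}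
  have hOo : IsOpen O := isOpen_iff_mem_nhds.2 fun x ⟨U, hU, hx, h⟩ =>
    mem_of_superset (hU.mem_nhds hx) fun y hy => ⟨U, hU, hy, h⟩
  have hOc : IsClosed O := by
    refine isClosed_of_closure_subset fun x hx => ?_
    obtain ⟨U, hU, hxU, c, hc⟩ := hloc x
    obtain ⟨y, hyU, U', hU', hyU', h'⟩ := mem_closure_iff.1 hx U hU hxU
    have hpos : (riemannianVolume g).restrict (U ∩ U') ≠ 0 := by
      rw [Ne, Measure.restrict_eq_zero]
      exact (hU.inter hU').measure_ne_zero _ ⟨y, hyU, hyU'⟩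
    have : (ae ((riemannianVolume g).restrict (U ∩ U'))).NeBot := ae_neBot.2 hpos
    -- the constant value of `v` near `x` is its value at almost every point of `U ∩ U'`
    obtain ⟨z, hz1, hz2⟩ := ((ae_restrict_of_ae_restrict_of_subset Set.inter_subset_left hc).and
      (ae_restrict_of_ae_restrict_of_subset Set.inter_subset_right h')).exists
    refine ⟨U, hU, hxU, ?_⟩
    rwa [← hz1, hz2] at hc
  have hOne : O.Nonempty := by
    obtain ⟨p, hp⟩ := hWne
    have hWp : 0 < W p := (hW0 p).lt_of_ne' hp
    set U : Set S := {x | W p / 2 < W x} with hU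
    have hUo : IsOpen U := isOpen_lt continuous_const hW
    refine ⟨p, U, hUo, by simp only [hU, Set.mem_ofPred_eq]; linarith, ?_⟩
    have hle : ∀ k, ∫⁻ x in U, ‖v x‖ₑ ^ 2 ∂(riemannianVolume g) ≤
        4 * (ENNReal.ofReal ((2 / W p) * ∫ x, W x * ‖u k x‖ ^ 2 ∂(riemannianVolume g)) +
          ∫⁻ x, ‖u k x - v x‖ₑ ^ 2 ∂(riemannianVolume g)) := fun k => by
      have huk := (hu k).continuous
      have hcW : Continuous fun x => (2 / W p) * (W x * ‖u k x‖ ^ 2) :=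
        continuous_const.mul (hW.mul (huk.norm.pow 2))
      have h1 : ∀ x ∈ U, ‖u k x‖ₑ ^ 2 ≤ ENNReal.ofReal ((2 / W p) * (W x * ‖u k x‖ ^ 2)) :=
        fun x hx => by
        rw [← ofReal_norm, ← ENNReal.ofReal_pow (norm_nonneg _)]
        refine ENNReal.ofReal_le_ofReal ?_
        have h2 : 1 ≤ 2 / W p * W x := by
          rw [div_mul_eq_mul_div, le_div_iff₀ hWp]
          have h3 : W p / 2 < W x := hx
          linarith
        rw [← mul_assoc]
        exact le_mul_of_one_le_left (sq_nonneg _) h2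
      calc ∫⁻ x in U, ‖v x‖ₑ ^ 2 ∂(riemannianVolume g)
          ≤ ∫⁻ x in U, 4 * (ENNReal.ofReal ((2 / W p) * (W x * ‖u k x‖ ^ 2)) +
              ‖u k x - v x‖ₑ ^ 2) ∂(riemannianVolume g) := by
            refine setLIntegral_mono' hUo.measurableSet fun x hx => ?_
            have h2 : ‖v x‖ₑ ≤ ‖u k x‖ₑ + ‖u k x - v x‖ₑ := by
              conv_lhs => rw [show v x = u k x - (u k x - v x) by ring]
              exact enorm_sub_le
            exact (pow_le_pow_left' h2 2).trans ((ENNReal.add_sq_le_four _ _).trans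
              (mul_le_mul' le_rfl (add_le_add (h1 x hx) le_rfl)))
        _ ≤ ∫⁻ x, 4 * (ENNReal.ofReal ((2 / W p) * (W x * ‖u k x‖ ^ 2)) +
              ‖u k x - v x‖ₑ ^ 2) ∂(riemannianVolume g) := setLIntegral_le_lintegral _ _
        _ = _ := by
            rw [lintegral_const_mul' _ _ (by norm_num),
              lintegral_add_left hcW.measurable.ennreal_ofReal, ← integral_const_mul,
              ofReal_integral_eq_lintegral_ofReal (integrable_riemannianVolume g hcW)
                (Eventually.of_forall fun x => mul_nonneg (by positivity)
                  (mul_nonneg (hW0 x) (sq_nonneg _)))]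
    have hzero : ∫⁻ x in U, ‖v x‖ₑ ^ 2 ∂(riemannianVolume g) = 0 := by
      have h1 := ENNReal.tendsto_ofReal (hP.const_mul (2 / W p))
      have h2 := ENNReal.Tendsto.const_mul (a := 4) (h1.add hlim) (Or.inr (by norm_num))
      simp only [mul_zero, add_zero, ENNReal.ofReal_zero] at h2
      exact le_antisymm (ge_of_tendsto' h2 hle) zero_le
    filter_upwards [(lintegral_eq_zero_iff (hv.enorm.pow_const 2)).1 hzero] with x hx
    simpa using hx
  have hO : O = Set.univ := IsClopen.eq_univ ⟨hOc, hOo⟩ hOne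
  choose U hUo hxU hU using fun x => (show x ∈ O from hO ▸ Set.mem_univ x)
  obtain ⟨t, ht⟩ := isCompact_univ.elim_finite_subcover U hUo
    fun x _ => Set.mem_iUnion.2 ⟨x, hxU x⟩
  have h := (ae_restrict_biUnion_finset_iff U t fun y => v y = 0).2 fun x _ => hU x
  rwa [Set.eq_univ_of_univ_subset ht, Measure.restrict_univ] at h

end ZeroEnergy

/-! ### The smallest eigenvalue of `-(n-1)Δ + W` -/

section Eigenvalue

variable {n : ℕ} {S : Type*} [TopologicalSpace S] [ChartedSpace (EuclideanSpace ℝ (Fin n)) S]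
  [IsManifold (𝓡 n) ∞ S] [CompactSpace S] [MeasurableSpace S] [BorelSpace S]

lemma enorm_smoothToLp_sub_sq (g : RMetric n S) (u : smoothFun n S)
    {v : S → ℂ} (hv : MemLp v 2 (riemannianVolume g)) :
    ‖smoothToLp g u - hv.toLp v‖ₑ ^ 2 = ∫⁻ x, ‖u.1 x - v x‖ₑ ^ 2 ∂(riemannianVolume g) :=
  enorm_toLp_sq ((memLp_riemannianVolume g u.2.continuous).sub hv)

lemma norm_smoothToLp_sub_sq (g : RMetric n S) (u : smoothFun n S)
    {v : S → ℂ} (hv : MemLp v 2 (riemannianVolume g)) :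
    ‖smoothToLp g u - hv.toLp v‖ ^ 2 = ∫ x, ‖u.1 x - v x‖ ^ 2 ∂(riemannianVolume g) :=
  (integral_norm_sq_eq ((memLp_riemannianVolume g u.2.continuous).sub hv)).symm

lemma exists_smoothToLp_ne_zero [Nonempty S] (g : RMetric n S) :
    ∃ u : smoothFun n S, smoothToLp g u ≠ 0 := by
  refine ⟨⟨fun _ => 1, contMDiff_const⟩, fun h => ?_⟩
  have h1 : (fun _ : S => (1 : ℂ)) =ᵐ[riemannianVolume g] 0 :=
    ((memLp_riemannianVolume g continuous_const).toLp_eq_toLp_iff MemLp.zero).1 h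
  have : (ae (riemannianVolume g)).NeBot := ae_neBot.2 fun h0 =>
    isOpen_univ.measure_ne_zero (riemannianVolume g) Set.univ_nonempty (by rw [h0]; simp)
  obtain ⟨x, hx⟩ := h1.exists
  exact one_ne_zero hx

lemma tendsto_sq_nhds_zero {α : Type*} {l : Filter α} {f : α → ℝ}
    (h : Tendsto (fun a => f a ^ 2) l (𝓝 0)) : Tendsto f l (𝓝 0) := by
  have h1 := h.sqrt
  simp only [Real.sqrt_sq_eq_abs, Real.sqrt_zero] at h1
  exact (tendsto_zero_iff_abs_tendsto_zero f).2 h1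

/-- Every eigenvalue is at least any lower bound of the Rayleigh quotient. -/
lemma IsEigenvalue.le [T2Space S] (hn : 2 ≤ n) {g : RMetric n S} {W : S → ℝ} (hW : Continuous W)
    (hW0 : ∀ x, 0 ≤ W x) {μ : ℝ} (hμ : IsEigenvalue g W μ) {μ₀ : ℝ}
    (hmin : ∀ w : smoothFun n S, μ₀ * ‖smoothToLp g w‖ ^ 2 ≤ (energyForm g hW w w).re) :
    μ₀ ≤ μ := by
  obtain ⟨v, ⟨hv, u, hu, hlim, hgrad⟩, hv0, hweak⟩ := hμ
  let U : ℕ → smoothFun n S := fun k => ⟨u k, hu k⟩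
  have hU : Tendsto (fun k => smoothToLp g (U k)) atTop (𝓝 (hv.toLp v)) := by
    refine tendsto_iff_norm_sub_tendsto_zero.2 (tendsto_sq_nhds_zero ?_)
    simpa only [norm_smoothToLp_sub_sq] using hlim
  refine le_of_weak_eigenvector (conj_energyForm g hW) (energyForm_self_nonneg hn g hW hW0)
    (smoothToLp g) (inner_ellipticOp g hW) hmin (v := hv.toLp v) (u := U) ?_ hU ?_ fun φ => ?_
  · exact fun h => hv0 ((hv.toLp_eq_toLp_iff MemLp.zero).1 (h.trans (MemLp.toLp_zero _).symm))
  · obtain ⟨B, hB⟩ := exists_energyForm_le g hW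
    have h1 := ((cauchySeq_iff_tendsto_dist_atTop_0.1 hU.cauchySeq).pow 2).const_mul B
    have h2 := (hgrad.const_mul ((n : ℝ) - 1)).add h1
    simp only [ne_eq, OfNat.ofNat_ne_zero, not_false_eq_true, zero_pow, mul_zero, add_zero] at h2
    refine squeeze_zero (fun kl => energyForm_self_nonneg hn g hW hW0 _) (fun kl => ?_) h2
    rw [dist_eq_norm, ← map_sub]
    exact hB (U kl.1 - U kl.2)
  · rw [inner_toLp_toLp]
    refine (hweak φ.1 φ.2).trans (congrArg _ ?_)
    exact (inner_toLp_toLp (memLp_riemannianVolume g φ.2.continuous) hv).symm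

/-- On a closed connected manifold the operator `-(n-1)Δ + W` with a nonnegative potential which
does not vanish identically has a smallest eigenvalue, and it is positive. -/
theorem exists_isLeast_eigenvalue_pos [T2Space S] [ConnectedSpace S] (hn : 2 ≤ n) (g : RMetric n S)
    {W : S → ℝ} (hW : Continuous W) (hW0 : ∀ x, 0 ≤ W x) (hWne : ∃ x, W x ≠ 0) :
    ∃ μ₀ : ℝ, IsLeast {μ : ℝ | IsEigenvalue g W μ} μ₀ ∧ 0 < μ₀ := by
  have hnn := energyForm_self_nonneg hn g hW hW0
  have hgradle := integral_gradNormSq_le_energyForm hn g hW hW0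
  obtain ⟨μ₀, v, u, hv1, hmin, hlim, hsub, hQ, hEL⟩ := exists_minimizer (conj_energyForm g hW) hnn
    (smoothToLp g) (fun ε hε => by
      obtain ⟨J, hJ, w, ℓ, K, hK, hfr⟩ := exists_friedrichs g hε
      exact ⟨J, hJ, w, ℓ, K, hK, fun u => (hfr u).trans
        (add_le_add (mul_le_mul_of_nonneg_left (hgradle u) hε.le) le_rfl)⟩)
    (exists_smoothToLp_ne_zero g)
  have hv : MemLp v 2 (riemannianVolume g) := Lp.memLp v
  have hvv : hv.toLp v = v := Lp.toLp_coeFn v hv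
  have hvne : ¬ (v =ᵐ[riemannianVolume g] 0) := fun h => by
    rw [← hvv, (hv.toLp_eq_toLp_iff MemLp.zero).2 h, MemLp.toLp_zero, norm_zero] at hv1
    exact zero_ne_one hv1
  have hdist : Tendsto (fun k => ‖smoothToLp g (u k) - hv.toLp v‖ ^ 2) atTop (𝓝 0) := by
    rw [hvv]
    simpa using (tendsto_iff_norm_sub_tendsto_zero.1 hlim).pow 2
  refine ⟨μ₀, ⟨⟨v, ⟨hv, fun k => (u k).1, fun k => (u k).2, ?_, ?_⟩, hvne, fun φ hφ => ?_⟩,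
    fun μ hμ => hμ.le hn hW hW0 hmin⟩, ?_⟩
  · simpa only [norm_smoothToLp_sub_sq] using hdist
  · exact squeeze_zero (fun kl => integral_nonneg (gradNormSq_nonneg g _))
      (fun kl => hgradle (u kl.1 - u kl.2)) hsub
  · let Φ : smoothFun n S := ⟨φ, hφ⟩
    have h1 := inner_toLp_toLp (memLp_riemannianVolume g (continuous_ellipticOp g hW hφ)) hv
    have h2 := inner_toLp_toLp (memLp_riemannianVolume g hφ.continuous) hv
    rw [hvv] at h1 h2
    rw [← h1, ← h2]
    refine tendsto_nhds_unique (tendsto_const_nhds.inner hlim) ?_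
    have h3 := hEL Φ
    simp only [← inner_ellipticOp] at h3
    exact h3
  · have hμ0 : 0 ≤ μ₀ := ge_of_tendsto' hQ fun k => hnn (u k)
    -- if `μ₀ = 0`, the energies of the minimizing sequence tend to zero, so that its limit vanishes
    refine hμ0.lt_of_ne' fun h0 => hvne ?_
    rw [h0] at hQ
    have hgrad : Tendsto (fun k => ∫ x, gradNormSq g (u k).1 x ∂(riemannianVolume g)) atTop
        (𝓝 0) :=
      squeeze_zero (fun k => integral_nonneg (gradNormSq_nonneg g _)) (fun k => hgradle (u k)) hQ
    refine ae_eq_zero_of_energy_tendsto_zero g hW hW0 hWne (Lp.stronglyMeasurable v).measurable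
      (u := fun k => (u k).1) (fun k => (u k).2) ?_ ?_ ?_
    · have h1 := ENNReal.tendsto_ofReal hdist
      simpa only [ENNReal.ofReal_pow (norm_nonneg _), ofReal_norm, enorm_smoothToLp_sub_sq,
        ENNReal.ofReal_zero] using h1
    · have h1 := ENNReal.tendsto_ofReal hgrad
      simpa only [← dirichletE_eq_ofReal g (u _).2, ENNReal.ofReal_zero] using h1
    · refine squeeze_zero (fun k => integral_nonneg fun x => mul_nonneg (hW0 x) (sq_nonneg _))
        (fun k => ?_) hQ
      rw [re_energyForm_self]
      have h2 : (2 : ℝ) ≤ n := by exact_mod_cast hn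
      have h3 : 0 ≤ ∫ x, gradNormSq g (u k).1 x ∂(riemannianVolume g) :=
        integral_nonneg (gradNormSq_nonneg g _)
      nlinarith

end Eigenvalue

/-! ### The potentials of the theorem -/

section Potentials

variable {n : ℕ} {S : Type*} [TopologicalSpace S] [ChartedSpace (EuclideanSpace ℝ (Fin n)) S]
  [IsManifold (𝓡 n) ∞ S] {k : ℕ} {G : Type*} [TopologicalSpace G]
  [ChartedSpace (EuclideanSpace ℝ (Fin k)) G] [Group G] [LieGroup (𝓡 k) ∞ G] {ι : Type*}
  {Z : VectorBundleCore ℝ S (EuclideanSpace ℝ (Fin k)) ι}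

lemma continuous_ymPotential [Z.IsContMDiff (𝓡 n) ∞] (g : RMetric n S)
    (A : AdConnection G (n := n) Z) (α₁ : ℝ) : Continuous (ymPotential g A α₁) :=
  (continuous_const.mul (continuous_scalarCurvature g)).add
    (continuous_const.mul (continuous_curvSq A g))

lemma ymPotential_le_scalarPotential (g : RMetric n S) (A : AdConnection G (n := n) Z)
    (Φ : S → ℝ) {V : ℝ → ℝ} (hV : ∀ s, 0 ≤ V s) (α₁ : ℝ) {α₂ m : ℝ} (hα₂ : 0 < α₂) (hm : 0 ≤ m)
    (x : S) : ymPotential g A α₁ x ≤ scalarPotential g A Φ V α₁ α₂ m x := by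
  have h1 := mul_nonneg (show 0 ≤ α₂ * ((n : ℝ) / 4) by positivity)
    (gradNormSq_nonneg g (fun y => (Φ y : ℂ)) x)
  have h2 := mul_nonneg (show 0 ≤ α₂ * ((n : ℝ) / 2) * m by positivity) (hV (Φ x))
  exact (le_add_of_nonneg_right h1).trans (le_add_of_nonneg_right h2)

lemma continuous_higgsPotential [Z.IsContMDiff (𝓡 n) ∞] (hZ : HasAdStructureGroup G Z)
    (g : RMetric n S) (A : AdConnection G (n := n) Z) {Φ : (x : S) → Z.Fiber x}
    {V : TotalSpace (EuclideanSpace ℝ (Fin k)) Z.Fiber → ℝ}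
    (hΦ : ContMDiff (𝓡 n) ((𝓡 n).prod 𝓘(ℝ, EuclideanSpace ℝ (Fin k))) ∞
      (fun x => TotalSpace.mk' (EuclideanSpace ℝ (Fin k)) x (Φ x)))
    (hV : ContMDiff ((𝓡 n).prod 𝓘(ℝ, EuclideanSpace ℝ (Fin k))) 𝓘(ℝ, ℝ) ∞ V) (α₁ α₂ m : ℝ) :
    Continuous (higgsPotential g A Φ V α₁ α₂ m) :=
  ((continuous_ymPotential g A α₁).add (continuous_const.mul (continuous_higgsSq hZ A g hΦ))).add
    (continuous_const.mul (hV.continuous.comp hΦ.continuous))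

lemma continuous_scalarPotential [Z.IsContMDiff (𝓡 n) ∞] (g : RMetric n S)
    (A : AdConnection G (n := n) Z) {Φ : S → ℝ} {V : ℝ → ℝ} (hΦ : ContMDiff (𝓡 n) 𝓘(ℝ, ℝ) ∞ Φ)
    (hV : ContDiff ℝ ∞ V) (α₁ α₂ m : ℝ) : Continuous (scalarPotential g A Φ V α₁ α₂ m) :=
  ((continuous_ymPotential g A α₁).add (continuous_const.mul (continuous_gradNormSq g
    (Complex.ofRealCLM.contDiff.comp_contMDiff hΦ)))).add
    (continuous_const.mul (hV.continuous.comp hΦ.continuous))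

variable [CompactSpace G]

lemma ymPotential_nonneg (g : RMetric n S) (A : AdConnection G (n := n) Z) {α₁ : ℝ} (hα₁ : 0 < α₁)
    (hR : ∀ x, scalarCurvature g x ≤ 0) (x : S) : 0 ≤ ymPotential g A α₁ x := by
  have h1 := mul_nonneg (show 0 ≤ (n : ℝ) / 2 by positivity) (neg_nonneg.2 (hR x))
  have h2 := mul_nonneg (show 0 ≤ α₁ * ((n : ℝ) / 8) by positivity) (curvSq_nonneg A g x)
  rw [ymPotential]
  linarith

/-- There is no cancellation between the two terms, as both are nonnegative. -/
lemma exists_ymPotential_ne_zero (hn : 0 < n) (g : RMetric n S) (A : AdConnection G (n := n) Z)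
    {α₁ : ℝ} (hα₁ : 0 < α₁) (hR : ∀ x, scalarCurvature g x ≤ 0)
    (hRF : (∃ x, scalarCurvature g x ≠ 0) ∨ (∃ x, A.curvSq g x ≠ 0)) :
    ∃ x, ymPotential g A α₁ x ≠ 0 := by
  have hn' : (0 : ℝ) < n := by exact_mod_cast hn
  obtain ⟨x, hx⟩ | ⟨x, hx⟩ := hRF
  · have h1 := mul_pos (show 0 < (n : ℝ) / 2 by positivity)
      (neg_pos.2 ((hR x).lt_of_ne hx))
    have h2 := mul_nonneg (show 0 ≤ α₁ * ((n : ℝ) / 8) by positivity) (curvSq_nonneg A g x)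
    refine ⟨x, ne_of_gt ?_⟩
    rw [ymPotential]
    linarith
  · have h1 := mul_nonneg (show 0 ≤ (n : ℝ) / 2 by positivity) (neg_nonneg.2 (hR x))
    have h2 := mul_pos (show 0 < α₁ * ((n : ℝ) / 8) by positivity)
      ((curvSq_nonneg A g x).lt_of_ne' hx)
    refine ⟨x, ne_of_gt ?_⟩
    rw [ymPotential]
    linarith

lemma ymPotential_le_higgsPotential (g : RMetric n S) (A : AdConnection G (n := n) Z)
    (Φ : (x : S) → Z.Fiber x) {V : TotalSpace (EuclideanSpace ℝ (Fin k)) Z.Fiber → ℝ}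
    (hV : ∀ e, 0 ≤ V e) (α₁ : ℝ) {α₂ m : ℝ} (hα₂ : 0 < α₂) (hm : 0 ≤ m) (x : S) :
    ymPotential g A α₁ x ≤ higgsPotential g A Φ V α₁ α₂ m x := by
  have h1 := mul_nonneg (show 0 ≤ α₂ * ((n : ℝ) / 4) by positivity) (higgsSq_nonneg A g Φ x)
  have h2 := mul_nonneg (show 0 ≤ α₂ * ((n : ℝ) / 2) * m by positivity) (hV ⟨x, Φ x⟩)
  exact (le_add_of_nonneg_right h1).trans (le_add_of_nonneg_right h2)

end Potentials

theorem mainTheorem2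
    {n : ℕ} (hn : 2 ≤ n)
    {S : Type*} [TopologicalSpace S] [ChartedSpace (EuclideanSpace ℝ (Fin n)) S]
    [IsManifold (𝓡 n) ∞ S] [T2Space S] [CompactSpace S] [ConnectedSpace S]
    [MeasurableSpace S] [BorelSpace S]
    (g : RMetric n S)
    {k : ℕ} {G : Type*} [TopologicalSpace G] [ChartedSpace (EuclideanSpace ℝ (Fin k)) G]
    [Group G] [LieGroup (𝓡 k) ∞ G] [T2Space G] [CompactSpace G] [ConnectedSpace G]
    [LieAlgebra.IsSemisimple ℝ (GroupLieAlgebra (𝓡 k) G)]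
    {ι : Type*} (Z : VectorBundleCore ℝ S (EuclideanSpace ℝ (Fin k)) ι)
    [Z.IsContMDiff (𝓡 n) ∞] (hZ : HasAdStructureGroup G Z)
    (A : AdConnection G (n := n) Z)
    (α₁ : ℝ) (hα₁ : 0 < α₁)
    (hR : ∀ x, scalarCurvature g x ≤ 0)
    (hRF : (∃ x, scalarCurvature g x ≠ 0) ∨ (∃ x, A.curvSq g x ≠ 0)) :
    (∃ μ₀ : ℝ, IsLeast {μ : ℝ | IsEigenvalue g (ymPotential g A α₁) μ} μ₀ ∧ 0 < μ₀) ∧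
    (∀ (α₂ m : ℝ), 0 < α₂ → 0 ≤ m →
      (∀ (Φ : (x : S) → Z.Fiber x) (V : TotalSpace (EuclideanSpace ℝ (Fin k)) Z.Fiber → ℝ),
        ContMDiff (𝓡 n) ((𝓡 n).prod 𝓘(ℝ, EuclideanSpace ℝ (Fin k))) ∞
          (fun x => TotalSpace.mk' (EuclideanSpace ℝ (Fin k)) x (Φ x)) →
        ContMDiff ((𝓡 n).prod 𝓘(ℝ, EuclideanSpace ℝ (Fin k))) 𝓘(ℝ, ℝ) ∞ V →
        (∀ e, 0 ≤ V e) →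
        ∃ μ₀ : ℝ, IsLeast {μ : ℝ | IsEigenvalue g (higgsPotential g A Φ V α₁ α₂ m) μ} μ₀ ∧
          0 < μ₀) ∧
      (∀ (Φ : S → ℝ) (V : ℝ → ℝ),
        ContMDiff (𝓡 n) 𝓘(ℝ, ℝ) ∞ Φ → ContDiff ℝ ∞ V → (∀ s, 0 ≤ V s) →
        ∃ μ₀ : ℝ, IsLeast {μ : ℝ | IsEigenvalue g (scalarPotential g A Φ V α₁ α₂ m) μ} μ₀ ∧
          0 < μ₀)) := by
  have h0 := ymPotential_nonneg g A hα₁ hR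
  obtain ⟨x₀, hx₀⟩ := exists_ymPotential_ne_zero (by lia) g A hα₁ hR hRF
  have hpos : 0 < ymPotential g A α₁ x₀ := (h0 x₀).lt_of_ne' hx₀
  -- a continuous potential bounded below by `ymPotential` is nonnegative and not identically zero
  have key : ∀ W : S → ℝ, Continuous W → (∀ x, ymPotential g A α₁ x ≤ W x) →
      ∃ μ₀ : ℝ, IsLeast {μ : ℝ | IsEigenvalue g W μ} μ₀ ∧ 0 < μ₀ := fun W hW hle =>
    exists_isLeast_eigenvalue_pos hn g hW (fun x => (h0 x).trans (hle x))
      ⟨x₀, (hpos.trans_le (hle x₀)).ne'⟩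
  exact ⟨key _ (continuous_ymPotential g A α₁) fun _ => le_rfl, fun α₂ m hα₂ hm =>
    ⟨fun Φ V hΦ hV hV0 => key _ (continuous_higgsPotential hZ g A hΦ hV α₁ α₂ m)
      (ymPotential_le_higgsPotential g A Φ hV0 α₁ hα₂ hm),
    fun Φ V hΦ hV hV0 => key _ (continuous_scalarPotential g A hΦ hV α₁ α₂ m)
      (ymPotential_le_scalarPotential g A Φ hV0 α₁ hα₂ hm)⟩⟩
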